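/- **Theorem 4 (Risk convergence).** Let $T>0$, let $d\ge 1$ and $q\ge 0$ be integers, and let $(X,z,y)$ be random, where $X:[0,T]\to\mathbb R^{d-1}$ is a continuous path with a fixed (deterministic) initial value $X_0$, $z\in\mathbb R^q$ and $y\in\{0,1\}$. Suppose that $$\operatorname{Logit}\mathbb P(y=1\mid X,z)=F(X)+z^\top\gamma ,$$ where $F:C([0,T];\mathbb R^{d-1})\to\mathbb R$ is continuous and $\gamma\in\mathbb R^q$. *Notation.* Write $\tilde X_t=(X_t,t)\in\mathbb R^d$. For a path of bounded variation and $I=(i_1,\dots,i_k)\in\{1,\dots,d\}^k$ let $S^I(\tilde X)=\int_{0<t_1<\dots<t_k<T}d\tilde X^{i_1}_{t_1}\cdots d\tilde X^{i_k}_{t_k}$ (equal to $1$ for $k=0$), let $S_p(\tilde X)=(S^I(\tilde X):|I|\le p)$ be the signature truncated at order $p$, and $s_d(p)=\sum_{k=0}^p d^k$ its dimension. Put $\ell(y,\eta)=-y\eta+\log(1+e^\eta)$ and, for $\theta\in\mathbb R^{s_d(p)+q}$, $$\mathcal R_p(\theta)=\mathbb E\,\ell\big(y,\langle (S_p(\tilde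 X),z),\theta\rangle\big),\qquad B_{p,r}=\{\theta\in\mathbb R^{s_d(p)+q}:\|\theta\|_1\le r\},\qquad L(p)=\min_{\theta\in B_{p,r}}\mathcal R_p(\theta).$$ *Assumptions.* - (A.1) $\|F\|_\infty<C_F$ and $\|\gamma\|_1\le C_\gamma$, with constants $C_F,C_\gamma>0$. - (A.2) $\|X\|_{\mathrm{TV}}<C_X$ and $\|z\|<C_z$ almost surely (Euclidean norms), with constants $C_X,C_z>0$. - (A.3) There is a smallest order $p^*\in\mathbb N=\{0,1,\dots\}$ for which some $\theta$ satisfies $\mathcal R_{p^*}(\theta)=\inf_{p,\theta_p}\mathcal R_p(\theta_p)$ (infimum over all $p\in\mathbb N$ and all $\theta_p\in\mathbb R^{s_d(p)+q}$); and $r>0$ is such that some such minimizer $\theta^*_{p^*}$ lies in $B_{p^*,r}$. Put $\widetilde{\mathcal R}^*=\mathcal R_{p^*}(\theta^*_{p^*})$. - (A.4) $\mathcal R^*\le\inf_{p,\theta_p}\mathcal R_p(\theta_p)$, where $\mathcal R^*$ is the infimum of $\mathbb E\,\ell(y,G(X)+z^\top g)$ over all continuous $G:C([0,T];\mathbb R^{d-1})\to\mathbb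 R$ with $\|G\|_\infty\le C_F$ and all $g\in\mathbb R^q$ with $\|g\|_1\le C_\gamma$. *Estimators.* Let $(X_i,z_i,y_i)$, $1\le i\le n$, be i.i.d. copies of $(X,z,y)$, let $\widehat{\mathcal R}_{p,n}(\theta)=\frac1n\sum_{i=1}^n\ell(y_i,\langle(S_p(\tilde X_i),z_i),\theta\rangle)$, let $\widehat\theta_p$ be any (measurable) minimizer of $\widehat{\mathcal R}_{p,n}$ over $B_{p,r}$, and let $\widehat L_n(p)=\min_{B_{p,r}}\widehat{\mathcal R}_{p,n}$. For $C_{\mathrm{pen}}>0$ and $\rho\in(0,\frac12)$ let $\widehat p$ be the smallest minimizer over $p\in\mathbb N$ of $\widehat L_n(p)+C_{\mathrm{pen}}\sqrt{s_d(p)e^q}\,n^{-\rho}$. *Constants.* Let $C=2(C_z+e^{C_X+T})$, $\tilde\rho=\min(\rho,\frac12-\rho)$, and let $n^*$ be the smallest integer with $$(n^*)^{\tilde\rho}\ \ge\ \big(432\sqrt\pi\,rC+C_{\mathrm{pen}}\sqrt{e^q}\big)\left(\frac{2\sqrt{s_d(p^*+1)+q}}{L(p^*-1)-\widetilde{\mathcal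 R}^*}+\frac{\sqrt{2s_d(p^*+1)+2q}}{C_{\mathrm{pen}}\sqrt{e^qd^{p^*+1}}}\right),$$ $$c_0=\frac{C_{\mathrm{pen}}^2d^{p^*+1}e^q}{256\,rC(36rC+1)\,s_d(p^*+1)},\qquad c_1=74\sum_{p>0}e^{-c_0s_d(p)}+148\,p^*,$$ $$c_2=\frac1{256\,rC(36rC+1)}\min\left\{\frac{C_{\mathrm{pen}}^2d^{p^*+1}e^q}{s_d(p^*+1)},\ \frac{(L(p^*-1)-\widetilde{\mathcal R}^*)^2}4\right\},$$ $$c_3=36\,rC\sqrt\pi\,(p^*+1)\sqrt{s_d(p^*)+q},\qquad c_4=rC\Big(2664\sqrt\pi\sum_{p>p^*}\sqrt{s_d(p)+q}\;e^{-c_0s_d(p)}+c_1\Big)+c_1\log 2,$$ where for $p^*=0$ one reads $L(-1)=+\infty$, i.e. the terms containing $L(p^*-1)$ are omitted from the sum and from the minimum. *Conclusion.* For all $n\ge n^*$, the random variable $\mathcal R_{\widehat p}(\widehat\theta_{\widehat p})$ is integrable and $$\Big|\mathbb E\big[\mathcal R_{\widehat p}(\widehat\theta_{\widehat p})\big]-\mathcal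 R^*\Big|\ \le\ \frac{c_3}{\sqrt n}+c_4\,e^{-c_2n^{1-2\rho}} .$$ -/

import Mathlib

open MeasureTheory ProbabilityTheory Set
open scoped NNReal ENNReal

noncomputable section

namespace PSLR

/-! ### Riemann–Stieltjes integrals and path signatures -/

/-- `J` is the Riemann–Stieltjes integral of `f` against `g` over `[a, b]`: the tagged sums
`∑ i < N, f (ξ i) * (g (t (i+1)) - g (t i))` over partitions `a = t 0 ≤ ⋯ ≤ t N = b` with tags
`ξ i ∈ [t i, t (i+1)]` converge to `J` as the mesh of the partition tends to `0`. -/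
def HasRSIntegral (f g : ℝ → ℝ) (a b J : ℝ) : Prop :=
  ∀ ε > 0, ∃ δ > 0, ∀ (N : ℕ) (t ξ : ℕ → ℝ), Monotone t → t 0 = a → t N = b →
    (∀ i < N, t (i + 1) - t i < δ) → (∀ i < N, ξ i ∈ Icc (t i) (t (i + 1))) →
    |∑ i ∈ Finset.range N, f (ξ i) * (g (t (i + 1)) - g (t i)) - J| < ε

open Classical in
/-- The Riemann–Stieltjes integral `∫_a^b f dg` (with value `0` if it does not exist). -/
def rsIntegral (f g : ℝ → ℝ) (a b : ℝ) : ℝ :=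
  if h : ∃ J, HasRSIntegral f g a b J then h.choose else 0

/-- The iterated integral `∫_{0 < t₁ < ⋯ < t_k < t} dX^{i₁}_{t₁} ⋯ dX^{i_k}_{t_k}` of a path
`X : ℝ → ℝ^d`, for the multi-index `I = (i₁, …, i_k)`; the outermost integration is in `t_k`. -/
def iterInt {d : ℕ} (X : ℝ → Fin d → ℝ) : (k : ℕ) → (Fin k → Fin d) → ℝ → ℝ
  | 0, _ => fun _ => 1
  | k + 1, I => fun t =>
      rsIntegral (iterInt X k (Fin.init I)) (fun s => X s (I (Fin.last k))) 0 t

/-- Continuous paths `[0, T] → ℝ^m` (Euclidean norm on `ℝ^m`, uniform topology on paths). -/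
abbrev CPath (m : ℕ) (T : ℝ≥0) : Type := C(Icc (0 : ℝ) T, EuclideanSpace ℝ (Fin m))

instance instMeasurableSpaceCPath (m : ℕ) (T : ℝ≥0) : MeasurableSpace (CPath m T) :=
  borel (CPath m T)

instance instBorelSpaceCPath (m : ℕ) (T : ℝ≥0) : BorelSpace (CPath m T) := ⟨rfl⟩

/-- The time-augmented path `(X_t, t)` in `ℝ^{m+1}` (constantly extended in `X` outside `[0, T]`). -/
def augment {m : ℕ} {T : ℝ≥0} (x : CPath m T) (t : ℝ) : Fin (m + 1) → ℝ :=
  Fin.snoc (α := fun _ => ℝ) (fun i => IccExtend T.2 x t i) t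

/-- Multi-indices over `{1, …, d}` of length at most `p`. -/
abbrev Word (d p : ℕ) : Type := Σ k : Fin (p + 1), (Fin k → Fin d)

/-- The number `s_d(p) = 1 + d + ⋯ + d^p` of signature terms of order at most `p`. -/
def sigDim (d p : ℕ) : ℕ := ∑ k ∈ Finset.range (p + 1), d ^ k

/-- The truncated signature of order `p` of the time-augmented path. -/
def truncSig {m : ℕ} {T : ℝ≥0} (p : ℕ) (x : CPath m T) (I : Word (m + 1) p) : ℝ :=
  iterInt (augment x) I.1 I.2 T

/-! ### Data, parameters and risks.  The augmented path dimension is `d = m + 1`. -/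

/-- An observation `(X, z, y)`: path, scalar covariates, binary response. -/
abbrev Obs (m q : ℕ) (T : ℝ≥0) : Type := CPath m T × EuclideanSpace ℝ (Fin q) × Bool

/-- The response as a real number in `{0, 1}`. -/
def label {m q : ℕ} {T : ℝ≥0} (o : Obs m q T) : ℝ := if o.2.2 then 1 else 0

/-- The covariates `(X, z)` of an observation. -/
def covariates {m q : ℕ} {T : ℝ≥0} (o : Obs m q T) : CPath m T × EuclideanSpace ℝ (Fin q) :=
  (o.1, o.2.1)

/-- Parameter vectors `θ_p = (β_p, γ) ∈ ℝ^{s_d(p) + q}` with `d = m + 1`. -/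
abbrev Param (m q p : ℕ) : Type := (Word (m + 1) p ⊕ Fin q) → ℝ

/-- The linear predictor `⟨(S_p(X̃), z), θ⟩`. -/
def linPred {m q : ℕ} {T : ℝ≥0} (p : ℕ) (o : Obs m q T) (θ : Param m q p) : ℝ :=
  ∑ j, Sum.elim (truncSig p o.1) (fun l => o.2.1 l) j * θ j

/-- The logistic loss `-y η + log (1 + e^η)`. -/
def logisticLoss (y η : ℝ) : ℝ := -y * η + Real.log (1 + Real.exp η)

/-- The population risk `R_p(θ)` under the joint law `P` of `(X, z, y)`. -/
def popRisk {m q : ℕ} {T : ℝ≥0} (P : Measure (Obs m q T)) (p : ℕ) (θ : Param m q p) : ℝ :=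
  ∫ o, logisticLoss (label o) (linPred p o θ) ∂P

/-- The population risk of the semi-parametric model with log-odds `F(X) + zᵀγ`. -/
def semiRisk {m q : ℕ} {T : ℝ≥0} (P : Measure (Obs m q T))
    (F : BoundedContinuousFunction (CPath m T) ℝ) (γ : Fin q → ℝ) : ℝ :=
  ∫ o, logisticLoss (label o) (F o.1 + ∑ l, o.2.1 l * γ l) ∂P

/-- The minimal risk `R*` of the semi-parametric model, over continuous `F` with `‖F‖_∞ ≤ C_F`
and `γ` with `‖γ‖₁ ≤ C_γ`. -/
def minSemiRisk {m q : ℕ} {T : ℝ≥0} (P : Measure (Obs m q T)) (CF Cγ : ℝ) : ℝ :=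
  sInf {R | ∃ (F : BoundedContinuousFunction (CPath m T) ℝ) (γ : Fin q → ℝ),
    ‖F‖ ≤ CF ∧ ∑ l, |γ l| ≤ Cγ ∧ R = semiRisk P F γ}

/-- `inf_{p, θ_p} R_p(θ_p)` over all orders and all (unconstrained) parameters. -/
def infRisk {m q : ℕ} {T : ℝ≥0} (P : Measure (Obs m q T)) : ℝ :=
  ⨅ s : (Σ p : ℕ, Param m q p), popRisk P s.1 s.2

/-- The `ℓ¹`-ball `B_{p,r}`. -/
def l1Ball (m q p : ℕ) (r : ℝ) : Set (Param m q p) := {θ | ∑ j, |θ j| ≤ r}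

/-- `L(p) = min_{θ ∈ B_{p,r}} R_p(θ)`. -/
def popMin {m q : ℕ} {T : ℝ≥0} (P : Measure (Obs m q T)) (r : ℝ) (p : ℕ) : ℝ :=
  sInf (popRisk P p '' l1Ball m q p r)

/-! ### Estimators -/

/-- The empirical risk of the sample `o₁, …, o_n`. -/
def empRisk {m q n : ℕ} {T : ℝ≥0} (o : Fin n → Obs m q T) (p : ℕ) (θ : Param m q p) : ℝ :=
  (1 / (n : ℝ)) * ∑ i, logisticLoss (label (o i)) (linPred p (o i) θ)

/-- `θ` minimizes the empirical risk of order `p` over `B_{p,r}`. -/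
def IsERM {m q n : ℕ} {T : ℝ≥0} (o : Fin n → Obs m q T) (r : ℝ) (p : ℕ) (θ : Param m q p) :
    Prop :=
  θ ∈ l1Ball m q p r ∧ ∀ η ∈ l1Ball m q p r, empRisk o p θ ≤ empRisk o p η

/-- `L̂_n(p) = min_{θ ∈ B_{p,r}} R̂_{p,n}(θ)`. -/
def empMin {m q n : ℕ} {T : ℝ≥0} (o : Fin n → Obs m q T) (r : ℝ) (p : ℕ) : ℝ :=
  sInf (empRisk o p '' l1Ball m q p r)

/-- The penalty `pen_n(p, q) = C_pen √(s_d(p) e^q) / n^ρ`. -/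
def penalty (d q n : ℕ) (Cpen ρ : ℝ) (p : ℕ) : ℝ :=
  Cpen * √((sigDim d p : ℝ) * Real.exp q) / (n : ℝ) ^ ρ

/-- The selected order: the smallest minimizer over `p ∈ ℕ` of `L̂_n(p) + pen_n(p, q)`. -/
def orderHat {m q n : ℕ} {T : ℝ≥0} (o : Fin n → Obs m q T) (r Cpen ρ : ℝ) : ℕ :=
  sInf {p | ∀ p', empMin o r p + penalty (m + 1) q n Cpen ρ p
    ≤ empMin o r p' + penalty (m + 1) q n Cpen ρ p'}

/-! ### Constants -/

/-- `C = 2 (C_z + e^{C_X + T})`. -/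
def constC (Cz CX : ℝ) (T : ℝ≥0) : ℝ := 2 * (Cz + Real.exp (CX + T))

/-- The lower bound for `n^{ρ̃}` that defines the sample size threshold; `gap` stands for
`L(p* - 1) - R̃*`, and the term with the gap is absent if `p* = 0` (convention `L(-1) = +∞`). -/
def thresholdBound (d q pStar : ℕ) (r C Cpen gap : ℝ) : ℝ :=
  (432 * √Real.pi * r * C + Cpen * √(Real.exp q)) *
    ((if pStar = 0 then 0 else 2 * √((sigDim d (pStar + 1) : ℝ) + q) / gap) +
      √(2 * (sigDim d (pStar + 1) : ℝ) + 2 * q) /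
        (Cpen * √(Real.exp q * (d : ℝ) ^ (pStar + 1))))

/-- `n*`: the smallest `k` with `k^{ρ̃}` at least the bound above, `ρ̃ = min(ρ, 1/2 - ρ)`. -/
def nStar (d q pStar : ℕ) (r C Cpen ρ gap : ℝ) : ℕ :=
  sInf {k : ℕ | thresholdBound d q pStar r C Cpen gap ≤ (k : ℝ) ^ (min ρ (1 / 2 - ρ))}

def c0 (d q pStar : ℕ) (r C Cpen : ℝ) : ℝ :=
  Cpen ^ 2 * (d : ℝ) ^ (pStar + 1) * Real.exp q /
    (256 * r * C * (36 * r * C + 1) * sigDim d (pStar + 1))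

/-- `c₁ = 74 ∑_{p > 0} e^{-c₀ s_d(p)} + 148 p*`. -/
def c1 (d q pStar : ℕ) (r C Cpen : ℝ) : ℝ :=
  74 * ∑' p : ℕ, Real.exp (-c0 d q pStar r C Cpen * sigDim d (p + 1)) + 148 * pStar

/-- The minimum is over its first entry only if `p* = 0` (convention `L(-1) = +∞`). -/
def c2 (d q pStar : ℕ) (r C Cpen gap : ℝ) : ℝ :=
  1 / (256 * r * C * (36 * r * C + 1)) *
    (if pStar = 0 then
        Cpen ^ 2 * (d : ℝ) ^ (pStar + 1) * Real.exp q / sigDim d (pStar + 1)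
      else
        min (Cpen ^ 2 * (d : ℝ) ^ (pStar + 1) * Real.exp q / sigDim d (pStar + 1))
          (gap ^ 2 / 4))

def c3 (d q pStar : ℕ) (r C : ℝ) : ℝ :=
  36 * r * C * √Real.pi * (pStar + 1) * √((sigDim d pStar : ℝ) + q)

/-- The series is the sum over `p > p*`, indexed by `p = p* + 1 + k`. -/
def c4 (d q pStar : ℕ) (r C Cpen : ℝ) : ℝ :=
  r * C * (2664 * √Real.pi * ∑' k : ℕ, √((sigDim d (pStar + 1 + k) : ℝ) + q) *
      Real.exp (-c0 d q pStar r C Cpen * sigDim d (pStar + 1 + k))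
    + c1 d q pStar r C Cpen) + c1 d q pStar r C Cpen * Real.log 2

end PSLR

end

noncomputable section

namespace PSLR

/-! (A.4) bounds the semi-parametric optimum by `infRisk`; universality of the signature gives the
reverse (`infRisk_le_minSemiRisk`). The two are therefore equal, and the quantity to bound is a
nonnegative expected excess risk. It is split according to whether the selected order is `pStar`. If
it is, the excess is at most twice the uniform deviation over the `ℓ¹`-ball of order `pStar`, which
yields the `c3` term. If not, the risk is at most `r * C / 2 + log 2`, and the probability of a
wrong order yields the `c4` term.

Universality (`exists_sig_approx`). Integration by parts and associativity of the Riemann–Stieltjes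
integral show that products of iterated integrals are linear combinations of iterated integrals, so
linear functionals of the signature form an algebra. Balls of bounded variation are not compact in
the uniform topology, so Stone–Weierstrass is not applied to paths. A path is instead encoded by the
moments `∫ (X_t - X_0) t^k dt`, which are signature functionals, determine the path, and range in a
compact box. A continuous functional of the path is a Borel function of the moments; it is
approximated in `L¹` by a continuous one, and that uniformly on the box by signature functionals. As
the loss is 1-Lipschitz, the `L¹` error bounds the error in risk.

Uniform deviations (`exists_uniform_deviation`). No chaining is used. The exponential moment of the
maximal centred sum is bounded one sample at a time: symmetrization and a two-point contraction
replace the loss by the linear predictor, whose maximum over the `ℓ¹`-ball is attained at a multiple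
of a coordinate vector. This leaves a sum of `cosh` terms over the coordinates, giving both a
Gaussian tail and a bound on the mean.

Order selection (`measure_orderHat_ne_le`). Parameters of lower order embed by zero padding without
changing any risk. Selecting an order `p > pStar` forces a deviation at order `p` comparable to the
penalty, because raising the order above `pStar` cannot lower the population risk. Selecting any
order below `pStar` forces a deviation at order `pStar` comparable to the gap. The threshold on the
sample size lets the exponents absorb the dimension factors, and the overshoot probabilities are
summable in `p`. -/

/-! ### Riemann–Stieltjes integrals against controlled integrators -/

/-- The increments of `g` on `[a, b]` are dominated by those of `ω`. -/
def IsControl (ω g : ℝ → ℝ) (a b : ℝ) : Prop :=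
  ∀ s t, a ≤ s → s ≤ t → t ≤ b → |g t - g s| ≤ ω t - ω s

theorem IsControl.mono {ω g : ℝ → ℝ} {a b a' b' : ℝ} (h : IsControl ω g a b) (ha : a ≤ a')
    (hb : b' ≤ b) : IsControl ω g a' b' :=
  fun s t hs hst ht => h s t (ha.trans hs) hst (ht.trans hb)

theorem IsControl.le {ω g : ℝ → ℝ} {a b s t : ℝ} (h : IsControl ω g a b) (hs : a ≤ s)
    (hst : s ≤ t) (ht : t ≤ b) : ω s ≤ ω t := by
  have := (abs_nonneg _).trans (h s t hs hst ht)
  linarith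

/-- The tagged sum over a partition. -/
def rsSum (f g : ℝ → ℝ) (N : ℕ) (t ξ : ℕ → ℝ) : ℝ :=
  ∑ i ∈ Finset.range N, f (ξ i) * (g (t (i + 1)) - g (t i))

/-- The mixed difference of `g (min (t i) (s j))`. -/
def mixDiff (g : ℝ → ℝ) (t s : ℕ → ℝ) (i j : ℕ) : ℝ :=
  (g (min (t (i + 1)) (s (j + 1))) - g (min (t i) (s (j + 1)))) -
    (g (min (t (i + 1)) (s j)) - g (min (t i) (s j)))

theorem mixDiff_comm (g : ℝ → ℝ) (t s : ℕ → ℝ) (i j : ℕ) :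
    mixDiff g t s i j = mixDiff g s t j i := by
  simp only [mixDiff, min_comm]
  ring

/-- The array `g (min (t i) (s j))` stands in for a common refinement of two partitions: its mixed
differences telescope in one index and return the increments along the other, so no refined
partition has to be built. -/
theorem sum_mixDiff (g : ℝ → ℝ) {t s : ℕ → ℝ} {M i : ℕ}
    (h1 : ∀ k ∈ Icc i (i + 1), t k ∈ Icc (s 0) (s M)) :
    ∑ j ∈ Finset.range M, mixDiff g t s i j = g (t (i + 1)) - g (t i) := by
  have := Finset.sum_range_sub (fun j => g (min (t (i + 1)) (s j)) - g (min (t i) (s j))) M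
  simp only [mixDiff]
  rw [this]
  have ha := h1 i ⟨le_rfl, by omega⟩
  have hb := h1 (i + 1) ⟨by omega, le_rfl⟩
  simp only [min_eq_left ha.2, min_eq_left hb.2, min_eq_right ha.1, min_eq_right hb.1]
  ring

theorem mem_Icc_of_partition {t : ℕ → ℝ} (ht : Monotone t) {a b : ℝ} {N i : ℕ} (h0 : t 0 = a)
    (hN : t N = b) (hi : i ≤ N) : t i ∈ Icc a b :=
  ⟨h0 ▸ ht (Nat.zero_le i), hN ▸ ht hi⟩

/-- Either the two cells do not overlap and the four terms cancel, or the mixed difference is the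
increment of `g` over their intersection, which the control dominates. Tags of overlapping cells are
within `2 * δ` of each other. -/
theorem abs_sub_mul_mixDiff_le {f g ω : ℝ → ℝ} {a b ε δ : ℝ} (hg : IsControl ω g a b)
    (hf : ∀ x ∈ Icc a b, ∀ y ∈ Icc a b, |x - y| ≤ 2 * δ → |f x - f y| ≤ ε)
    {t s : ℕ → ℝ} (ht : Monotone t) (hs : Monotone s) {i j : ℕ}
    (hti : t i ∈ Icc a b) (hti' : t (i + 1) ∈ Icc a b)
    (hsj : s j ∈ Icc a b) (hsj' : s (j + 1) ∈ Icc a b)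
    (htd : t (i + 1) - t i < δ) (hsd : s (j + 1) - s j < δ)
    {x y : ℝ} (hx : x ∈ Icc (t i) (t (i + 1))) (hy : y ∈ Icc (s j) (s (j + 1))) :
    |(f x - f y) * mixDiff g t s i j| ≤ ε * mixDiff ω t s i j := by
  have hti1 := ht (Nat.le_succ i)
  have hsj1 := hs (Nat.le_succ j)
  simp only [Nat.succ_eq_add_one] at hti1 hsj1
  rcases le_or_gt (t (i + 1)) (s j) with h | h
  · have h' : t i ≤ s j := hti1.trans h
    have h2 : t (i + 1) ≤ s (j + 1) := h.trans hsj1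
    simp [mixDiff, min_eq_left h, min_eq_left h', min_eq_left h2, min_eq_left (hti1.trans h2)]
  rcases le_or_gt (s (j + 1)) (t i) with h2 | h2
  · have h' : s j ≤ t i := hsj1.trans h2
    simp [mixDiff, min_eq_right h', min_eq_right h2, min_eq_right (h2.trans hti1),
      min_eq_right (h'.trans hti1)]
  have key : ∀ u : ℝ → ℝ, mixDiff u t s i j
      = u (min (t (i + 1)) (s (j + 1))) - u (max (t i) (s j)) := by
    intro u
    simp only [mixDiff, min_eq_left h2.le, min_eq_right h.le]
    rcases le_total (t i) (s j) with h3 | h3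
    · rw [min_eq_left h3, max_eq_right h3]; ring
    · rw [min_eq_right h3, max_eq_left h3]; ring
  have hle : max (t i) (s j) ≤ min (t (i + 1)) (s (j + 1)) :=
    max_le (le_min hti1 h2.le) (le_min h.le hsj1)
  have hc := hg _ _ (hti.1.trans (le_max_left _ _)) hle ((min_le_left _ _).trans hti'.2)
  have hfx := hf x ⟨hti.1.trans hx.1, hx.2.trans hti'.2⟩ y ⟨hsj.1.trans hy.1, hy.2.trans hsj'.2⟩
    (by rw [abs_le]; constructor <;> linarith [hx.1, hx.2, hy.1, hy.2])
  rw [abs_mul, key, key]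
  exact mul_le_mul hfx hc (abs_nonneg _) ((abs_nonneg _).trans hfx)

/-- Two tagged sums over fine partitions are close. -/
theorem abs_rsSum_sub_rsSum_le {f g ω : ℝ → ℝ} {a b ε δ : ℝ} (hg : IsControl ω g a b)
    (hf : ∀ x ∈ Icc a b, ∀ y ∈ Icc a b, |x - y| ≤ 2 * δ → |f x - f y| ≤ ε)
    {t s ξ η : ℕ → ℝ} {N M : ℕ} (ht : Monotone t) (hs : Monotone s)
    (ht0 : t 0 = a) (htN : t N = b) (hs0 : s 0 = a) (hsM : s M = b)
    (htd : ∀ i < N, t (i + 1) - t i < δ) (hsd : ∀ i < M, s (i + 1) - s i < δ)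
    (hξ : ∀ i < N, ξ i ∈ Icc (t i) (t (i + 1))) (hη : ∀ i < M, η i ∈ Icc (s i) (s (i + 1))) :
    |rsSum f g N t ξ - rsSum f g M s η| ≤ ε * (ω b - ω a) := by
  have htm : ∀ i ≤ N, t i ∈ Icc a b := fun i hi => mem_Icc_of_partition ht ht0 htN hi
  have hsm : ∀ i ≤ M, s i ∈ Icc a b := fun i hi => mem_Icc_of_partition hs hs0 hsM hi
  have e1 : ∀ u : ℝ → ℝ, ∀ i ∈ Finset.range N,
      ∑ j ∈ Finset.range M, mixDiff u t s i j = u (t (i + 1)) - u (t i) := by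
    intro u i hi
    rw [Finset.mem_range] at hi
    refine sum_mixDiff u fun k hk => ?_
    rw [hs0, hsM]
    exact htm k (by have := hk.2; omega)
  have e2 : ∀ j ∈ Finset.range M,
      ∑ i ∈ Finset.range N, mixDiff g t s i j = g (s (j + 1)) - g (s j) := by
    intro i hi
    rw [Finset.mem_range] at hi
    simp only [mixDiff_comm g t s]
    refine sum_mixDiff g fun k hk => ?_
    rw [ht0, htN]
    exact hsm k (by have := hk.2; omega)
  have h1 : rsSum f g N t ξ - rsSum f g M s η
      = ∑ i ∈ Finset.range N, ∑ j ∈ Finset.range M, (f (ξ i) - f (η j)) * mixDiff g t s i j := by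
    simp only [sub_mul, Finset.sum_sub_distrib]
    congr 1
    · refine Finset.sum_congr rfl fun i hi => ?_
      rw [← Finset.mul_sum, e1 g i hi]
    · rw [Finset.sum_comm]
      refine Finset.sum_congr rfl fun j hj => ?_
      rw [← Finset.mul_sum, e2 j hj]
  have h2 : ε * (ω b - ω a)
      = ∑ i ∈ Finset.range N, ∑ j ∈ Finset.range M, ε * mixDiff ω t s i j := by
    simp only [← Finset.mul_sum]
    rw [Finset.sum_congr rfl (e1 ω), Finset.sum_range_sub (fun i => ω (t i)), ht0, htN]
  rw [h1, h2]
  refine (Finset.abs_sum_le_sum_abs _ _).trans (Finset.sum_le_sum fun i hi => ?_)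
  refine (Finset.abs_sum_le_sum_abs _ _).trans (Finset.sum_le_sum fun j hj => ?_)
  rw [Finset.mem_range] at hi hj
  exact abs_sub_mul_mixDiff_le hg hf ht hs (htm i hi.le) (htm _ hi) (hsm j hj.le) (hsm _ hj)
    (htd i hi) (hsd j hj) (hξ i hi) (hη j hj)

/-! ### Uniform partitions as test sequences -/

/-- The uniform partition of `[a, b]` into `N` intervals. -/
def unifPart (a b : ℝ) (N i : ℕ) : ℝ := a + (b - a) * (i / N)

theorem unifPart_monotone {a b : ℝ} (hab : a ≤ b) (N : ℕ) : Monotone (unifPart a b N) := by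
  intro i j hij
  unfold unifPart
  have : (i : ℝ) / N ≤ j / N := by gcongr
  nlinarith

theorem unifPart_zero (a b : ℝ) (N : ℕ) : unifPart a b N 0 = a := by simp [unifPart]

theorem unifPart_self (a b : ℝ) {N : ℕ} (hN : N ≠ 0) : unifPart a b N N = b := by
  have : (N : ℝ) ≠ 0 := by exact_mod_cast hN
  simp [unifPart, div_self this]

theorem unifPart_succ_sub (a b : ℝ) (N i : ℕ) :
    unifPart a b N (i + 1) - unifPart a b N i = (b - a) / N := by
  simp only [unifPart]; push_cast; ring

theorem unifPart_mem {a b : ℝ} (hab : a ≤ b) {N : ℕ} (hN : N ≠ 0) {i : ℕ} (hi : i ≤ N) :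
    unifPart a b N i ∈ Icc a b :=
  mem_Icc_of_partition (unifPart_monotone hab N) (unifPart_zero a b N) (unifPart_self a b hN) hi

theorem exists_unifPart_mesh (a b : ℝ) {δ : ℝ} (hδ : 0 < δ) :
    ∃ K : ℕ, ∀ N ≥ K, (b - a) / N < δ := by
  have h := tendsto_const_div_atTop_nhds_zero_nat (b - a)
  exact Filter.eventually_atTop.1 (h.eventually (gt_mem_nhds hδ))

/-- Identities between integrals are later read off from exact identities between sums along this
sequence of partitions, by uniqueness of limits. -/
theorem tendsto_rsSum_of_hasRSIntegral {f g : ℝ → ℝ} {a b J : ℝ} (hab : a ≤ b)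
    (h : HasRSIntegral f g a b J) (ξ : ℕ → ℕ → ℝ)
    (hξ : ∀ N i, ξ N i ∈ Icc (unifPart a b N i) (unifPart a b N (i + 1))) :
    Filter.Tendsto (fun N => rsSum f g N (unifPart a b N) (ξ N)) Filter.atTop (nhds J) := by
  rw [Metric.tendsto_atTop]
  intro ε hε
  obtain ⟨δ, hδ, H⟩ := h ε hε
  obtain ⟨K, hK⟩ := exists_unifPart_mesh a b hδ
  refine ⟨K + 1, fun N hN => ?_⟩
  rw [Real.dist_eq]
  exact H N _ _ (unifPart_monotone hab N) (unifPart_zero a b N) (unifPart_self a b (by omega))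
    (fun i _ => by rw [unifPart_succ_sub]; exact hK N (by omega)) (fun i _ => hξ N i)

theorem tendsto_leftSum {f g : ℝ → ℝ} {a b J : ℝ} (hab : a ≤ b) (h : HasRSIntegral f g a b J) :
    Filter.Tendsto (fun N => rsSum f g N (unifPart a b N) (unifPart a b N)) Filter.atTop
      (nhds J) :=
  tendsto_rsSum_of_hasRSIntegral hab h (fun N => unifPart a b N)
    fun N i => ⟨le_rfl, unifPart_monotone hab N (Nat.le_succ i)⟩

theorem tendsto_rightSum {f g : ℝ → ℝ} {a b J : ℝ} (hab : a ≤ b) (h : HasRSIntegral f g a b J) :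
    Filter.Tendsto (fun N => rsSum f g N (unifPart a b N) (fun i => unifPart a b N (i + 1)))
      Filter.atTop (nhds J) :=
  tendsto_rsSum_of_hasRSIntegral hab h (fun N i => unifPart a b N (i + 1))
    fun N i => ⟨unifPart_monotone hab N (Nat.le_succ i), le_rfl⟩

theorem HasRSIntegral.unique {f g : ℝ → ℝ} {a b J J' : ℝ} (hab : a ≤ b)
    (h : HasRSIntegral f g a b J) (h' : HasRSIntegral f g a b J') : J = J' :=
  tendsto_nhds_unique (tendsto_leftSum hab h) (tendsto_leftSum hab h')

theorem HasRSIntegral.rsIntegral_eq {f g : ℝ → ℝ} {a b J : ℝ} (hab : a ≤ b)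
    (h : HasRSIntegral f g a b J) : rsIntegral f g a b = J := by
  have hex : ∃ J, HasRSIntegral f g a b J := ⟨J, h⟩
  rw [rsIntegral, dif_pos hex]
  exact hex.choose_spec.unique hab h

theorem exists_modulus {f : ℝ → ℝ} {a b : ℝ} (hf : ContinuousOn f (Icc a b)) {ε : ℝ}
    (hε : 0 < ε) :
    ∃ δ > 0, ∀ x ∈ Icc a b, ∀ y ∈ Icc a b, |x - y| ≤ 2 * δ → |f x - f y| ≤ ε := by
  have := isCompact_Icc.uniformContinuousOn_of_continuous hf
  rw [Metric.uniformContinuousOn_iff] at this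
  obtain ⟨δ, hδ, H⟩ := this ε hε
  refine ⟨δ / 4, by positivity, fun x hx y hy hxy => ?_⟩
  have := H x hx y hy (by rw [Real.dist_eq]; linarith)
  rw [Real.dist_eq] at this
  exact this.le

/-- Continuous functions are Riemann–Stieltjes integrable against controlled integrators. -/
theorem exists_hasRSIntegral {f g ω : ℝ → ℝ} {a b : ℝ} (hab : a ≤ b)
    (hf : ContinuousOn f (Icc a b)) (hg : IsControl ω g a b) :
    ∃ J, HasRSIntegral f g a b J := by
  set u : ℕ → ℝ := fun N => rsSum f g N (unifPart a b N) (unifPart a b N)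
  have hω : 0 ≤ ω b - ω a := by linarith [hg.le le_rfl hab le_rfl]
  have key : ∀ ε > 0, ∃ δ > 0, ∀ (N : ℕ) (t ξ : ℕ → ℝ) (M : ℕ), M ≠ 0 → (b - a) / M < δ →
      Monotone t → t 0 = a → t N = b → (∀ i < N, t (i + 1) - t i < δ) →
      (∀ i < N, ξ i ∈ Icc (t i) (t (i + 1))) → |rsSum f g N t ξ - u M| ≤ ε := by
    intro ε hε
    -- The `+ 1` keeps the quotient meaningful when the control has no total increment.
    obtain ⟨δ, hδ, H⟩ := exists_modulus hf (ε := ε / (ω b - ω a + 1)) (by positivity)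
    refine ⟨δ, hδ, fun N t ξ M hM hMd ht h0 hN hd hξ => ?_⟩
    refine (abs_rsSum_sub_rsSum_le hg H ht (unifPart_monotone hab M) h0 hN (unifPart_zero a b M)
      (unifPart_self a b hM) hd (fun i _ => by rwa [unifPart_succ_sub]) hξ
      (fun i _ => ⟨le_rfl, unifPart_monotone hab M (Nat.le_succ i)⟩)).trans ?_
    rw [div_mul_eq_mul_div, div_le_iff₀ (by positivity)]
    nlinarith
  have hcau : CauchySeq u := by
    rw [Metric.cauchySeq_iff']
    intro ε hε
    obtain ⟨δ, hδ, H⟩ := key (ε / 2) (by positivity)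
    obtain ⟨K, hK⟩ := exists_unifPart_mesh a b hδ
    refine ⟨K + 1, fun N hN => ?_⟩
    rw [Real.dist_eq]
    refine (H N _ _ (K + 1) (by omega) (hK _ (by omega)) (unifPart_monotone hab N)
      (unifPart_zero a b N) (unifPart_self a b (by omega))
      (fun i _ => by rw [unifPart_succ_sub]; exact hK N (by omega))
      (fun i _ => ⟨le_rfl, unifPart_monotone hab N (Nat.le_succ i)⟩)).trans_lt (by linarith)
  obtain ⟨J, hJ⟩ := cauchySeq_tendsto_of_complete hcau
  refine ⟨J, fun ε hε => ?_⟩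
  obtain ⟨δ, hδ, H⟩ := key (ε / 2) (by positivity)
  refine ⟨δ, hδ, fun N t ξ ht h0 hN hd hξ => ?_⟩
  obtain ⟨K, hK⟩ := exists_unifPart_mesh a b hδ
  have hlim : Filter.Tendsto (fun M => |rsSum f g N t ξ - u M|) Filter.atTop
      (nhds |rsSum f g N t ξ - J|) := (tendsto_const_nhds.sub hJ).abs
  have : |rsSum f g N t ξ - J| ≤ ε / 2 := by
    refine le_of_tendsto hlim (Filter.eventually_atTop.2 ⟨K + 1, fun M hM => ?_⟩)
    exact H N t ξ M (by omega) (hK M (by omega)) ht h0 hN hd hξ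
  exact this.trans_lt (by linarith)

theorem hasRSIntegral_rsIntegral {f g ω : ℝ → ℝ} {a b : ℝ} (hab : a ≤ b)
    (hf : ContinuousOn f (Icc a b)) (hg : IsControl ω g a b) :
    HasRSIntegral f g a b (rsIntegral f g a b) := by
  obtain ⟨J, hJ⟩ := exists_hasRSIntegral hab hf hg
  rwa [hJ.rsIntegral_eq hab]

theorem rsIntegral_self (f g : ℝ → ℝ) (a : ℝ) : rsIntegral f g a a = 0 := by
  refine HasRSIntegral.rsIntegral_eq le_rfl fun ε hε => ⟨1, one_pos, ?_⟩
  intro N t ξ ht h0 hN _ _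
  have : ∑ i ∈ Finset.range N, f (ξ i) * (g (t (i + 1)) - g (t i)) = 0 := by
    refine Finset.sum_eq_zero fun i hi => ?_
    rw [Finset.mem_range] at hi
    have h1 := mem_Icc_of_partition ht h0 hN hi.le
    have h2 := mem_Icc_of_partition ht h0 hN (Nat.succ_le_of_lt hi)
    rw [Icc_self, mem_singleton_iff] at h1 h2
    rw [h1, h2, sub_self, mul_zero]
  rw [this]; simpa using hε

theorem rsIntegral_const_mul_add {f₁ f₂ g ω : ℝ → ℝ} {a b : ℝ} (hab : a ≤ b)
    (hf₁ : ContinuousOn f₁ (Icc a b)) (hf₂ : ContinuousOn f₂ (Icc a b))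
    (hg : IsControl ω g a b) (c : ℝ) :
    rsIntegral (fun s => c * f₁ s + f₂ s) g a b
      = c * rsIntegral f₁ g a b + rsIntegral f₂ g a b := by
  have h := hasRSIntegral_rsIntegral hab ((hf₁.const_mul c).add hf₂) hg
  have h1 := tendsto_leftSum hab h
  have h2 := ((tendsto_leftSum hab (hasRSIntegral_rsIntegral hab hf₁ hg)).const_mul c).add
    (tendsto_leftSum hab (hasRSIntegral_rsIntegral hab hf₂ hg))
  refine tendsto_nhds_unique h1 (h2.congr fun N => ?_)
  simp only [rsSum, Finset.mul_sum, ← Finset.sum_add_distrib]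
  exact Finset.sum_congr rfl fun i _ => by simp only [Pi.add_apply]; ring

theorem rsIntegral_congr {f₁ f₂ g ω : ℝ → ℝ} {a b : ℝ} (hab : a ≤ b)
    (hf₁ : ContinuousOn f₁ (Icc a b)) (h : EqOn f₁ f₂ (Icc a b)) (hg : IsControl ω g a b) :
    rsIntegral f₁ g a b = rsIntegral f₂ g a b := by
  have h1 := tendsto_leftSum hab (hasRSIntegral_rsIntegral hab hf₁ hg)
  have h2 := tendsto_leftSum hab (hasRSIntegral_rsIntegral hab (hf₁.congr h.symm) hg)
  refine tendsto_nhds_unique (h1.congr' ?_) h2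
  refine Filter.eventually_atTop.2 ⟨1, fun N hN => Finset.sum_congr rfl fun i hi => ?_⟩
  rw [Finset.mem_range] at hi
  rw [h (unifPart_mem hab (by omega) hi.le)]

theorem rsIntegral_one {g ω : ℝ → ℝ} {a b : ℝ} (hab : a ≤ b) (hg : IsControl ω g a b) :
    rsIntegral (fun _ => 1) g a b = g b - g a := by
  have h1 := tendsto_leftSum hab
    (hasRSIntegral_rsIntegral (f := fun _ => 1) hab continuousOn_const hg)
  refine tendsto_nhds_unique h1 (tendsto_const_nhds.congr' ?_)
  refine Filter.eventually_atTop.2 ⟨1, fun N hN => ?_⟩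
  simp only [rsSum, one_mul]
  rw [Finset.sum_range_sub (fun i => g (unifPart a b N i)), unifPart_self _ _ (by omega),
    unifPart_zero]

/-- Integration by parts. -/
theorem rsIntegral_add_rsIntegral {f g ω ω' : ℝ → ℝ} {a b : ℝ} (hab : a ≤ b)
    (hf : ContinuousOn f (Icc a b)) (hg : ContinuousOn g (Icc a b))
    (hgω : IsControl ω g a b) (hfω : IsControl ω' f a b) :
    rsIntegral f g a b + rsIntegral g f a b = f b * g b - f a * g a := by
  -- Left tags for one integral and right tags for the other make the two sums add up to an exactly
  -- telescoping sum of increments of `f * g`.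
  have h := (tendsto_leftSum hab (hasRSIntegral_rsIntegral hab hf hgω)).add
    (tendsto_rightSum hab (hasRSIntegral_rsIntegral hab hg hfω))
  refine tendsto_nhds_unique h (tendsto_const_nhds.congr' ?_)
  refine Filter.eventually_atTop.2 ⟨1, fun N hN => ?_⟩
  simp only [rsSum]
  rw [← Finset.sum_add_distrib]
  have := Finset.sum_range_sub (fun i => f (unifPart a b N i) * g (unifPart a b N i)) N
  rw [unifPart_self _ _ (by omega), unifPart_zero] at this
  rw [← this]
  exact Finset.sum_congr rfl fun i _ => by ring

/-! ### Increments of the indefinite integral -/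

/-- The increment of an indefinite integral is a limit of sums over the later part. -/
theorem tendsto_increment {f g ω : ℝ → ℝ} {a b s : ℝ} (has : a ≤ s) (hsb : s ≤ b)
    (hf : ContinuousOn f (Icc a b)) (hg : IsControl ω g a b) :
    Filter.Tendsto (fun N => ∑ i ∈ Finset.range N, f (unifPart a b N i) *
        (g (max (unifPart a b N (i + 1)) s) - g (max (unifPart a b N i) s)))
      Filter.atTop (nhds (rsIntegral f g a b - rsIntegral f g a s)) := by
  have hab := has.trans hsb
  have h1 := tendsto_leftSum hab (hasRSIntegral_rsIntegral hab hf hg)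
  have hs := hasRSIntegral_rsIntegral has (hf.mono (Icc_subset_Icc_right hsb))
    (hg.mono le_rfl hsb)
  -- The partition of `[a, b]` truncated at `s` is a partition of `[a, s]` whose later cells are
  -- degenerate, so both integrals are approximated on the same index set and can be subtracted cell
  -- by cell.
  have h2 : Filter.Tendsto (fun N => rsSum f g N (fun i => min (unifPart a b N i) s)
      (fun i => min (unifPart a b N i) s)) Filter.atTop (nhds (rsIntegral f g a s)) := by
    rw [Metric.tendsto_atTop]
    intro ε hε
    obtain ⟨δ, hδ, H⟩ := hs ε hε
    obtain ⟨K, hK⟩ := exists_unifPart_mesh a b hδ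
    refine ⟨K + 1, fun N hN => ?_⟩
    have hm : Monotone fun i => min (unifPart a b N i) s :=
      (unifPart_monotone hab N).min monotone_const
    rw [Real.dist_eq]
    refine H N _ _ hm (by simp [unifPart_zero, has])
      (by rw [unifPart_self a b (by omega), min_eq_right hsb])
      (fun i _ => ?_) (fun i _ => ⟨le_rfl, hm (Nat.le_succ i)⟩)
    have h3 := hK N (by omega)
    rw [← unifPart_succ_sub a b N i] at h3
    refine lt_of_le_of_lt ?_ h3
    have h4 := unifPart_monotone hab N (Nat.le_succ i)
    simp only [Nat.succ_eq_add_one] at h4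
    rcases le_total (unifPart a b N i) s with h5 | h5
    · rw [min_eq_left h5]; linarith [min_le_left (unifPart a b N (i + 1)) s]
    · rw [min_eq_right h5, min_eq_right (h5.trans h4)]; linarith
  refine (h1.sub h2).congr fun N => ?_
  simp only [rsSum, ← Finset.sum_sub_distrib]
  refine Finset.sum_congr rfl fun i _ => ?_
  have h4 := unifPart_monotone hab N (Nat.le_succ i)
  simp only [Nat.succ_eq_add_one] at h4
  rcases le_total (unifPart a b N i) s with h5 | h5
  · rcases le_total (unifPart a b N (i + 1)) s with h6 | h6
    · simp [h5, h6]
    · simp [h5, h6]; ring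
  · simp [h5, h5.trans h4]

/-- Only cells reaching past `s` contribute, so smallness of `u` is needed at their left ends alone;
the truncated control increments telescope to `ω b - ω s`. -/
theorem abs_increment_sum_le {u g ω : ℝ → ℝ} {a b s ε : ℝ} (has : a ≤ s) (hsb : s ≤ b)
    (hg : IsControl ω g a b) {N : ℕ} (hN : N ≠ 0)
    (hu : ∀ i < N, s < unifPart a b N (i + 1) → |u (unifPart a b N i)| ≤ ε) :
    |∑ i ∈ Finset.range N, u (unifPart a b N i) *
        (g (max (unifPart a b N (i + 1)) s) - g (max (unifPart a b N i) s))|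
      ≤ ε * (ω b - ω s) := by
  have hab := has.trans hsb
  have h1 : ε * (ω b - ω s) = ∑ i ∈ Finset.range N, ε *
      (ω (max (unifPart a b N (i + 1)) s) - ω (max (unifPart a b N i) s)) := by
    rw [← Finset.mul_sum, Finset.sum_range_sub (fun i => ω (max (unifPart a b N i) s)),
      unifPart_self _ _ hN, unifPart_zero, max_eq_left hsb, max_eq_right has]
  rw [h1]
  refine (Finset.abs_sum_le_sum_abs _ _).trans (Finset.sum_le_sum fun i hi => ?_)
  rw [Finset.mem_range] at hi
  have h4 := unifPart_monotone hab N (Nat.le_succ i)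
  simp only [Nat.succ_eq_add_one] at h4
  rcases le_or_gt (unifPart a b N (i + 1)) s with h5 | h5
  · simp [h5, h4.trans h5]
  · rw [abs_mul]
    have hu' := hu i hi h5
    refine mul_le_mul hu' (hg _ _ (has.trans (le_max_right _ _)) (max_le_max_right _ h4) ?_)
      (abs_nonneg _) ((abs_nonneg _).trans hu')
    exact max_le (unifPart_mem hab hN hi).2 hsb

theorem abs_rsIntegral_sub_le {f g ω : ℝ → ℝ} {a b s M : ℝ} (has : a ≤ s) (hsb : s ≤ b)
    (hf : ContinuousOn f (Icc a b)) (hg : IsControl ω g a b) (hM : ∀ x ∈ Icc a b, |f x| ≤ M) :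
    |rsIntegral f g a b - rsIntegral f g a s| ≤ M * (ω b - ω s) := by
  refine le_of_tendsto (tendsto_increment has hsb hf hg).abs
    (Filter.eventually_atTop.2 ⟨1, fun N hN => ?_⟩)
  exact abs_increment_sum_le has hsb hg (by omega)
    fun i hi _ => hM _ (unifPart_mem (has.trans hsb) (by omega) hi.le)

/-- Local estimate for the indefinite integral. -/
theorem abs_rsIntegral_sub_sub_le {f g ω : ℝ → ℝ} {a b s ε δ ξ : ℝ} (has : a ≤ s) (hsb : s ≤ b)
    (hf : ContinuousOn f (Icc a b)) (hg : IsControl ω g a b) (hδ : 0 < δ)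
    (hm : ∀ x ∈ Icc a b, ∀ y ∈ Icc a b, |x - y| ≤ 2 * δ → |f x - f y| ≤ ε)
    (hbs : b - s ≤ δ) (hξ : ξ ∈ Icc s b) :
    |rsIntegral f g a b - rsIntegral f g a s - f ξ * (g b - g s)| ≤ ε * (ω b - ω s) := by
  have hab := has.trans hsb
  obtain ⟨K, hK⟩ := exists_unifPart_mesh a b hδ
  have hlim := ((tendsto_increment has hsb hf hg).sub
    (tendsto_const_nhds (x := f ξ * (g b - g s)))).abs
  refine le_of_tendsto hlim (Filter.eventually_atTop.2 ⟨K + 1, fun N hN => ?_⟩)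
  have h1 : f ξ * (g b - g s) = ∑ i ∈ Finset.range N, f ξ *
      (g (max (unifPart a b N (i + 1)) s) - g (max (unifPart a b N i) s)) := by
    rw [← Finset.mul_sum, Finset.sum_range_sub (fun i => g (max (unifPart a b N i) s)),
      unifPart_self _ _ (by omega), unifPart_zero, max_eq_left hsb, max_eq_right has]
  rw [h1, ← Finset.sum_sub_distrib]
  simp only [← sub_mul]
  refine abs_increment_sum_le (u := fun x => f x - f ξ) has hsb hg (by omega) fun i hi his => ?_
  have h3 := hK N (by omega)
  rw [← unifPart_succ_sub a b N i] at h3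
  have h4 := unifPart_mem hab (show N ≠ 0 by omega) hi.le
  -- A cell reaching past `s` starts above `s - δ`, while its left end and `ξ` are both at most `b ≤
  -- s + δ`.
  refine hm _ h4 ξ ⟨has.trans hξ.1, hξ.2⟩ ?_
  rw [abs_le]
  constructor <;> linarith [hξ.1, hξ.2, h4.2]

/-- The indefinite integral is itself a legitimate integrator, which is what associativity and the
product formula require. -/
theorem IsControl.rsIntegral {f g ω : ℝ → ℝ} {a b M : ℝ}
    (hf : ContinuousOn f (Icc a b)) (hg : IsControl ω g a b) (hM : ∀ x ∈ Icc a b, |f x| ≤ M) :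
    IsControl (fun t => M * ω t) (fun t => rsIntegral f g a t) a b := by
  intro s t hs hst ht
  rw [← mul_sub]
  exact abs_rsIntegral_sub_le hs hst (hf.mono (Icc_subset_Icc_right ht)) (hg.mono le_rfl ht)
    fun x hx => hM x ⟨hx.1, hx.2.trans ht⟩

theorem exists_abs_bound {f : ℝ → ℝ} {a b : ℝ} (hf : ContinuousOn f (Icc a b)) :
    ∃ M, 0 ≤ M ∧ ∀ x ∈ Icc a b, |f x| ≤ M := by
  obtain ⟨M, hM⟩ := isCompact_Icc.exists_bound_of_continuousOn hf
  exact ⟨max M 0, le_max_right _ _, fun x hx => (hM x hx).trans (le_max_left _ _)⟩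

/-- The control `ω` may jump, so domination by its increments does not suffice. Over a short
interval the increment is `f s * (g t - g s)` up to a small multiple of the control increment, and
continuity comes from that of `g`. -/
theorem continuousOn_rsIntegral {f g ω : ℝ → ℝ} {a b : ℝ} (hf : ContinuousOn f (Icc a b))
    (hgc : ContinuousOn g (Icc a b)) (hg : IsControl ω g a b) :
    ContinuousOn (fun t => rsIntegral f g a t) (Icc a b) := by
  rw [Metric.continuousOn_iff]
  intro x hx ε hε
  have hab : a ≤ b := hx.1.trans hx.2
  obtain ⟨M, hM0, hM⟩ := exists_abs_bound hf
  have hω : 0 ≤ ω b - ω a := by linarith [hg.le le_rfl hab le_rfl]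
  obtain ⟨δ, hδ, H⟩ := exists_modulus hf (ε := ε / 4 / (ω b - ω a + 1)) (by positivity)
  obtain ⟨δ', hδ', H'⟩ := exists_modulus hgc (ε := ε / 4 / (M + 1)) (by positivity)
  have key : ∀ s ∈ Icc a b, ∀ t ∈ Icc a b, s ≤ t → t - s ≤ min δ δ' →
      |rsIntegral f g a t - rsIntegral f g a s| < ε := by
    intro s hs t ht hst hd
    have h1 := abs_rsIntegral_sub_sub_le hs.1 hst (hf.mono (Icc_subset_Icc_right ht.2))
      (hg.mono le_rfl ht.2) hδ
      (fun x hx y hy => H x ⟨hx.1, hx.2.trans ht.2⟩ y ⟨hy.1, hy.2.trans ht.2⟩)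
      (hd.trans (min_le_left _ _)) (ξ := s) ⟨le_rfl, hst⟩
    have h2 : |f s * (g t - g s)| ≤ M * (ε / 4 / (M + 1)) := by
      rw [abs_mul]
      refine mul_le_mul (hM s hs) (H' t ht s hs ?_) (abs_nonneg _) hM0
      rw [abs_of_nonneg (by linarith)]
      linarith [min_le_right δ δ']
    have h3 : M * (ε / 4 / (M + 1)) ≤ ε / 4 := by
      rw [← mul_div_assoc, div_le_iff₀ (by positivity)]; nlinarith
    have h4 : ε / 4 / (ω b - ω a + 1) * (ω t - ω s) ≤ ε / 4 := by
      rw [div_mul_eq_mul_div, div_le_iff₀ (by positivity)]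
      have := hg.le le_rfl hs.1 hs.2
      have := hg.le ht.1 ht.2 le_rfl
      nlinarith
    have h5 := abs_sub_abs_le_abs_sub (rsIntegral f g a t - rsIntegral f g a s)
      (f s * (g t - g s))
    linarith
  refine ⟨min δ δ', lt_min hδ hδ', fun y hy hyx => ?_⟩
  rw [Real.dist_eq] at hyx ⊢
  rcases le_total x y with h | h
  · exact key x hx y hy h (by rw [abs_of_nonneg (by linarith)] at hyx; exact hyx.le)
  · rw [abs_sub_comm] at hyx ⊢
    exact key y hy x hx h (by rw [abs_of_nonneg (by linarith)] at hyx; exact hyx.le)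

/-- Associativity: `u d(∫ f dg) = u f dg`. -/
theorem rsIntegral_rsIntegral {u f g ω : ℝ → ℝ} {a b : ℝ} (hab : a ≤ b)
    (hu : ContinuousOn u (Icc a b)) (hf : ContinuousOn f (Icc a b)) (hg : IsControl ω g a b) :
    rsIntegral u (fun t => rsIntegral f g a t) a b = rsIntegral (fun t => u t * f t) g a b := by
  obtain ⟨M, hM0, hM⟩ := exists_abs_bound hf
  obtain ⟨U, hU0, hU⟩ := exists_abs_bound hu
  have hω : 0 ≤ ω b - ω a := by linarith [hg.le le_rfl hab le_rfl]
  have h1 := tendsto_leftSum hab (hasRSIntegral_rsIntegral hab hu (hg.rsIntegral hf hM))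
  have h2 := tendsto_leftSum hab (hasRSIntegral_rsIntegral hab (hu.mul hf) hg)
  refine eq_of_abs_sub_le_all fun η hη => ?_
  set ε := η / (U * (ω b - ω a) + 1) with hε_def
  have hε : 0 < ε := by positivity
  obtain ⟨δ, hδ, H⟩ := exists_modulus hf hε
  obtain ⟨K, hK⟩ := exists_unifPart_mesh a b hδ
  refine le_of_tendsto (h1.sub h2).abs (Filter.eventually_atTop.2 ⟨K + 1, fun N hN => ?_⟩)
  have h3 : U * (ε * (ω b - ω a)) ≤ η := by
    rw [hε_def, div_mul_eq_mul_div, ← mul_div_assoc, div_le_iff₀ (by positivity)]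
    nlinarith
  refine le_trans ?_ h3
  have h4 : U * (ε * (ω b - ω a)) = ∑ i ∈ Finset.range N,
      U * (ε * (ω (unifPart a b N (i + 1)) - ω (unifPart a b N i))) := by
    rw [← Finset.mul_sum, ← Finset.mul_sum, Finset.sum_range_sub (fun i => ω (unifPart a b N i)),
      unifPart_self _ _ (by omega), unifPart_zero]
  rw [h4, rsSum, rsSum, ← Finset.sum_sub_distrib]
  refine (Finset.abs_sum_le_sum_abs _ _).trans (Finset.sum_le_sum fun i hi => ?_)
  rw [Finset.mem_range] at hi
  have hm := unifPart_mem hab (show N ≠ 0 by omega) hi.le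
  have hm' := unifPart_mem hab (show N ≠ 0 by omega) (Nat.succ_le_of_lt hi)
  have hle := unifPart_monotone hab N (Nat.le_succ i)
  simp only [Nat.succ_eq_add_one] at hle hm'
  -- On each cell the increment of `∫ f dg` is replaced by `f` at the left end times the increment
  -- of `g`; the errors are proportional to control increments and hence summable.
  have h5 := abs_rsIntegral_sub_sub_le hm.1 hle (hf.mono (Icc_subset_Icc_right hm'.2))
      (hg.mono le_rfl hm'.2) hδ
      (fun x hx y hy => H x ⟨hx.1, hx.2.trans hm'.2⟩ y ⟨hy.1, hy.2.trans hm'.2⟩)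
      (by rw [unifPart_succ_sub]; exact (hK N (by omega)).le) (ξ := unifPart a b N i)
      ⟨le_rfl, hle⟩
  rw [Pi.mul_apply, mul_assoc, ← mul_sub, abs_mul]
  exact mul_le_mul (hU _ hm) h5 (abs_nonneg _) hU0

theorem rsIntegral_id {f : ℝ → ℝ} {a b : ℝ} (hab : a ≤ b) (hf : ContinuousOn f (Icc a b)) :
    rsIntegral f (fun t => t) a b = ∫ x in a..b, f x := by
  have hid : IsControl (fun t => t) (fun t => t) a b := fun s t _ hst _ => by
    rw [abs_of_nonneg (by linarith)]
  have h1 := tendsto_leftSum hab (hasRSIntegral_rsIntegral hab hf hid)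
  refine eq_of_abs_sub_le_all fun η hη => ?_
  set ε := η / (b - a + 1) with hε_def
  have hba : 0 ≤ b - a := by linarith
  have hε : 0 < ε := by positivity
  obtain ⟨δ, hδ, H⟩ := exists_modulus hf hε
  obtain ⟨K, hK⟩ := exists_unifPart_mesh a b hδ
  refine le_of_tendsto (h1.sub (tendsto_const_nhds (x := ∫ x in a..b, f x))).abs
    (Filter.eventually_atTop.2 ⟨K + 1, fun N hN => ?_⟩)
  have hm : ∀ i ≤ N, unifPart a b N i ∈ Icc a b :=
    fun i hi => unifPart_mem hab (show N ≠ 0 by omega) hi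
  have hle : ∀ i, unifPart a b N i ≤ unifPart a b N (i + 1) :=
    fun i => unifPart_monotone hab N (Nat.le_succ i)
  have hint : ∀ i < N, IntervalIntegrable f volume (unifPart a b N i) (unifPart a b N (i + 1)) :=
    fun i hi => (hf.mono (by
      rw [uIcc_of_le (hle i)]
      exact Icc_subset_Icc (hm i hi.le).1 (hm _ hi).2)).intervalIntegrable
  have h3 : ∫ x in a..b, f x = ∑ i ∈ Finset.range N,
      ∫ x in (unifPart a b N i)..(unifPart a b N (i + 1)), f x := by
    rw [intervalIntegral.sum_integral_adjacent_intervals hint, unifPart_zero,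
      unifPart_self _ _ (by omega)]
  have h4 : ∑ i ∈ Finset.range N, ε * (unifPart a b N (i + 1) - unifPart a b N i) ≤ η := by
    rw [← Finset.mul_sum, Finset.sum_range_sub (fun i => unifPart a b N i),
      unifPart_self _ _ (by omega), unifPart_zero, hε_def, div_mul_eq_mul_div,
      div_le_iff₀ (by positivity)]
    nlinarith
  refine le_trans ?_ h4
  rw [h3, rsSum, ← Finset.sum_sub_distrib]
  refine (Finset.abs_sum_le_sum_abs _ _).trans (Finset.sum_le_sum fun i hi => ?_)
  rw [Finset.mem_range] at hi
  have h5 : f (unifPart a b N i) * (unifPart a b N (i + 1) - unifPart a b N i)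
      = ∫ _x in (unifPart a b N i)..(unifPart a b N (i + 1)), f (unifPart a b N i) := by
    rw [intervalIntegral.integral_const, smul_eq_mul, mul_comm]
  rw [h5, ← intervalIntegral.integral_sub intervalIntegrable_const (hint i hi)]
  have h6 := intervalIntegral.norm_integral_le_of_norm_le_const (C := ε)
    (a := unifPart a b N i) (b := unifPart a b N (i + 1))
    (f := fun x => f (unifPart a b N i) - f x) (fun x hx => ?_)
  · rwa [Real.norm_eq_abs, abs_of_nonneg (sub_nonneg.2 (hle i))] at h6
  · rw [uIoc_of_le (hle i)] at hx
    have h7 := hK N (by omega)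
    rw [← unifPart_succ_sub a b N i] at h7
    refine H _ (hm i hi.le) x ⟨(hm i hi.le).1.trans hx.1.le, hx.2.trans (hm _ hi).2⟩ ?_
    rw [abs_sub_comm, abs_of_nonneg (by linarith [hx.1])]
    linarith [hx.2]

/-! ### Iterated integrals of controlled paths -/

/-- A continuous path on `[0, T]` all of whose coordinates are controlled by `ω`. -/
structure ControlledPath {d : ℕ} (ω : ℝ → ℝ) (Y : ℝ → Fin d → ℝ) (T : ℝ) : Prop where
  cont : ∀ j, ContinuousOn (fun s => Y s j) (Icc 0 T)
  control : ∀ j, IsControl ω (fun s => Y s j) 0 T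

section IterInt

variable {d : ℕ} {ω : ℝ → ℝ} {Y : ℝ → Fin d → ℝ} {T : ℝ}

theorem continuousOn_iterInt (h : ControlledPath ω Y T) (k : ℕ) (I : Fin k → Fin d) :
    ContinuousOn (iterInt Y k I) (Icc 0 T) := by
  induction k with
  | zero => exact continuousOn_const
  | succ k ih => exact continuousOn_rsIntegral (ih _) (h.cont _) (h.control _)

theorem exists_isControl_iterInt (h : ControlledPath ω Y T) (k : ℕ) (I : Fin (k + 1) → Fin d) :
    ∃ ω', IsControl ω' (iterInt Y (k + 1) I) 0 T := by
  have hc := continuousOn_iterInt h k (Fin.init I)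
  obtain ⟨M, -, hM⟩ := exists_abs_bound hc
  exact ⟨_, (h.control _).rsIntegral hc hM⟩

theorem iterInt_snoc (Y : ℝ → Fin d → ℝ) (k : ℕ) (I : Fin k → Fin d) (j : Fin d) (t : ℝ) :
    iterInt Y (k + 1) (Fin.snoc (α := fun _ => Fin d) I j) t
      = rsIntegral (iterInt Y k I) (fun s => Y s j) 0 t := by
  simp only [iterInt, Fin.init_snoc, Fin.snoc_last]

/-- A discrete form of `(k + 1) x ^ k dx = d (x ^ (k + 1))`, with the inequality in the direction
suited to left sums. -/
theorem succ_mul_pow_mul_sub_le {x y : ℝ} (hx : 0 ≤ x) (hxy : x ≤ y) (k : ℕ) :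
    (k + 1) * (x ^ k * (y - x)) ≤ y ^ (k + 1) - x ^ (k + 1) := by
  induction k with
  | zero => simp
  | succ k ih =>
    have h1 : 0 ≤ x ^ k * (y - x) := mul_nonneg (pow_nonneg hx _) (by linarith)
    have h2 : y ^ (k + 1 + 1) - x ^ (k + 1 + 1)
        = y * (y ^ (k + 1) - x ^ (k + 1)) + x * (x ^ k * (y - x)) := by ring
    have h3 : x * ((k + 1) * (x ^ k * (y - x))) ≤ y * (y ^ (k + 1) - x ^ (k + 1)) :=
      mul_le_mul hxy ih (by positivity) (hx.trans hxy)
    rw [h2]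
    push_cast
    calc ((k : ℝ) + 1 + 1) * (x ^ (k + 1) * (y - x))
        = x * ((k + 1) * (x ^ k * (y - x))) + x * (x ^ k * (y - x)) := by ring
      _ ≤ _ := by linarith

/-- Left sums are compared termwise with the telescoping increments of `(ω - ω 0) ^ (k + 1) / (k +
1)!`; the factorial reflects integration over a simplex. -/
theorem abs_iterInt_le (h : ControlledPath ω Y T) (k : ℕ) (I : Fin k → Fin d) {t : ℝ}
    (ht : t ∈ Icc 0 T) : |iterInt Y k I t| ≤ (ω t - ω 0) ^ k / k.factorial := by
  induction k generalizing t with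
  | zero => simp [iterInt]
  | succ k ih =>
    have hc := (continuousOn_iterInt h k (Fin.init I)).mono (Icc_subset_Icc_right ht.2)
    have hg := (h.control (I (Fin.last k))).mono le_rfl ht.2
    refine le_of_tendsto (tendsto_leftSum ht.1 (hasRSIntegral_rsIntegral ht.1 hc hg)).abs
      (Filter.eventually_atTop.2 ⟨1, fun N hN => ?_⟩)
    have hm : ∀ i ≤ N, unifPart 0 t N i ∈ Icc 0 t :=
      fun i hi => unifPart_mem ht.1 (show N ≠ 0 by omega) hi
    have h1 : (ω t - ω 0) ^ (k + 1) / (k + 1).factorial = ∑ i ∈ Finset.range N,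
        ((ω (unifPart 0 t N (i + 1)) - ω 0) ^ (k + 1) / (k + 1).factorial
          - (ω (unifPart 0 t N i) - ω 0) ^ (k + 1) / (k + 1).factorial) := by
      rw [Finset.sum_range_sub
        (fun i => (ω (unifPart 0 t N i) - ω 0) ^ (k + 1) / ((k + 1).factorial : ℝ)),
        unifPart_zero, unifPart_self _ _ (by omega)]
      simp
    rw [h1, rsSum]
    refine (Finset.abs_sum_le_sum_abs _ _).trans (Finset.sum_le_sum fun i hi => ?_)
    rw [Finset.mem_range] at hi
    have hmi := hm i hi.le
    have hmi' := hm (i + 1) hi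
    have hle : unifPart 0 t N i ≤ unifPart 0 t N (i + 1) :=
      unifPart_monotone ht.1 N (Nat.le_succ i)
    have h2 := ih (Fin.init I) (t := unifPart 0 t N i) ⟨hmi.1, hmi.2.trans ht.2⟩
    have h3 := hg _ _ hmi.1 hle hmi'.2
    have h0 := hg.le le_rfl hmi.1 hmi.2
    have hle' := hg.le hmi.1 hle hmi'.2
    have h4 := succ_mul_pow_mul_sub_le (x := ω (unifPart 0 t N i) - ω 0)
      (y := ω (unifPart 0 t N (i + 1)) - ω 0) (by linarith) (by linarith) k
    rw [abs_mul]
    refine (mul_le_mul h2 h3 (abs_nonneg _) ((abs_nonneg _).trans h2)).trans ?_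
    rw [← sub_div, Nat.factorial_succ, Nat.cast_mul, div_mul_eq_mul_div,
      div_le_div_iff₀ (by positivity) (by positivity)]
    push_cast
    have hf : (0 : ℝ) ≤ k.factorial := by positivity
    nlinarith

end IterInt

/-- By induction on the order, an iterated integral is an almost sure limit of left sums of
measurable terms. Only almost everywhere measurability results, since paths are controlled only
almost surely. -/
theorem aemeasurable_iterInt {A : Type*} [MeasurableSpace A] {ν : Measure A} {d : ℕ} {T : ℝ}
    {Y : A → ℝ → Fin d → ℝ} (hY : ∀ t j, Measurable fun a => Y a t j)
    (h : ∀ᵐ a ∂ν, ∃ ω, ControlledPath ω (Y a) T) (k : ℕ) (I : Fin k → Fin d) {t : ℝ}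
    (ht : t ∈ Icc 0 T) : AEMeasurable (fun a => iterInt (Y a) k I t) ν := by
  induction k generalizing t with
  | zero => exact aemeasurable_const
  | succ k ih =>
    refine aemeasurable_of_tendsto_metrizable_ae' (f := fun N a =>
      rsSum (iterInt (Y a) k (Fin.init I)) (fun s => Y a s (I (Fin.last k))) (N + 1)
        (unifPart 0 t (N + 1)) (unifPart 0 t (N + 1))) (fun N => ?_) ?_
    · refine Finset.aemeasurable_fun_sum _ fun i hi => ?_
      rw [Finset.mem_range] at hi
      have hm := unifPart_mem ht.1 (Nat.succ_ne_zero N) hi.le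
      exact (ih (Fin.init I) ⟨hm.1, hm.2.trans ht.2⟩).mul
        ((hY _ _).sub (hY _ _)).aemeasurable
    · filter_upwards [h] with a ⟨ω, ha⟩
      exact (Filter.tendsto_add_atTop_iff_nat 1).2 (tendsto_leftSum ht.1
        (hasRSIntegral_rsIntegral ht.1
          ((continuousOn_iterInt ha k (Fin.init I)).mono (Icc_subset_Icc_right ht.2))
          ((ha.control (I (Fin.last k))).mono le_rfl ht.2)))

/-! ### The algebra of linear functionals of the signature -/

section SigFunctional

variable {G : Type*} {d : ℕ} {T : ℝ} {Y : G → ℝ → Fin d → ℝ} {ω : G → ℝ → ℝ}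

/-- The span of the iterated integrals, as functions of the path and the time. -/
def sigSpan (Y : G → ℝ → Fin d → ℝ) : Submodule ℝ (G → ℝ → ℝ) :=
  Submodule.span ℝ (range fun (w : Σ k, Fin k → Fin d) x => iterInt (Y x) w.1 w.2)

/-- `u` agrees on `[0, T]` with a linear combination of iterated integrals. -/
def IsSigFunctional (Y : G → ℝ → Fin d → ℝ) (T : ℝ) (u : G → ℝ → ℝ) : Prop :=
  ∃ v ∈ sigSpan Y, ∀ x, EqOn (u x) (v x) (Icc 0 T)

theorem isSigFunctional_iterInt (k : ℕ) (I : Fin k → Fin d) :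
    IsSigFunctional Y T fun x => iterInt (Y x) k I :=
  ⟨_, Submodule.subset_span ⟨⟨k, I⟩, rfl⟩, fun _ _ _ => rfl⟩

theorem isSigFunctional_const (c : ℝ) : IsSigFunctional Y T fun _ _ => c := by
  refine ⟨_, (sigSpan Y).smul_mem c (Submodule.subset_span ⟨⟨0, Fin.elim0⟩, rfl⟩),
    fun x t _ => ?_⟩
  simp [iterInt]

theorem IsSigFunctional.add {u v : G → ℝ → ℝ} (hu : IsSigFunctional Y T u)
    (hv : IsSigFunctional Y T v) : IsSigFunctional Y T fun x t => u x t + v x t := by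
  obtain ⟨u', hu', hu⟩ := hu
  obtain ⟨v', hv', hv⟩ := hv
  exact ⟨_, (sigSpan Y).add_mem hu' hv', fun x t ht => by simp [hu x ht, hv x ht]⟩

theorem IsSigFunctional.const_mul {u : G → ℝ → ℝ} (hu : IsSigFunctional Y T u) (c : ℝ) :
    IsSigFunctional Y T fun x t => c * u x t := by
  obtain ⟨u', hu', hu⟩ := hu
  exact ⟨_, (sigSpan Y).smul_mem c hu', fun x t ht => by simp [hu x ht]⟩

theorem IsSigFunctional.congr {u v : G → ℝ → ℝ} (hu : IsSigFunctional Y T u)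
    (h : ∀ x, EqOn (v x) (u x) (Icc 0 T)) : IsSigFunctional Y T v := by
  obtain ⟨u', hu', hu⟩ := hu
  exact ⟨u', hu', fun x => (h x).trans (hu x)⟩

theorem continuousOn_of_mem_sigSpan (hY : ∀ x, ControlledPath (ω x) (Y x) T) {v : G → ℝ → ℝ}
    (hv : v ∈ sigSpan Y) (x : G) : ContinuousOn (v x) (Icc 0 T) := by
  induction hv using Submodule.span_induction with
  | mem v hv =>
    obtain ⟨w, rfl⟩ := hv
    exact continuousOn_iterInt (hY x) _ _
  | zero => exact continuousOn_const
  | add u v _ _ hu hv => exact hu.add hv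
  | smul c u _ hu => exact hu.const_smul c

/-- On generators, integrating against coordinate `j` appends the letter `j` to the word; linearity
of the integral does the rest. -/
theorem IsSigFunctional.rsIntegral (hY : ∀ x, ControlledPath (ω x) (Y x) T) {u : G → ℝ → ℝ}
    (hu : IsSigFunctional Y T u) (j : Fin d) :
    IsSigFunctional Y T fun x t => rsIntegral (u x) (fun s => Y x s j) 0 t := by
  obtain ⟨v, hv, h⟩ := hu
  have hcg : ∀ x, ∀ t ∈ Icc (0 : ℝ) T, IsControl (ω x) (fun s => Y x s j) 0 t :=
    fun x t ht => ((hY x).control j).mono le_rfl ht.2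
  suffices H : IsSigFunctional Y T fun x t => PSLR.rsIntegral (v x) (fun s => Y x s j) 0 t by
    refine H.congr fun x t ht => ?_
    have hs : Icc (0 : ℝ) t ⊆ Icc 0 T := Icc_subset_Icc_right ht.2
    exact rsIntegral_congr ht.1 (((continuousOn_of_mem_sigSpan hY hv x).congr (h x)).mono hs)
      ((h x).mono hs) (hcg x t ht)
  clear h
  induction hv using Submodule.span_induction with
  | mem v hv =>
    obtain ⟨w, rfl⟩ := hv
    refine (isSigFunctional_iterInt (w.1 + 1) (Fin.snoc (α := fun _ => Fin d) w.2 j)).congr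
      fun x t _ => ?_
    rw [iterInt_snoc]
  | zero =>
    refine (isSigFunctional_const 0).congr fun x t ht => ?_
    have := rsIntegral_const_mul_add (f₁ := fun _ => 0) (f₂ := fun _ => 0) ht.1
      continuousOn_const continuousOn_const (hcg x t ht) 1
    simp only [mul_zero, add_zero, one_mul] at this
    simp only [Pi.zero_apply]
    change PSLR.rsIntegral (fun _ => 0) _ 0 t = 0
    linarith
  | add u v hu hv ihu ihv =>
    refine (ihu.add ihv).congr fun x t ht => ?_
    have hs : Icc (0 : ℝ) t ⊆ Icc 0 T := Icc_subset_Icc_right ht.2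
    have := rsIntegral_const_mul_add ht.1 ((continuousOn_of_mem_sigSpan hY hu x).mono hs)
      ((continuousOn_of_mem_sigSpan hY hv x).mono hs) (hcg x t ht) 1
    simp only [one_mul] at this
    exact this
  | smul c u hu ihu =>
    refine (ihu.const_mul c).congr fun x t ht => ?_
    have hs : Icc (0 : ℝ) t ⊆ Icc 0 T := Icc_subset_Icc_right ht.2
    have hz := rsIntegral_const_mul_add (f₁ := fun _ => 0) (f₂ := fun _ => 0) ht.1
      continuousOn_const continuousOn_const (hcg x t ht) 1
    have := rsIntegral_const_mul_add (f₂ := fun _ => 0) ht.1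
      ((continuousOn_of_mem_sigSpan hY hu x).mono hs) continuousOn_const (hcg x t ht) c
    simp only [mul_zero, add_zero, one_mul] at this hz
    change PSLR.rsIntegral (fun s => c * u x s) _ 0 t = _
    linarith

/-- Products of iterated integrals are linear combinations of iterated integrals. -/
theorem isSigFunctional_iterInt_mul (hY : ∀ x, ControlledPath (ω x) (Y x) T) (N : ℕ) :
    ∀ (k l : ℕ) (I : Fin k → Fin d) (J : Fin l → Fin d), k + l ≤ N →
    IsSigFunctional Y T fun x t => iterInt (Y x) k I t * iterInt (Y x) l J t := by
  induction N with
  | zero =>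
    intro k l I J h
    obtain rfl : k = 0 := by omega
    exact (isSigFunctional_iterInt l J).congr fun x t _ => by simp [iterInt]
  | succ N ih =>
    intro k l I J h
    rcases k with _ | k
    · exact (isSigFunctional_iterInt l J).congr fun x t _ => by simp [iterInt]
    rcases l with _ | l
    · exact (isSigFunctional_iterInt _ I).congr fun x t _ => by simp [iterInt]
    -- The Leibniz rule `d(AB) = A dB + B dA` lowers the total length by one inside each integral,
    -- which is the recursion of the shuffle product.
    have h1 := (ih (k + 1) l I (Fin.init J) (by omega)).rsIntegral hY (J (Fin.last l))
    have h2 := (ih (l + 1) k J (Fin.init I) (by omega)).rsIntegral hY (I (Fin.last k))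
    refine (h1.add h2).congr fun x t ht => ?_
    have hs : Icc (0 : ℝ) t ⊆ Icc 0 T := Icc_subset_Icc_right ht.2
    have hA := (continuousOn_iterInt (hY x) (k + 1) I).mono hs
    have hB := (continuousOn_iterInt (hY x) (l + 1) J).mono hs
    have ha := (continuousOn_iterInt (hY x) k (Fin.init I)).mono hs
    have hb := (continuousOn_iterInt (hY x) l (Fin.init J)).mono hs
    obtain ⟨ωA, hωA⟩ := exists_isControl_iterInt (hY x) k I
    obtain ⟨ωB, hωB⟩ := exists_isControl_iterInt (hY x) l J
    have hp := rsIntegral_add_rsIntegral ht.1 hA hB (hωB.mono le_rfl ht.2)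
      (hωA.mono le_rfl ht.2)
    have e1 := rsIntegral_rsIntegral ht.1 hA hb
      (((hY x).control (J (Fin.last l))).mono le_rfl ht.2)
    have e2 := rsIntegral_rsIntegral ht.1 hB ha
      (((hY x).control (I (Fin.last k))).mono le_rfl ht.2)
    -- Iterated integrals of positive order vanish at time `0`, which removes the boundary term.
    have h0 : iterInt (Y x) (k + 1) I 0 = 0 := rsIntegral_self _ _ _
    rw [h0, zero_mul, sub_zero] at hp
    exact hp.symm.trans (congrArg₂ (· + ·) e1 e2)

theorem IsSigFunctional.mul (hY : ∀ x, ControlledPath (ω x) (Y x) T) {u v : G → ℝ → ℝ}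
    (hu : IsSigFunctional Y T u) (hv : IsSigFunctional Y T v) :
    IsSigFunctional Y T fun x t => u x t * v x t := by
  obtain ⟨u', hu', hu⟩ := hu
  obtain ⟨v', hv', hv⟩ := hv
  suffices H : IsSigFunctional Y T fun x t => u' x t * v' x t from
    H.congr fun x t ht => by simp [hu x ht, hv x ht]
  clear hu hv
  induction hu' using Submodule.span_induction with
  | mem u hu =>
    obtain ⟨w, rfl⟩ := hu
    induction hv' using Submodule.span_induction with
    | mem v hv =>
      obtain ⟨w', rfl⟩ := hv
      exact isSigFunctional_iterInt_mul hY _ _ _ _ _ le_rfl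
    | zero => exact (isSigFunctional_const 0).congr fun x t _ => by simp
    | add a b _ _ ha hb => exact (ha.add hb).congr fun x t _ => by simp [mul_add]
    | smul c a _ ha => exact (ha.const_mul c).congr fun x t _ => by simp [mul_left_comm]
  | zero => exact (isSigFunctional_const 0).congr fun x t _ => by simp
  | add a b _ _ ha hb => exact (ha.add hb).congr fun x t _ => by simp [add_mul]
  | smul c a _ ha => exact (ha.const_mul c).congr fun x t _ => by simp [mul_assoc]

theorem isSigFunctional_increment (hY : ∀ x, ControlledPath (ω x) (Y x) T) (j : Fin d) :
    IsSigFunctional Y T fun x t => Y x t j - Y x 0 j := by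
  refine ((isSigFunctional_const 1).rsIntegral hY j).congr fun x t ht => ?_
  exact (rsIntegral_one ht.1 (((hY x).control j).mono le_rfl ht.2)).symm

theorem IsSigFunctional.pow (hY : ∀ x, ControlledPath (ω x) (Y x) T) {u : G → ℝ → ℝ}
    (hu : IsSigFunctional Y T u) (k : ℕ) : IsSigFunctional Y T fun x t => u x t ^ k := by
  induction k with
  | zero => simpa using isSigFunctional_const 1
  | succ k ih => simpa only [pow_succ] using ih.mul hY hu

theorem sum_word_eq_sum_range {d p : ℕ} (f : (k : ℕ) → (Fin k → Fin d) → ℝ) :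
    ∑ w : Word d p, f w.1 w.2 = ∑ k ∈ Finset.range (p + 1), ∑ I : Fin k → Fin d, f k I := by
  rw [Fintype.sum_sigma, Fin.sum_univ_eq_sum_range (fun k => ∑ I : Fin k → Fin d, f k I)]

theorem IsSigFunctional.exists_coeff {u : G → ℝ → ℝ} (hu : IsSigFunctional Y T u) :
    ∃ (p : ℕ) (β : (k : ℕ) → (Fin k → Fin d) → ℝ), ∀ x, ∀ t ∈ Icc 0 T,
      u x t = ∑ w : Word d p, iterInt (Y x) w.1 w.2 t * β w.1 w.2 := by
  obtain ⟨v, hv, h⟩ := hu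
  -- Vanishing of the coefficients above `p` is carried along so that representations of different
  -- orders can be brought to a common one and added.
  suffices H : ∃ (p : ℕ) (β : (k : ℕ) → (Fin k → Fin d) → ℝ),
      (∀ k > p, β k = 0) ∧ ∀ x t, v x t =
        ∑ k ∈ Finset.range (p + 1), ∑ I : Fin k → Fin d, iterInt (Y x) k I t * β k I by
    obtain ⟨p, β, -, H⟩ := H
    refine ⟨p, β, fun x t ht => ?_⟩
    rw [h x ht, H, sum_word_eq_sum_range fun k I => iterInt (Y x) k I t * β k I]
  have ext : ∀ {p p' : ℕ} (β : (k : ℕ) → (Fin k → Fin d) → ℝ), (∀ k > p, β k = 0) → p ≤ p' →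
      ∀ x t, ∑ k ∈ Finset.range (p + 1), ∑ I : Fin k → Fin d, iterInt (Y x) k I t * β k I
        = ∑ k ∈ Finset.range (p' + 1), ∑ I : Fin k → Fin d, iterInt (Y x) k I t * β k I := by
    intro p p' β hβ hp x t
    refine Finset.sum_subset (Finset.range_mono (by omega)) fun k _ hk => ?_
    rw [Finset.mem_range, not_lt] at hk
    simp [hβ k (by omega)]
  clear h
  induction hv using Submodule.span_induction with
  | mem v hv =>
    obtain ⟨⟨l, J⟩, rfl⟩ := hv
    classical
    refine ⟨l, fun k I => if h : k = l then (if I = fun i => J (Fin.cast h i) then 1 else 0)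
      else 0, fun k hk => ?_, fun x t => ?_⟩
    · ext I; simp [show k ≠ l by omega]
    · rw [Finset.sum_range_succ, Finset.sum_eq_zero]
      · simp
      · intro k hk
        rw [Finset.mem_range] at hk
        simp [show k ≠ l by omega]
  | zero => exact ⟨0, 0, fun _ _ => rfl, fun x t => by simp⟩
  | add a b _ _ ha hb =>
    obtain ⟨p, β, hβ, ha⟩ := ha
    obtain ⟨p', β', hβ', hb⟩ := hb
    refine ⟨max p p', β + β', fun k hk => ?_, fun x t => ?_⟩
    · simp [hβ k (lt_of_le_of_lt (le_max_left _ _) hk),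
        hβ' k (lt_of_le_of_lt (le_max_right _ _) hk)]
    · simp only [Pi.add_apply, ha, hb, ext β hβ (le_max_left p p'),
        ext β' hβ' (le_max_right p p'), mul_add, Finset.sum_add_distrib]
  | smul c a _ ha =>
    obtain ⟨p, β, hβ, ha⟩ := ha
    refine ⟨p, c • β, fun k hk => by simp [hβ k hk], fun x t => ?_⟩
    simp only [Pi.smul_apply, smul_eq_mul, ha, Finset.mul_sum]
    exact Finset.sum_congr rfl fun k _ => Finset.sum_congr rfl fun I _ => by ring

end SigFunctional

/-! ### Time-augmented continuous paths of bounded variation -/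

section Paths

variable {m : ℕ} {T : ℝ≥0}

theorem augment_castSucc (x : CPath m T) (t : ℝ) (i : Fin m) :
    augment x t i.castSucc = IccExtend T.2 x t i := by
  simp [augment]

theorem augment_last (x : CPath m T) (t : ℝ) : augment x t (Fin.last m) = t := by
  simp [augment]

theorem continuous_augment_uncurry (j : Fin (m + 1)) :
    Continuous fun z : CPath m T × ℝ => augment z.1 z.2 j := by
  induction j using Fin.lastCases with
  | last => simp only [augment_last]; exact continuous_snd
  | cast i =>
    simp only [augment_castSucc]
    unfold IccExtend
    fun_prop

theorem continuous_augment (x : CPath m T) (j : Fin (m + 1)) :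
    Continuous fun t => augment x t j :=
  (continuous_augment_uncurry j).comp (Continuous.prodMk_right x)

theorem measurable_augment (t : ℝ) (j : Fin (m + 1)) :
    Measurable fun x : CPath m T => augment x t j :=
  ((continuous_augment_uncurry j).comp (Continuous.prodMk_left t)).measurable

theorem augment_castSucc_of_mem (x : CPath m T) {t : ℝ} (ht : t ∈ Icc (0 : ℝ) T) (i : Fin m) :
    augment x t i.castSucc = x ⟨t, ht⟩ i := by
  rw [augment_castSucc]
  exact congrArg (fun v : EuclideanSpace ℝ (Fin m) => v i) (IccExtend_of_mem _ _ ht)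

/-- The variation on `[0, t]` plus `t` controls every coordinate at once: the first part handles the
space coordinates through the Euclidean norm, the second handles time. -/
theorem exists_controlledPath {x : CPath m T} {CX : ℝ} (hCX : 0 < CX)
    (hx : eVariationOn x univ < ENNReal.ofReal CX) :
    ∃ ω, ControlledPath ω (augment x) T ∧ ω T - ω 0 ≤ CX + T := by
  set xe : ℝ → EuclideanSpace ℝ (Fin m) := IccExtend T.2 x with hxe
  set e : ℝ → ℝ≥0∞ := fun t => eVariationOn xe (univ ∩ Icc 0 t) with he
  -- The extended path is `x` composed with the monotone projection onto `[0, T]`, and a monotone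
  -- reparametrization does not increase variation.
  have hle : ∀ t, e t ≤ eVariationOn x univ := fun t =>
    eVariationOn.comp_le_of_monotoneOn x (t := univ ∩ Icc 0 t) (projIcc (0 : ℝ) T T.2)
      ((monotone_projIcc T.2).monotoneOn _) (mapsTo_univ _ _)
  have hfin : ∀ t, e t ≠ ∞ := fun t => ((hle t).trans_lt (hx.trans_le le_top)).ne
  have hbd : ∀ t, (e t).toReal ≤ CX := fun t =>
    ENNReal.toReal_le_of_le_ofReal hCX.le ((hle t).trans hx.le)
  have hadd : ∀ s t, 0 ≤ s → s ≤ t → ‖xe t - xe s‖ ≤ (e t).toReal - (e s).toReal := by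
    intro s t hs hst
    have h1 := eVariationOn.Icc_add_Icc xe hs hst (mem_univ s)
    have h2 : e s + edist (xe t) (xe s) ≤ e t := by
      rw [he]
      simp only []
      rw [← h1]
      gcongr
      exact eVariationOn.edist_le xe ⟨mem_univ _, hst, le_rfl⟩ ⟨mem_univ _, le_rfl, hst⟩
    have h3 := ENNReal.toReal_mono (hfin t) h2
    rw [ENNReal.toReal_add (hfin s) (edist_ne_top _ _), ← dist_edist, dist_eq_norm] at h3
    linarith
  refine ⟨fun t => (e t).toReal + t, ⟨fun j => (continuous_augment x j).continuousOn,
    fun j s t hs hst ht => ?_⟩, ?_⟩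
  · have h1 := hadd s t hs hst
    induction j using Fin.lastCases with
    | last =>
      simp only [augment_last]
      rw [abs_of_nonneg (by linarith)]
      linarith [norm_nonneg (xe t - xe s)]
    | cast i =>
      simp only [augment_castSucc]
      have := PiLp.norm_apply_le (xe t - xe s) i
      rw [Real.norm_eq_abs, PiLp.sub_apply] at this
      linarith
  · have := hbd T
    have := ENNReal.toReal_nonneg (a := e 0)
    linarith

/-- A single term of the exponential series bounds all orders simultaneously, so the feature bound
does not depend on `p`. -/
theorem abs_iterInt_augment_le {x : CPath m T} {CX : ℝ} (hCX : 0 < CX)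
    (hx : eVariationOn x univ < ENNReal.ofReal CX) (k : ℕ) (I : Fin k → Fin (m + 1)) :
    |iterInt (augment x) k I T| ≤ Real.exp (CX + T) := by
  obtain ⟨ω, hω, hT⟩ := exists_controlledPath hCX hx
  have h0 : ω 0 ≤ ω T := (hω.control 0).le le_rfl T.2 le_rfl
  refine (abs_iterInt_le hω k I ⟨T.2, le_rfl⟩).trans ?_
  refine le_trans ?_ (Real.pow_div_factorial_le_exp (CX + T) (by positivity) k)
  have : (0 : ℝ) ≤ ω T - ω 0 := by linarith
  exact div_le_div_of_nonneg_right (pow_le_pow_left₀ this hT k) (Nat.cast_nonneg _)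

theorem aemeasurable_iterInt_augment {A : Type*} [MeasurableSpace A] {P : Measure A}
    {X : A → CPath m T} (hXm : Measurable X) {CX : ℝ} (hCX : 0 < CX)
    (hX : ∀ᵐ a ∂P, eVariationOn (X a) univ < ENNReal.ofReal CX) (k : ℕ)
    (I : Fin k → Fin (m + 1)) : AEMeasurable (fun a => iterInt (augment (X a)) k I T) P := by
  refine aemeasurable_iterInt (T := T) (fun t j => (measurable_augment t j).comp hXm) ?_ k I
    ⟨T.2, le_rfl⟩
  filter_upwards [hX] with x hx
  obtain ⟨ω, hω, -⟩ := exists_controlledPath hCX hx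
  exact ⟨ω, hω⟩

/-! ### Polynomial moments determine a path -/

/-- By Weierstrass, `∫ f ^ 2 = ∫ f * (f - p)` is arbitrarily small for suitable polynomials `p`; a
continuous nonnegative integrand with zero integral vanishes. -/
theorem eqOn_zero_of_moments {f : ℝ → ℝ} {b : ℝ} (hb : 0 < b) (hf : Continuous f)
    (h : ∀ k : ℕ, ∫ t in (0 : ℝ)..b, f t * t ^ k = 0) : EqOn f 0 (Icc 0 b) := by
  have hpoly : ∀ p : Polynomial ℝ, ∫ t in (0 : ℝ)..b, f t * p.eval t = 0 := by
    intro p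
    induction p using Polynomial.induction_on' with
    | add p q hp hq =>
      simp only [Polynomial.eval_add, mul_add]
      rw [intervalIntegral.integral_add, hp, hq, add_zero] <;>
      exact (hf.mul (Polynomial.continuous _)).intervalIntegrable _ _
    | monomial k a =>
      simp only [Polynomial.eval_monomial]
      have : ∀ t, f t * (a * t ^ k) = a * (f t * t ^ k) := fun t => by ring
      simp only [this, intervalIntegral.integral_const_mul, h k, mul_zero]
  obtain ⟨M, hM0, hM⟩ := exists_abs_bound (a := 0) (b := b) hf.continuousOn
  have hsq : ∫ t in (0 : ℝ)..b, f t * f t ≤ 0 := by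
    refine le_of_forall_pos_le_add fun η hη => ?_
    set ε := η / (M * b + 1) with hε_def
    have hε : 0 < ε := by positivity
    obtain ⟨p, hp⟩ := exists_polynomial_near_of_continuousOn 0 b f hf.continuousOn ε hε
    have h1 : ∫ t in (0 : ℝ)..b, f t * f t = ∫ t in (0 : ℝ)..b, f t * (f t - p.eval t) := by
      simp only [mul_sub]
      rw [intervalIntegral.integral_sub, hpoly, sub_zero]
      · exact (hf.mul hf).intervalIntegrable _ _
      · exact (hf.mul (Polynomial.continuous _)).intervalIntegrable _ _
    have h2 := intervalIntegral.norm_integral_le_of_norm_le_const (C := M * ε) (a := 0) (b := b)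
      (f := fun t => f t * (f t - p.eval t)) (fun t ht => by
        rw [uIoc_of_le hb.le] at ht
        have htm : t ∈ Icc 0 b := ⟨ht.1.le, ht.2⟩
        rw [Real.norm_eq_abs, abs_mul]
        have := hp t htm
        rw [abs_sub_comm] at this
        exact mul_le_mul (hM t htm) this.le (abs_nonneg _) hM0)
    rw [h1, zero_add]
    refine (le_abs_self _).trans (h2.trans ?_)
    rw [sub_zero, abs_of_pos hb, hε_def, ← mul_div_assoc, div_mul_eq_mul_div,
      div_le_iff₀ (by positivity)]
    nlinarith
  intro t ht
  by_contra hne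
  have := intervalIntegral.integral_pos hb ((hf.mul hf).continuousOn)
    (fun x _ => mul_self_nonneg (f x)) ⟨t, ht, mul_self_pos.2 hne⟩
  simp only [Pi.mul_apply] at this
  linarith

/-- The polynomial moments of a path relative to the base point `x₀`. -/
def moments (x₀ : EuclideanSpace ℝ (Fin m)) (x : CPath m T) (j : Fin m × ℕ) : ℝ :=
  ∫ t in (0 : ℝ)..T, (augment x t j.1.castSucc - x₀ j.1) * t ^ j.2

theorem continuous_moments (x₀ : EuclideanSpace ℝ (Fin m)) :
    Continuous (moments (T := T) x₀) := by
  refine continuous_pi fun j => ?_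
  refine intervalIntegral.continuous_parametric_intervalIntegral_of_continuous' ?_ _ _
  exact ((continuous_augment_uncurry j.1.castSucc).sub continuous_const).mul (continuous_snd.pow _)

/-- The base point cancels in the difference of two moments, so `x₀` plays no role in injectivity;
it is there to make the integrand an increment for paths starting at `x₀`. -/
theorem injective_moments (hT : 0 < T) (x₀ : EuclideanSpace ℝ (Fin m)) :
    Function.Injective (moments (T := T) x₀) := by
  intro x y hxy
  ext t i
  have hc : ∀ x : CPath m T, Continuous fun t => augment x t i.castSucc :=
    fun x => continuous_augment x _
  have h := eqOn_zero_of_moments (f := fun t => augment x t i.castSucc - augment y t i.castSucc)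
    (b := T) hT ((hc x).sub (hc y)) (fun k => by
      have h1 := congrFun hxy (i, k)
      simp only [moments] at h1
      rw [← sub_eq_zero, ← intervalIntegral.integral_sub] at h1
      · refine Eq.trans ?_ h1
        congr 1
        ext t
        ring
      · exact (((hc x).sub continuous_const).mul (continuous_id.pow _)).intervalIntegrable _ _
      · exact (((hc y).sub continuous_const).mul (continuous_id.pow _)).intervalIntegrable _ _)
  have h2 := h t.2
  simp only [Pi.zero_apply, augment_castSucc_of_mem _ t.2, sub_eq_zero] at h2
  exact h2

/-! ### Universality of the signature -/

/-- Paths of variation less than `CX` that start at `x₀`. -/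
abbrev BVPath (m : ℕ) (T : ℝ≥0) (CX : ℝ) (x₀ : EuclideanSpace ℝ (Fin m)) : Type :=
  {x : CPath m T // eVariationOn x univ < ENNReal.ofReal CX ∧ x ⟨0, le_refl 0, T.2⟩ = x₀}

variable {CX : ℝ} {x₀ : EuclideanSpace ℝ (Fin m)}

theorem augment_zero (x : BVPath m T CX x₀) (i : Fin m) :
    augment x.1 0 i.castSucc = x₀ i := by
  rw [augment_castSucc_of_mem x.1 ⟨le_rfl, T.2⟩]
  exact congrArg (fun v : EuclideanSpace ℝ (Fin m) => v i) x.2.2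

/-- The integrand is an increment of a space coordinate times a power of the increment of time, and
integrating against `dt` means integrating against the last coordinate. This is where time
augmentation enters. -/
theorem isSigFunctional_moments (hCX : 0 < CX) (j : Fin m × ℕ) :
    ∃ u : BVPath m T CX x₀ → ℝ → ℝ, IsSigFunctional (fun x => augment x.1) T u ∧
      ∀ x, moments x₀ x.1 j = u x T := by
  choose ω hω _ using fun x : BVPath m T CX x₀ => exists_controlledPath hCX x.2.1
  have h := (((isSigFunctional_increment hω j.1.castSucc).mul hω
    ((isSigFunctional_increment hω (Fin.last m)).pow hω j.2))).rsIntegral hω (Fin.last m)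
  refine ⟨_, h, fun x => ?_⟩
  simp only [augment_last, sub_zero, augment_zero]
  refine (rsIntegral_id T.2 ?_).symm
  exact (((continuous_augment x.1 _).sub continuous_const).mul
    (continuous_id.pow _)).continuousOn

/-- Supplies the compact box that replaces compactness of the set of paths. -/
theorem exists_bound_moments (hCX : 0 < CX) (j : Fin m × ℕ) :
    ∃ b, ∀ x : BVPath m T CX x₀, moments x₀ x.1 j ∈ Icc (-b) b := by
  refine ⟨(CX + T) * T ^ j.2 * |(T : ℝ) - 0|, fun x => ?_⟩
  rw [mem_Icc, ← abs_le]
  refine intervalIntegral.norm_integral_le_of_norm_le_const (a := (0 : ℝ)) (b := T)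
    (f := fun t => (augment x.1 t j.1.castSucc - x₀ j.1) * t ^ j.2) fun t ht => ?_
  rw [uIoc_of_le T.coe_nonneg] at ht
  obtain ⟨ω, hω, hT⟩ := exists_controlledPath hCX x.2.1
  have h1 := hω.control j.1.castSucc 0 t le_rfl ht.1.le ht.2
  have h2 := (hω.control j.1.castSucc).le ht.1.le ht.2 le_rfl
  simp only [augment_zero] at h1
  rw [Real.norm_eq_abs, abs_mul, abs_pow, abs_of_pos ht.1]
  have : |augment x.1 t j.1.castSucc - x₀ j.1| ≤ CX + T := by linarith
  have h3 := ht.2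
  have h4 := ht.1.le
  gcongr

/-- Linear functionals of the signature approximate bounded continuous functions of the path
in `L¹`. -/
theorem exists_sig_approx (hT : 0 < T) (hCX : 0 < CX) {A : Type*} [MeasurableSpace A] {P : Measure A}
    [IsProbabilityMeasure P] {X : A → CPath m T} (hXm : Measurable X)
    (hX : ∀ᵐ a ∂P, eVariationOn (X a) univ < ENNReal.ofReal CX)
    (hX₀ : ∀ᵐ a ∂P, X a ⟨0, le_refl 0, T.2⟩ = x₀)
    (F : BoundedContinuousFunction (CPath m T) ℝ) {ε : ℝ} (hε : 0 < ε) :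
    ∃ (p : ℕ) (β : Word (m + 1) p → ℝ),
      ∫ a, |F (X a) - ∑ w, truncSig p (X a) w * β w| ∂P ≤ ε := by
  classical
  choose ω hω _ using fun x : BVPath m T CX x₀ => exists_controlledPath hCX x.2.1
  have hΦc := continuous_moments (T := T) x₀
  -- An injective continuous map from a standard Borel space is a Borel embedding (Lusin–Souslin),
  -- so `F` factors through the moments via a Borel function `h`, in general discontinuous.
  have hΦ : MeasurableEmbedding (moments (T := T) x₀) :=
    hΦc.measurableEmbedding (injective_moments hT x₀)
  obtain ⟨h, hhm, hh⟩ := hΦ.exists_measurable_extend (F.continuous.measurable)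
    (fun _ => ⟨(0 : ℝ)⟩)
  have hhF : ∀ x, h (moments x₀ x) = F x := fun x => congrFun hh x
  have hFi : Integrable (fun a => F (X a)) P :=
    Integrable.of_bound (F.continuous.measurable.comp hXm).aestronglyMeasurable ‖F‖
      (Filter.Eventually.of_forall fun a => F.norm_coe_le_norm _)
  have hΦX : Measurable fun a => moments x₀ (X a) := hΦ.measurable.comp hXm
  have hhi : Integrable h (P.map fun a => moments x₀ (X a)) := by
    rw [integrable_map_measure hhm.aestronglyMeasurable hΦX.aemeasurable]
    simpa only [Function.comp_def, hhF] using hFi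
  have : IsProbabilityMeasure (P.map fun a => moments x₀ (X a)) :=
    Measure.isProbabilityMeasure_map hΦX.aemeasurable
  -- Continuity is restored by an `L¹` approximation under the law of the moments, at the cost of
  -- half the error.
  obtain ⟨g, hg, hgi⟩ := hhi.exists_boundedContinuous_integral_sub_le (half_pos hε)
  rw [integral_map hΦX.aemeasurable (f := fun y => ‖h y - g y‖)
    (hhi.sub hgi).norm.aestronglyMeasurable] at hg
  simp only [hhF, Real.norm_eq_abs] at hg
  choose b hb using fun j => exists_bound_moments (m := m) (T := T) (x₀ := x₀) hCX j
  set K : Set (Fin m × ℕ → ℝ) := Set.pi univ fun j => Icc (-b j) (b j) with hK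
  have hKc : IsCompact K := isCompact_univ_pi fun j => isCompact_Icc
  have : CompactSpace K := isCompact_iff_compactSpace.1 hKc
  have hmem : ∀ x : BVPath m T CX x₀, moments x₀ x.1 ∈ K := fun x j _ => hb j x
  -- Functions on the box whose pullback to admissible paths is a signature functional at the final
  -- time. Closure under products is the shuffle property.
  let 𝒜 : Subalgebra ℝ C(K, ℝ) :=
    { carrier := {f | ∃ u : BVPath m T CX x₀ → ℝ → ℝ,
        IsSigFunctional (fun x => augment x.1) T u ∧
          ∀ x, f ⟨moments x₀ x.1, hmem x⟩ = u x T}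
      mul_mem' := by
        rintro f f' ⟨u, hu, h⟩ ⟨u', hu', h'⟩
        exact ⟨_, hu.mul hω hu', fun x => by simp [h, h']⟩
      add_mem' := by
        rintro f f' ⟨u, hu, h⟩ ⟨u', hu', h'⟩
        exact ⟨_, hu.add hu', fun x => by simp [h, h']⟩
      algebraMap_mem' := fun c => ⟨_, isSigFunctional_const c, fun x => by simp⟩ }
  have hA : 𝒜.SeparatesPoints := by
    intro y y' hne
    obtain ⟨j, hj⟩ : ∃ j, y.1 j ≠ y'.1 j := by
      by_contra hcon
      push Not at hcon
      exact hne (Subtype.ext (funext hcon))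
    refine ⟨fun y => y.1 j, ⟨⟨fun y => y.1 j,
      (continuous_apply j).comp continuous_subtype_val⟩, ?_, rfl⟩, hj⟩
    exact isSigFunctional_moments hCX j
  have hcl := ContinuousMap.subalgebra_topologicalClosure_eq_top_of_separatesPoints 𝒜 hA
  let gK : C(K, ℝ) := ⟨fun y => g y.1, g.continuous.comp continuous_subtype_val⟩
  have hgK : gK ∈ closure (𝒜 : Set C(K, ℝ)) := by
    rw [← Subalgebra.topologicalClosure_coe, hcl]
    trivial
  obtain ⟨f, ⟨u, hu, hfu⟩, hf⟩ := Metric.mem_closure_iff.1 hgK (ε / 2) (half_pos hε)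
  obtain ⟨p, β, hβ⟩ := hu.exists_coeff
  refine ⟨p, fun w => β w.1 w.2, ?_⟩
  have hS : AEStronglyMeasurable
      (fun a => ∑ w : Word (m + 1) p, truncSig p (X a) w * β w.1 w.2) P := by
    refine (Finset.aemeasurable_fun_sum _ fun w _ => ?_).aestronglyMeasurable
    exact (aemeasurable_iterInt_augment hXm hCX hX _ _).mul_const _
  have hgS : ∀ᵐ a ∂P, |g (moments x₀ (X a)) - ∑ w : Word (m + 1) p, truncSig p (X a) w * β w.1 w.2|
      ≤ ε / 2 := by
    filter_upwards [hX, hX₀] with a hx hx0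
    have h1 := hβ ⟨X a, hx, hx0⟩ T ⟨T.2, le_rfl⟩
    rw [← hfu] at h1
    have h2 := (ContinuousMap.dist_apply_le_dist (f := gK) (g := f)
      ⟨moments x₀ (X a), hmem ⟨X a, hx, hx0⟩⟩).trans hf.le
    rw [Real.dist_eq, h1] at h2
    exact h2
  have hgint : Integrable (fun a => g (moments x₀ (X a))) P :=
    (integrable_map_measure hgi.aestronglyMeasurable hΦX.aemeasurable).1 hgi
  have hd : Integrable (fun a => g (moments x₀ (X a))
      - ∑ w : Word (m + 1) p, truncSig p (X a) w * β w.1 w.2) P :=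
    Integrable.of_bound (hgint.aestronglyMeasurable.sub hS) (ε / 2) hgS
  calc ∫ a, |F (X a) - ∑ w : Word (m + 1) p, truncSig p (X a) w * β w.1 w.2| ∂P
      ≤ ∫ a, (|F (X a) - g (moments x₀ (X a))| + |g (moments x₀ (X a))
        - ∑ w : Word (m + 1) p, truncSig p (X a) w * β w.1 w.2|) ∂P := by
        refine integral_mono_of_nonneg (Filter.Eventually.of_forall fun a => abs_nonneg _)
          ((hFi.sub hgint).abs.add hd.abs) (Filter.Eventually.of_forall fun a => ?_)
        exact abs_sub_le _ _ _
    _ = ∫ a, |F (X a) - g (moments x₀ (X a))| ∂P + ∫ a, |g (moments x₀ (X a))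
        - ∑ w : Word (m + 1) p, truncSig p (X a) w * β w.1 w.2| ∂P :=
        integral_add (hFi.sub hgint).abs hd.abs
    _ ≤ ε / 2 + ∫ _x, ε / 2 ∂P := by
        refine add_le_add hg ?_
        exact integral_mono_ae hd.abs (integrable_const _) hgS
    _ = ε := by simp

end Paths

/-! ### Maxima of exponentials and contraction -/

section ExpMax

variable {κ : Type*} [Fintype κ] [Nonempty κ]

/-- The maximum of `exp (a k)` over a finite index type. -/
def expMax (a : κ → ℝ) : ℝ := Finset.univ.sup' Finset.univ_nonempty fun k => Real.exp (a k)

theorem exp_le_expMax (a : κ → ℝ) (k : κ) : Real.exp (a k) ≤ expMax a :=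
  Finset.le_sup' (fun k => Real.exp (a k)) (Finset.mem_univ k)

theorem expMax_le {a : κ → ℝ} {c : ℝ} (h : ∀ k, Real.exp (a k) ≤ c) : expMax a ≤ c :=
  Finset.sup'_le _ _ fun k _ => h k

theorem exists_expMax_eq (a : κ → ℝ) : ∃ k, expMax a = Real.exp (a k) := by
  obtain ⟨k, -, hk⟩ := Finset.exists_mem_eq_sup' Finset.univ_nonempty fun k => Real.exp (a k)
  exact ⟨k, hk⟩

theorem expMax_pos (a : κ → ℝ) : 0 < expMax a := by
  obtain ⟨k, hk⟩ := exists_expMax_eq a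
  rw [hk]; exact Real.exp_pos _

theorem measurable_expMax {α : Type*} [MeasurableSpace α] {a : α → κ → ℝ}
    (ha : ∀ k, Measurable fun x => a x k) : Measurable fun x => expMax (a x) := by
  have : (fun x => expMax (a x))
      = Finset.univ.sup' Finset.univ_nonempty fun k x => Real.exp (a x k) := by
    ext x
    simp [expMax, Finset.sup'_apply]
  rw [this]
  exact Finset.measurable_sup' _ fun k _ => (ha k).exp

theorem integrable_expMax {α : Type*} [MeasurableSpace α] {P : Measure α} [IsFiniteMeasure P]
    {a : α → κ → ℝ} (ha : ∀ k, Measurable fun x => a x k) {c : ℝ} (hc : ∀ x k, a x k ≤ c) :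
    Integrable (fun x => expMax (a x)) P := by
  refine Integrable.of_bound (measurable_expMax ha).aestronglyMeasurable (Real.exp c)
    (Filter.Eventually.of_forall fun x => ?_)
  rw [Real.norm_eq_abs, abs_of_pos (expMax_pos _)]
  exact expMax_le fun k => Real.exp_le_exp.2 (hc x k)

/-- By convexity, the increment of `exp` grows with both the starting point and the step. The larger
of `t` and `s` decides which of the two increments can be lengthened, hence the maximum. -/
theorem exp_add_exp_sub_le {a b t s w v : ℝ} (hw : |w| ≤ |t|) (hv : |v| ≤ |s|)
    (hwv : |w - v| ≤ |t - s|) (h1 : b + v ≤ a + w) (h2 : a - w ≤ b - v)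
    (ht : 0 ≤ t) (hs : 0 ≤ s) :
    Real.exp (a + w) + Real.exp (b - v)
      ≤ max (Real.exp (a + t) + Real.exp (b - s)) (Real.exp (b + s) + Real.exp (a - t)) := by
  rw [abs_of_nonneg ht, abs_le] at hw
  rw [abs_of_nonneg hs, abs_le] at hv
  have key : ∀ x y e f : ℝ, x ≤ y → 0 ≤ e → e ≤ f →
      Real.exp (x + e) - Real.exp x ≤ Real.exp (y + f) - Real.exp y := by
    intro x y e f hxy he hef
    have h3 : Real.exp (x + e) - Real.exp x = Real.exp x * (Real.exp e - 1) := by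
      rw [Real.exp_add]; ring
    have h4 : Real.exp (y + f) - Real.exp y = Real.exp y * (Real.exp f - 1) := by
      rw [Real.exp_add]; ring
    rw [h3, h4]
    refine mul_le_mul (Real.exp_le_exp.2 hxy) ?_ ?_ (Real.exp_pos _).le
    · linarith [Real.exp_le_exp.2 hef]
    · linarith [Real.add_one_le_exp e]
  rcases le_total s t with hst | hst
  · refine le_max_of_le_left ?_
    rw [abs_of_nonneg (by linarith : 0 ≤ t - s), abs_le] at hwv
    have := key (b - s) (a + w) (s - v) (t - w) (by linarith) (by linarith) (by linarith)
    rw [show b - s + (s - v) = b - v by ring, show a + w + (t - w) = a + t by ring] at this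
    linarith
  · refine le_max_of_le_right ?_
    rw [abs_of_nonpos (by linarith : t - s ≤ 0), abs_le] at hwv
    have := key (a - t) (b - v) (t + w) (s + v) (by linarith) (by linarith) (by linarith)
    rw [show a - t + (t + w) = a + w by ring, show b - v + (s + v) = b + s by ring] at this
    linarith

/-- Two-point contraction for maxima of exponentials. -/
theorem expMax_contraction (a w t : κ → ℝ) (h1 : ∀ k, |w k| ≤ |t k|)
    (h2 : ∀ k l, |w k - w l| ≤ |t k - t l|) :
    expMax (fun k => a k + w k) + expMax (fun k => a k - w k)
      ≤ expMax (fun k => a k + t k) + expMax (fun k => a k - t k) := by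
  obtain ⟨k, hk⟩ := exists_expMax_eq fun k => a k + w k
  obtain ⟨l, hl⟩ := exists_expMax_eq fun k => a k - w k
  have hA : a l + w l ≤ a k + w k := by
    have := exp_le_expMax (fun k => a k + w k) l
    rw [hk] at this; exact Real.exp_le_exp.1 this
  have hB : a k - w k ≤ a l - w l := by
    have := exp_le_expMax (fun k => a k - w k) k
    rw [hl] at this; exact Real.exp_le_exp.1 this
  have hp : ∀ k, Real.exp (a k + t k) ≤ expMax (fun k => a k + t k) :=
    exp_le_expMax fun k => a k + t k
  have hm : ∀ k, Real.exp (a k - t k) ≤ expMax (fun k => a k - t k) :=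
    exp_le_expMax fun k => a k - t k
  rw [hk, hl]
  -- The maximizers `k` and `l` for the two signs determine the competitors. Equal signs of `t k`
  -- and `t l` need the convexity estimate, after replacing `t` by `-t` when both are nonpositive;
  -- opposite signs allow a termwise comparison.
  rcases le_total 0 (t k) with htk | htk <;> rcases le_total 0 (t l) with htl | htl
  · refine (exp_add_exp_sub_le (h1 k) (h1 l) (h2 k l) hA hB htk htl).trans (max_le ?_ ?_)
    · exact add_le_add (hp k) (hm l)
    · exact add_le_add (hp l) (hm k)
  · refine (add_le_add (Real.exp_le_exp.2 ?_) (Real.exp_le_exp.2 ?_)).trans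
      (add_le_add (hp k) (hm l))
    · have := (le_abs_self _).trans (h1 k); rw [abs_of_nonneg htk] at this; linarith
    · have := (neg_abs_le _).trans' (neg_le_neg (h1 l)); rw [abs_of_nonpos htl] at this; linarith
  · rw [add_comm]
    refine (add_le_add (Real.exp_le_exp.2 ?_) (Real.exp_le_exp.2 ?_)).trans
      (add_le_add (hp l) (hm k))
    · have := (neg_abs_le _).trans' (neg_le_neg (h1 l)); rw [abs_of_nonneg htl] at this; linarith
    · have := (le_abs_self _).trans (h1 k); rw [abs_of_nonpos htk] at this; linarith
  · have h2' : |w k - w l| ≤ |-t k - -t l| := by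
      rw [show -t k - -t l = -(t k - t l) by ring, abs_neg]; exact h2 k l
    refine (exp_add_exp_sub_le (t := -t k) (s := -t l) (by rw [abs_neg]; exact h1 k)
      (by rw [abs_neg]; exact h1 l) h2' hA hB (by linarith) (by linarith)).trans (max_le ?_ ?_)
    · have := add_le_add (hm k) (hp l)
      simp only [← sub_eq_add_neg, sub_neg_eq_add]
      linarith
    · have := add_le_add (hm l) (hp k)
      simp only [← sub_eq_add_neg, sub_neg_eq_add]
      linarith

/-- Symmetrization without a ghost sample: `xy ≤ (x² + y²) / 2` separates `f` from its mean inside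
the exponential, Jensen turns the mean back into an integral of `-f`, and the contraction replaces
`f` by `t`. The price is the factor `2` in front of `t`. -/
theorem integral_expMax_centered_le {α : Type*} [MeasurableSpace α] {P : Measure α}
    [IsProbabilityMeasure P] {f t : κ → α → ℝ} (hf : ∀ k, Measurable (f k))
    (ht : ∀ k, Measurable (t k)) {c : ℝ} (hc : ∀ k x, |t k x| ≤ c)
    (h1 : ∀ k x, |f k x| ≤ |t k x|) (h2 : ∀ k l x, |f k x - f l x| ≤ |t k x - t l x|)
    (a : κ → ℝ) :
    ∫ x, expMax (fun k => a k + (f k x - ∫ x', f k x' ∂P)) ∂P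
      ≤ ∫ x, (expMax (fun k => a k + 2 * t k x) + expMax (fun k => a k - 2 * t k x)) / 2 ∂P := by
  obtain ⟨A, hA⟩ : ∃ A, ∀ k, a k ≤ A := ⟨Finset.univ.sup' Finset.univ_nonempty a,
    fun k => Finset.le_sup' a (Finset.mem_univ k)⟩
  have hcf : ∀ k x, |f k x| ≤ c := fun k x => (h1 k x).trans (hc k x)
  have hfi : ∀ k, Integrable (f k) P := fun k =>
    Integrable.of_bound (hf k).aestronglyMeasurable c (Filter.Eventually.of_forall (hcf k))
  have hmb : ∀ k, |∫ x', f k x' ∂P| ≤ c := fun k => by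
    have := norm_integral_le_of_norm_le_const (μ := P) (f := f k) (C := c)
      (Filter.Eventually.of_forall (hcf k))
    simpa using this
  have i1 : Integrable (fun x => expMax (fun k => a k + 2 * f k x)) P :=
    integrable_expMax (fun k => ((hf k).const_mul 2).const_add _) (c := A + 2 * c)
      fun x k => by linarith [hA k, (abs_le.1 (hcf k x)).2]
  have i2 : Integrable (fun x => expMax (fun k => a k - 2 * f k x)) P :=
    integrable_expMax (fun k => ((hf k).const_mul 2).const_sub _) (c := A + 2 * c)
      fun x k => by linarith [hA k, (abs_le.1 (hcf k x)).1]
  have i3 : Integrable (fun x => expMax (fun k => a k + 2 * t k x)) P :=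
    integrable_expMax (fun k => ((ht k).const_mul 2).const_add _) (c := A + 2 * c)
      fun x k => by linarith [hA k, (abs_le.1 (hc k x)).2]
  have i4 : Integrable (fun x => expMax (fun k => a k - 2 * t k x)) P :=
    integrable_expMax (fun k => ((ht k).const_mul 2).const_sub _) (c := A + 2 * c)
      fun x k => by linarith [hA k, (abs_le.1 (hc k x)).1]
  have i0 : Integrable (fun x => expMax (fun k => a k + (f k x - ∫ x', f k x' ∂P))) P :=
    integrable_expMax (fun k => ((hf k).sub_const _).const_add _) (c := A + 2 * c)
      fun x k => by linarith [hA k, (abs_le.1 (hcf k x)).2, (abs_le.1 (hmb k)).1]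
  -- Jensen, through the tangent line of `exp` at the mean.
  have hJ : ∀ k, Real.exp (a k - 2 * ∫ x', f k x' ∂P)
      ≤ ∫ x, expMax (fun k => a k - 2 * f k x) ∂P := by
    intro k
    set μk := ∫ x', f k x' ∂P
    have h3 : ∀ x, Real.exp (a k - 2 * μk) * (1 + 2 * (μk - f k x))
        ≤ expMax (fun k => a k - 2 * f k x) := by
      intro x
      refine le_trans ?_ (exp_le_expMax (fun k => a k - 2 * f k x) k)
      have : Real.exp (a k - 2 * f k x)
          = Real.exp (a k - 2 * μk) * Real.exp (2 * (μk - f k x)) := by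
        rw [← Real.exp_add]; ring_nf
      rw [this]
      refine mul_le_mul_of_nonneg_left ?_ (Real.exp_pos _).le
      linarith [Real.add_one_le_exp (2 * (μk - f k x))]
    have hsub : Integrable (fun x => μk - f k x) P := (integrable_const _).sub (hfi k)
    have h4 := integral_mono (((integrable_const (1 : ℝ)).add (hsub.const_mul 2)).const_mul
      (Real.exp (a k - 2 * μk))) i2 h3
    simp only [Pi.add_apply] at h4
    rw [integral_const_mul, integral_add (integrable_const _) (hsub.const_mul 2),
      integral_const_mul, integral_sub (integrable_const _) (hfi k)] at h4
    simpa [μk] using h4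
  calc ∫ x, expMax (fun k => a k + (f k x - ∫ x', f k x' ∂P)) ∂P
      ≤ ∫ x, (expMax (fun k => a k + 2 * f k x)
          + ∫ x', expMax (fun k => a k - 2 * f k x') ∂P) / 2 ∂P := by
        refine integral_mono i0 ((i1.add (integrable_const _)).div_const 2) fun x => ?_
        refine expMax_le fun k => ?_
        have h3 := hJ k
        have h4 := exp_le_expMax (fun k => a k + 2 * f k x) k
        set μk := ∫ x', f k x' ∂P
        have h5 : Real.exp (a k + (f k x - μk))
            = Real.exp ((a k + 2 * f k x) / 2) * Real.exp ((a k - 2 * μk) / 2) := by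
          rw [← Real.exp_add]; ring_nf
        have h6 : ∀ y : ℝ, Real.exp y = Real.exp (y / 2) ^ 2 := fun y => by
          rw [← Real.exp_nat_mul]; push_cast; ring_nf
        rw [h6] at h3 h4
        rw [h5]
        nlinarith [sq_nonneg (Real.exp ((a k + 2 * f k x) / 2) - Real.exp ((a k - 2 * μk) / 2))]
    _ = ∫ x, (expMax (fun k => a k + 2 * f k x) + expMax (fun k => a k - 2 * f k x)) / 2 ∂P := by
        rw [integral_div, integral_div, integral_add i1 (integrable_const _), integral_add i1 i2]
        simp
    _ ≤ _ := by
        refine integral_mono ((i1.add i2).div_const 2) ((i3.add i4).div_const 2) fun x => ?_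
        have := expMax_contraction a (fun k => 2 * f k x) (fun k => 2 * t k x)
          (fun k => by rw [abs_mul, abs_mul]; exact mul_le_mul_of_nonneg_left (h1 k x) (abs_nonneg _))
          (fun k l => by 
            rw [← mul_sub, ← mul_sub, abs_mul, abs_mul]
            exact mul_le_mul_of_nonneg_left (h2 k l x) (abs_nonneg _))
        linarith

end ExpMax

/-! ### Exponential moments of the maximal deviation -/

section Deviation

variable {κ J α : Type*} [Fintype κ] [Nonempty κ] [Fintype J] [MeasurableSpace α]

/-- The sum of `e^{r v_j} + e^{-r v_j}`. -/
def coshSum (r : ℝ) (v : J → ℝ) : ℝ := ∑ j, (Real.exp (r * v j) + Real.exp (-(r * v j)))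

theorem sum_mul_le_mul_sum_abs {v θ : J → ℝ} {B : ℝ} (hB : ∀ j, |v j| ≤ B) :
    |∑ j, v j * θ j| ≤ B * ∑ j, |θ j| := by
  refine (Finset.abs_sum_le_sum_abs _ _).trans ?_
  rw [Finset.mul_sum]
  refine Finset.sum_le_sum fun j _ => ?_
  rw [abs_mul]
  exact mul_le_mul_of_nonneg_right (hB j) (abs_nonneg _)

/-- By `ℓ¹`–`ℓ∞` duality a linear form on the ball is at most `r` times its largest coefficient in
absolute value; bounding that maximum by a sum over signed coordinates removes the dependence on the
size of `κ`. -/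
theorem expMax_le_coshSum [Nonempty J] {r : ℝ} {θ : κ → J → ℝ}
    (hθ : ∀ k, ∑ j, |θ k j| ≤ r) (v : J → ℝ) :
    expMax (fun k => ∑ j, v j * θ k j) ≤ coshSum r v := by
  obtain ⟨j₀, hj₀⟩ := Finite.exists_max fun j => |v j|
  refine expMax_le fun k => ?_
  have h1 : ∑ j, v j * θ k j ≤ r * |v j₀| := by
    refine (le_abs_self _).trans ((sum_mul_le_mul_sum_abs hj₀).trans ?_)
    rw [mul_comm]
    exact mul_le_mul_of_nonneg_right (hθ k) (abs_nonneg _)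
  have h2 : Real.exp (r * |v j₀|) ≤ Real.exp (r * v j₀) + Real.exp (-(r * v j₀)) := by
    have p1 := Real.exp_pos (r * v j₀)
    have p2 := Real.exp_pos (-(r * v j₀))
    rcases abs_cases (v j₀) with ⟨h, -⟩ | ⟨h, -⟩ <;> rw [h]
    · linarith
    · rw [mul_neg]; linarith
  refine (Real.exp_le_exp.2 h1).trans (h2.trans ?_)
  exact Finset.single_le_sum
    (f := fun j => Real.exp (r * v j) + Real.exp (-(r * v j))) (fun j _ => by positivity)
    (Finset.mem_univ j₀)

/-- Averaging over the sign factors out `cosh (2 r φ_j)`, and `cosh x ≤ exp (x² / 2)` gives the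
sub-Gaussian factor contributed by one sample. -/
theorem coshSum_add_sub_le {r B : ℝ} {φ : J → ℝ} (hφ : ∀ j, |φ j| ≤ B) (v : J → ℝ) :
    (coshSum r (fun j => v j + 2 * φ j) + coshSum r (fun j => v j - 2 * φ j)) / 2
      ≤ Real.exp (2 * r ^ 2 * B ^ 2) * coshSum r v := by
  simp only [coshSum]
  rw [← Finset.sum_add_distrib, Finset.sum_div, Finset.mul_sum]
  refine Finset.sum_le_sum fun j _ => ?_
  have h1 : (Real.exp (r * (v j + 2 * φ j)) + Real.exp (-(r * (v j + 2 * φ j)))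
      + (Real.exp (r * (v j - 2 * φ j)) + Real.exp (-(r * (v j - 2 * φ j))))) / 2
      = Real.cosh (2 * r * φ j) * (Real.exp (r * v j) + Real.exp (-(r * v j))) := by
    rw [Real.cosh_eq, show r * (v j + 2 * φ j) = r * v j + 2 * r * φ j by ring,
      show r * (v j - 2 * φ j) = r * v j + -(2 * r * φ j) by ring, neg_add, neg_add]
    simp only [Real.exp_add, neg_neg]
    ring
  rw [h1]
  refine mul_le_mul_of_nonneg_right ?_ (by positivity)
  refine (Real.cosh_le_exp_half_sq _).trans (Real.exp_le_exp.2 ?_)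
  have h2 : φ j ^ 2 ≤ B ^ 2 := sq_le_sq.2 ((hφ j).trans (le_abs_self B))
  nlinarith [sq_nonneg r, mul_le_mul_of_nonneg_left h2 (sq_nonneg r)]

theorem integral_pi_succ {P : Measure α} [IsProbabilityMeasure P] (n : ℕ)
    (g : α × (Fin n → α) → ℝ) :
    ∫ s : Fin (n + 1) → α, g (s 0, fun i => s i.succ) ∂Measure.pi (fun _ => P)
      = ∫ z, g z ∂(P.prod (Measure.pi fun _ : Fin n => P)) := by
  have h := measurePreserving_piFinSuccAbove (fun _ : Fin (n + 1) => P) 0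
  exact h.integral_comp' g

/-- Exponential moment of the maximal centered sum over a finite part of the `ℓ¹`-ball. -/
theorem integral_expMax_sum_le [Nonempty J] {P : Measure α} [IsProbabilityMeasure P]
    {f : κ → α → ℝ} {φ : α → J → ℝ} {θ : κ → J → ℝ} {r B : ℝ}
    (hB : 0 ≤ B) (hf : ∀ k, Measurable (f k)) (hφ : ∀ j, Measurable fun x => φ x j)
    (hφB : ∀ x j, |φ x j| ≤ B) (hθ : ∀ k, ∑ j, |θ k j| ≤ r)
    (h1 : ∀ k x, |f k x| ≤ |∑ j, φ x j * θ k j|)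
    (h2 : ∀ k l x, |f k x - f l x| ≤ |∑ j, φ x j * θ k j - ∑ j, φ x j * θ l j|)
    (n : ℕ) (v : J → ℝ) :
    ∫ s : Fin n → α, expMax (fun k => ∑ j, v j * θ k j + ∑ i, (f k (s i) - ∫ x, f k x ∂P))
        ∂Measure.pi (fun _ => P)
      ≤ Real.exp (2 * r ^ 2 * B ^ 2) ^ n * coshSum r v := by
  have htB : ∀ k x, |∑ j, φ x j * θ k j| ≤ B * r := fun k x =>
    (sum_mul_le_mul_sum_abs (hφB x)).trans (mul_le_mul_of_nonneg_left (hθ k) hB)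
  have htm : ∀ k, Measurable fun x => ∑ j, φ x j * θ k j := fun k =>
    Finset.measurable_fun_sum _ fun j _ => (hφ j).mul_const _
  have hfB : ∀ k x, |f k x| ≤ B * r := fun k x => (h1 k x).trans (htB k x)
  have hmB : ∀ k, |∫ x, f k x ∂P| ≤ B * r := fun k => by
    have := norm_integral_le_of_norm_le_const (μ := P) (f := f k) (C := B * r)
      (Filter.Eventually.of_forall (hfB k))
    simpa using this
  have hdB : ∀ k x, f k x - ∫ x, f k x ∂P ≤ 2 * (B * r) := fun k x => by
    linarith [(abs_le.1 (hfB k x)).2, (abs_le.1 (hmB k)).1]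
  have hsB : ∀ (n : ℕ) (s : Fin n → α) k, ∑ i, (f k (s i) - ∫ x, f k x ∂P)
      ≤ n * (2 * (B * r)) := fun n s k => by
    refine (Finset.sum_le_sum fun i _ => hdB k (s i)).trans ?_
    simp
  have hsm : ∀ (n : ℕ) k, Measurable fun s : Fin n → α => ∑ i, (f k (s i) - ∫ x, f k x ∂P) :=
    fun n k => Finset.measurable_fun_sum _ fun i _ =>
      ((hf k).comp (measurable_pi_apply i)).sub_const _
  have hvB : ∀ v : J → ℝ, ∃ A, ∀ k, ∑ j, v j * θ k j ≤ A := fun v =>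
    ⟨Finset.univ.sup' Finset.univ_nonempty fun k => ∑ j, v j * θ k j,
      fun k => Finset.le_sup' (fun k => ∑ j, v j * θ k j) (Finset.mem_univ k)⟩
  -- Processing a sample shifts the linear offset `v` by `± 2 φ`, so the claim must be available for
  -- every offset.
  induction n generalizing v with
  | zero =>
    simp only [Finset.univ_eq_empty, Finset.sum_empty, add_zero, integral_const, pow_zero,
      one_mul]
    simpa using expMax_le_coshSum hθ v
  | succ n ih =>
    set Q := Measure.pi fun _ : Fin n => P with hQ
    obtain ⟨A, hA⟩ := hvB v
    set S : κ → (Fin n → α) → ℝ := fun k s => ∑ i, (f k (s i) - ∫ x, f k x ∂P) with hS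
    have e0 : ∫ s : Fin (n + 1) → α,
        expMax (fun k => ∑ j, v j * θ k j + ∑ i, (f k (s i) - ∫ x, f k x ∂P))
          ∂Measure.pi (fun _ => P)
        = ∫ z : α × (Fin n → α), expMax (fun k => (∑ j, v j * θ k j + S k z.2)
          + (f k z.1 - ∫ x, f k x ∂P)) ∂(P.prod Q) := by
      rw [← integral_pi_succ]
      congr 1
      ext s
      congr 1
      ext k
      rw [Fin.sum_univ_succ]
      simp only [hS]
      ring
    have i0 : Integrable (fun z : α × (Fin n → α) => expMax (fun k => (∑ j, v j * θ k j
        + S k z.2) + (f k z.1 - ∫ x, f k x ∂P))) (P.prod Q) := by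
      refine integrable_expMax (c := A + n * (2 * (B * r)) + 2 * (B * r)) (fun k => ?_)
        fun z k => by linarith [hA k, hsB n z.2 k, hdB k z.1]
      exact (((hsm n k).comp measurable_snd).const_add _).add
        (((hf k).comp measurable_fst).sub_const _)
    have ip : Integrable (fun z : α × (Fin n → α) => expMax (fun k => (∑ j, v j * θ k j
        + S k z.2) + 2 * ∑ j, φ z.1 j * θ k j)) (P.prod Q) := by
      refine integrable_expMax (c := A + n * (2 * (B * r)) + 2 * (B * r)) (fun k => ?_)
        fun z k => by linarith [hA k, hsB n z.2 k, (abs_le.1 (htB k z.1)).2]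
      exact (((hsm n k).comp measurable_snd).const_add _).add
        (((htm k).comp measurable_fst).const_mul 2)
    have im : Integrable (fun z : α × (Fin n → α) => expMax (fun k => (∑ j, v j * θ k j
        + S k z.2) - 2 * ∑ j, φ z.1 j * θ k j)) (P.prod Q) := by
      refine integrable_expMax (c := A + n * (2 * (B * r)) + 2 * (B * r)) (fun k => ?_)
        fun z k => by linarith [hA k, hsB n z.2 k, (abs_le.1 (htB k z.1)).1]
      exact (((hsm n k).comp measurable_snd).const_add _).sub
        (((htm k).comp measurable_fst).const_mul 2)
    have i1 := (ip.add im).div_const 2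
    -- The isolated sample is integrated first, with the others frozen, so that it can be
    -- symmetrized; the order is then reversed so that the induction hypothesis applies for each of
    -- its values.
    rw [e0, integral_prod_symm _ i0]
    calc ∫ s, ∫ x, expMax (fun k => (∑ j, v j * θ k j + S k s)
          + (f k x - ∫ x, f k x ∂P)) ∂P ∂Q
        ≤ ∫ s, ∫ x, (expMax (fun k => (∑ j, v j * θ k j + S k s) + 2 * ∑ j, φ x j * θ k j)
          + expMax (fun k => (∑ j, v j * θ k j + S k s) - 2 * ∑ j, φ x j * θ k j)) / 2
            ∂P ∂Q :=
          integral_mono i0.integral_prod_right i1.integral_prod_right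
            fun s => integral_expMax_centered_le hf htm htB h1 h2 _
      _ = ∫ x, ∫ s, (expMax (fun k => (∑ j, v j * θ k j + S k s) + 2 * ∑ j, φ x j * θ k j)
          + expMax (fun k => (∑ j, v j * θ k j + S k s) - 2 * ∑ j, φ x j * θ k j)) / 2
            ∂Q ∂P := by
          have a1 := integral_prod_symm _ i1
          have a2 := integral_prod _ i1
          exact a1.symm.trans a2
      _ ≤ ∫ _x, Real.exp (2 * r ^ 2 * B ^ 2) ^ (n + 1) * coshSum r v ∂P := by
          refine integral_mono i1.integral_prod_left (integrable_const _) fun x => ?_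
          have hip : Integrable (fun s => expMax (fun k => (∑ j, v j * θ k j + S k s)
              + 2 * ∑ j, φ x j * θ k j)) Q := by
            refine integrable_expMax (c := A + n * (2 * (B * r)) + 2 * (B * r)) (fun k => ?_)
              fun z k => by linarith [hA k, hsB n z k, (abs_le.1 (htB k x)).2]
            exact ((hsm n k).const_add _).add_const _
          have him : Integrable (fun s => expMax (fun k => (∑ j, v j * θ k j + S k s)
              - 2 * ∑ j, φ x j * θ k j)) Q := by
            refine integrable_expMax (c := A + n * (2 * (B * r)) + 2 * (B * r)) (fun k => ?_)
              fun z k => by linarith [hA k, hsB n z k, (abs_le.1 (htB k x)).1]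
            exact ((hsm n k).const_add _).sub_const _
          have b1 := ih fun j => v j + 2 * φ x j
          have b2 := ih fun j => v j - 2 * φ x j
          have c1 : ∀ s k, ∑ j, (v j + 2 * φ x j) * θ k j + ∑ i, (f k (s i) - ∫ x, f k x ∂P)
              = (∑ j, v j * θ k j + S k s) + 2 * ∑ j, φ x j * θ k j := by
            intro s k
            simp only [add_mul, Finset.sum_add_distrib, Finset.mul_sum, mul_assoc, hS]
            ring
          have c2 : ∀ s k, ∑ j, (v j - 2 * φ x j) * θ k j + ∑ i, (f k (s i) - ∫ x, f k x ∂P)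
              = (∑ j, v j * θ k j + S k s) - 2 * ∑ j, φ x j * θ k j := by
            intro s k
            simp only [sub_mul, Finset.sum_sub_distrib, Finset.mul_sum, mul_assoc, hS]
            ring
          simp only [c1] at b1
          simp only [c2] at b2
          have b3 := mul_le_mul_of_nonneg_left (coshSum_add_sub_le (r := r) (hφB x) v)
            (pow_nonneg (Real.exp_pos (2 * r ^ 2 * B ^ 2)).le n)
          rw [integral_div, integral_add hip him, pow_succ, mul_assoc]
          refine le_trans ?_ b3
          rw [← mul_div_assoc, mul_add]
          gcongr
      _ = _ := by simp

/-- The one-sided bound is applied to `lam * f` and `-lam * f`. Two signs of the sum and two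
exponentials per coordinate account for the factor `4`. -/
theorem integral_expMax_abs_sum_le [Nonempty J] {P : Measure α} [IsProbabilityMeasure P]
    {f : κ → α → ℝ} {φ : α → J → ℝ} {θ : κ → J → ℝ} {r B : ℝ}
    (hB : 0 ≤ B) (hf : ∀ k, Measurable (f k)) (hφ : ∀ j, Measurable fun x => φ x j)
    (hφB : ∀ x j, |φ x j| ≤ B) (hθ : ∀ k, ∑ j, |θ k j| ≤ r)
    (h1 : ∀ k x, |f k x| ≤ |∑ j, φ x j * θ k j|)
    (h2 : ∀ k l x, |f k x - f l x| ≤ |∑ j, φ x j * θ k j - ∑ j, φ x j * θ l j|)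
    (n : ℕ) {lam : ℝ} (hl : 0 ≤ lam) :
    Integrable (fun s : Fin n → α =>
      expMax (fun k => lam * |∑ i, (f k (s i) - ∫ x, f k x ∂P)|)) (Measure.pi fun _ => P) ∧
    ∫ s : Fin n → α, expMax (fun k => lam * |∑ i, (f k (s i) - ∫ x, f k x ∂P)|)
        ∂Measure.pi (fun _ => P)
      ≤ 4 * Fintype.card J * Real.exp (2 * lam ^ 2 * r ^ 2 * B ^ 2 * n) := by
  have hfB : ∀ k x, |f k x| ≤ B * r := fun k x => (h1 k x).trans
    ((sum_mul_le_mul_sum_abs (hφB x)).trans (mul_le_mul_of_nonneg_left (hθ k) hB))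
  have hmB : ∀ k, |∫ x, f k x ∂P| ≤ B * r := fun k => by
    have := norm_integral_le_of_norm_le_const (μ := P) (f := f k) (C := B * r)
      (Filter.Eventually.of_forall (hfB k))
    simpa using this
  have hSB : ∀ (s : Fin n → α) k, |∑ i, (f k (s i) - ∫ x, f k x ∂P)| ≤ n * (2 * (B * r)) := by
    intro s k
    refine (Finset.abs_sum_le_sum_abs _ _).trans ((Finset.sum_le_sum fun i _ =>
      (abs_sub _ _).trans (add_le_add (hfB k (s i)) (hmB k))).trans ?_)
    simp [two_mul, mul_add]
  have hSm : ∀ k, Measurable fun s : Fin n → α => ∑ i, (f k (s i) - ∫ x, f k x ∂P) :=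
    fun k => Finset.measurable_fun_sum _ fun i _ =>
      ((hf k).comp (measurable_pi_apply i)).sub_const _
  have hint : ∀ c : ℝ, Integrable (fun s : Fin n → α =>
      expMax (fun k => c * ∑ i, (f k (s i) - ∫ x, f k x ∂P))) (Measure.pi fun _ => P) := by
    intro c
    refine integrable_expMax (c := |c| * (n * (2 * (B * r)))) (fun k => (hSm k).const_mul c) ?_
    intro s k
    refine (le_abs_self _).trans ?_
    rw [abs_mul]
    exact mul_le_mul_of_nonneg_left (hSB s k) (abs_nonneg _)
  have hint' : Integrable (fun s : Fin n → α =>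
      expMax (fun k => lam * |∑ i, (f k (s i) - ∫ x, f k x ∂P)|)) (Measure.pi fun _ => P) :=
    integrable_expMax (c := lam * (n * (2 * (B * r)))) (fun k => (hSm k).abs.const_mul lam)
      fun s k => mul_le_mul_of_nonneg_left (hSB s k) hl
  have key : ∀ c : ℝ, |c| = lam → ∫ s : Fin n → α,
      expMax (fun k => c * ∑ i, (f k (s i) - ∫ x, f k x ∂P)) ∂Measure.pi (fun _ => P)
      ≤ 2 * Fintype.card J * Real.exp (2 * lam ^ 2 * r ^ 2 * B ^ 2 * n) := by
    intro c hc
    have hcs : ∀ x k, ∑ j, lam * φ x j * θ k j = lam * ∑ j, φ x j * θ k j := fun x k => by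
      rw [Finset.mul_sum]; exact Finset.sum_congr rfl fun j _ => by ring
    have h := integral_expMax_sum_le (P := P) (f := fun k x => c * f k x)
      (φ := fun x j => lam * φ x j) (θ := θ) (r := r) (B := lam * B) (mul_nonneg hl hB)
      (fun k => (hf k).const_mul c) (fun j => (hφ j).const_mul lam)
      (fun x j => by
        rw [abs_mul, abs_of_nonneg hl]; exact mul_le_mul_of_nonneg_left (hφB x j) hl) hθ
      (fun k x => by
        rw [hcs, abs_mul, abs_mul, hc, abs_of_nonneg hl]
        exact mul_le_mul_of_nonneg_left (h1 k x) hl)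
      (fun k l x => by
        rw [hcs, hcs, ← mul_sub, ← mul_sub, abs_mul, abs_mul, hc, abs_of_nonneg hl]
        exact mul_le_mul_of_nonneg_left (h2 k l x) hl) n 0
    simp only [integral_const_mul, ← mul_sub, ← Finset.mul_sum, Pi.zero_apply, zero_mul,
      Finset.sum_const_zero, zero_add] at h
    refine h.trans (le_of_eq ?_)
    rw [← Real.exp_nat_mul]
    simp only [coshSum, Pi.zero_apply, mul_zero, neg_zero, Real.exp_zero, Finset.sum_const,
      Finset.card_univ, nsmul_eq_mul]
    ring_nf
  refine ⟨hint', ?_⟩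
  calc _ ≤ ∫ s : Fin n → α, (expMax (fun k => lam * ∑ i, (f k (s i) - ∫ x, f k x ∂P))
        + expMax (fun k => -lam * ∑ i, (f k (s i) - ∫ x, f k x ∂P))) ∂Measure.pi (fun _ => P) := by
        refine integral_mono hint' ((hint lam).add (hint (-lam))) fun s => expMax_le fun k => ?_
        have e1 := exp_le_expMax (fun k => lam * ∑ i, (f k (s i) - ∫ x, f k x ∂P)) k
        have e2 := exp_le_expMax (fun k => -lam * ∑ i, (f k (s i) - ∫ x, f k x ∂P)) k
        have p1 := expMax_pos (fun k => lam * ∑ i, (f k (s i) - ∫ x, f k x ∂P))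
        have p2 := expMax_pos (fun k => -lam * ∑ i, (f k (s i) - ∫ x, f k x ∂P))
        rcases abs_cases (∑ i, (f k (s i) - ∫ x, f k x ∂P)) with ⟨h, -⟩ | ⟨h, -⟩ <;> rw [h]
        · linarith
        · rw [mul_neg, ← neg_mul]; linarith
    _ ≤ _ := by
        rw [integral_add (hint lam) (hint (-lam))]
        have a1 := key lam (abs_of_nonneg hl)
        have a2 := key (-lam) (by rw [abs_neg, abs_of_nonneg hl])
        linarith

/-- Uniform deviations over the `ℓ¹`-ball, up to an arbitrarily small error: tail bound and
expectation. -/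
theorem exists_uniform_deviation [Nonempty J] {P : Measure α} [IsProbabilityMeasure P]
    {f : (J → ℝ) → α → ℝ} {φ : α → J → ℝ} {r B : ℝ} (hr : 0 < r) (hB : 0 < B)
    (hf : ∀ θ, Measurable (f θ)) (hφ : ∀ j, Measurable fun x => φ x j)
    (hφB : ∀ x j, |φ x j| ≤ B)
    (h1 : ∀ θ x, |f θ x| ≤ |∑ j, φ x j * θ j|)
    (h2 : ∀ θ η x, |f θ x - f η x| ≤ |∑ j, φ x j * θ j - ∑ j, φ x j * η j|)
    {n : ℕ} (hn : 0 < n) {δ : ℝ} (hδ : 0 < δ) :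
    ∃ W : (Fin n → α) → ℝ, Measurable W ∧ Integrable W (Measure.pi fun _ => P) ∧
      (∀ s, 0 ≤ W s) ∧
      (∀ θ : J → ℝ, ∑ j, |θ j| ≤ r → ∀ s : Fin n → α,
        |∑ i, (f θ (s i) - ∫ x, f θ x ∂P)| ≤ W s + δ) ∧
      (∀ c, 0 ≤ c → (Measure.pi fun _ : Fin n => P).real {s | c ≤ W s}
        ≤ 4 * Fintype.card J * Real.exp (-(c ^ 2 / (8 * r ^ 2 * B ^ 2 * n)))) ∧
      ∫ s, W s ∂(Measure.pi fun _ : Fin n => P) ≤ 6 * r * B * √(Fintype.card J * n) := by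
  classical
  set N : ℝ := ((Fintype.card J : ℕ) : ℝ) with hN
  have hN1 : 1 ≤ N := by
    rw [hN]; exact_mod_cast Fintype.card_pos
  have hn' : (0 : ℝ) < n := by exact_mod_cast hn
  set ball : Set (J → ℝ) := {θ | ∑ j, |θ j| ≤ r} with hball
  have hbc : IsCompact ball := by
    refine Metric.isCompact_of_isClosed_isBounded ?_ ?_
    · exact isClosed_le (by fun_prop) continuous_const
    · refine (Metric.isBounded_iff_subset_closedBall 0).2 ⟨r, fun θ hθ => ?_⟩
      rw [mem_closedBall_zero_iff, pi_norm_le_iff_of_nonneg hr.le]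
      intro j
      exact (Finset.single_le_sum (f := fun j => |θ j|) (fun j _ => abs_nonneg _)
        (Finset.mem_univ j)).trans hθ
  -- Moving `θ` by `η` in each of the `N` coordinates changes each loss and its mean by at most `B N
  -- η`, and the centred sum of `n` terms by at most `2 n B N η = δ`.
  set η := δ / (2 * n * B * N) with hη_def
  have hη : 0 < η := by positivity
  obtain ⟨t, htb, htf, htc⟩ := hbc.finite_cover_balls hη
  have : Fintype t := htf.fintype
  have h0 : (0 : J → ℝ) ∈ ball := by simp [hball, hr.le]
  have : Nonempty t := by
    obtain ⟨y, hy⟩ := mem_iUnion.1 (htc h0)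
    obtain ⟨hy, -⟩ := mem_iUnion.1 hy
    exact ⟨⟨y, hy⟩⟩
  have hfB : ∀ θ x, |f θ x| ≤ B * ∑ j, |θ j| := fun θ x =>
    (h1 θ x).trans (sum_mul_le_mul_sum_abs (hφB x))
  have hfi : ∀ θ, Integrable (f θ) P := fun θ =>
    Integrable.of_bound (hf θ).aestronglyMeasurable _ (Filter.Eventually.of_forall (hfB θ))
  set S : (J → ℝ) → (Fin n → α) → ℝ := fun θ s => ∑ i, (f θ (s i) - ∫ x, f θ x ∂P) with hS
  have hSm : ∀ θ, Measurable (S θ) := fun θ => Finset.measurable_fun_sum _ fun i _ =>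
    ((hf θ).comp (measurable_pi_apply i)).sub_const _
  set W : (Fin n → α) → ℝ := fun s =>
    Finset.univ.sup' Finset.univ_nonempty fun k : t => |S k.1 s| with hW
  have hWm : Measurable W := by
    have : W = Finset.univ.sup' Finset.univ_nonempty fun (k : t) s => |S k.1 s| := by
      ext s; simp [hW, Finset.sup'_apply]
    rw [this]
    exact Finset.measurable_sup' _ fun k _ => (hSm k.1).abs
  have hWle : ∀ s (k : t), |S k.1 s| ≤ W s := fun s k =>
    Finset.le_sup' (fun k : t => |S k.1 s|) (Finset.mem_univ k)
  have hW0 : ∀ s, 0 ≤ W s := fun s => (abs_nonneg _).trans (hWle s (Classical.arbitrary t))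
  have hexp : ∀ lam s, Real.exp (lam * W s) ≤ expMax (fun k : t => lam * |S k.1 s|) := by
    intro lam s
    obtain ⟨k, -, hk⟩ := Finset.exists_mem_eq_sup' Finset.univ_nonempty
      fun k : t => |S k.1 s|
    have : W s = |S k.1 s| := hk
    rw [this]
    exact exp_le_expMax (fun k : t => lam * |S k.1 s|) k
  have hmgf : ∀ lam, 0 ≤ lam →
      Integrable (fun s => Real.exp (lam * W s)) (Measure.pi fun _ : Fin n => P) ∧
      ∫ s, Real.exp (lam * W s) ∂(Measure.pi fun _ : Fin n => P)
        ≤ 4 * N * Real.exp (2 * lam ^ 2 * r ^ 2 * B ^ 2 * n) := by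
    intro lam hl
    obtain ⟨hi, hb⟩ := integral_expMax_abs_sum_le (P := P) (f := fun k : t => f k.1)
      (θ := fun k : t => k.1) hB.le (fun k => hf k.1) hφ hφB (fun k => htb k.2)
      (fun k => h1 k.1) (fun k l => h2 k.1 l.1) n hl
    have hi' : Integrable (fun s => Real.exp (lam * W s)) (Measure.pi fun _ : Fin n => P) := by
      refine hi.mono' (hWm.const_mul lam).exp.aestronglyMeasurable
        (Filter.Eventually.of_forall fun s => ?_)
      rw [Real.norm_eq_abs, abs_of_pos (Real.exp_pos _)]
      exact hexp lam s
    exact ⟨hi', (integral_mono hi' hi (hexp lam)).trans hb⟩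
  have hWi : Integrable W (Measure.pi fun _ : Fin n => P) := by
    refine (hmgf 1 zero_le_one).1.mono' hWm.aestronglyMeasurable
      (Filter.Eventually.of_forall fun s => ?_)
    rw [Real.norm_eq_abs, abs_of_nonneg (hW0 s), one_mul]
    linarith [Real.add_one_le_exp (W s)]
  refine ⟨W, hWm, hWi, hW0, fun θ hθ s => ?_, fun c hc => ?_, ?_⟩
  · obtain ⟨y, hy⟩ := mem_iUnion.1 (htc hθ)
    obtain ⟨hyt, hy⟩ := mem_iUnion.1 hy
    have hd : ∀ x, |f θ x - f y x| ≤ B * (N * η) := by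
      intro x
      refine (h2 θ y x).trans ?_
      rw [← Finset.sum_sub_distrib]
      simp only [← mul_sub]
      refine (sum_mul_le_mul_sum_abs (hφB x)).trans (mul_le_mul_of_nonneg_left ?_ hB.le)
      calc ∑ j, |θ j - y j| ≤ ∑ _j : J, η := Finset.sum_le_sum fun j _ =>
            (dist_le_pi_dist θ y j).trans (Metric.mem_ball.1 hy).le
        _ = N * η := by simp [hN]
    have hd' : |∫ x, f θ x ∂P - ∫ x, f y x ∂P| ≤ B * (N * η) := by
      rw [← integral_sub (hfi θ) (hfi y)]
      have := norm_integral_le_of_norm_le_const (μ := P) (f := fun x => f θ x - f y x)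
        (Filter.Eventually.of_forall hd)
      simpa using this
    have hdS : |S θ s - S y s| ≤ δ := by
      simp only [hS]
      rw [← Finset.sum_sub_distrib]
      refine (Finset.abs_sum_le_sum_abs _ _).trans ((Finset.sum_le_sum fun i _ =>
        (?_ : _ ≤ 2 * (B * (N * η)))).trans ?_)
      · have e : f θ (s i) - ∫ x, f θ x ∂P - (f y (s i) - ∫ x, f y x ∂P)
            = (f θ (s i) - f y (s i)) - (∫ x, f θ x ∂P - ∫ x, f y x ∂P) := by ring
        rw [e]
        exact (abs_sub _ _).trans (by linarith [hd (s i)])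
      · simp only [Finset.sum_const, Finset.card_univ, Fintype.card_fin, nsmul_eq_mul]
        refine le_of_eq ?_
        rw [hη_def]
        field_simp
    have h3 := abs_sub_abs_le_abs_sub (S θ s) (S y s)
    have h4 := hWle s ⟨y, hyt⟩
    change |S θ s| ≤ _
    linarith
  -- The minimizer of `2 lam² r² B² n - lam c` in the Chernoff bound.
  · set lam := c / (4 * r ^ 2 * B ^ 2 * n) with hlam
    have hl : 0 ≤ lam := by positivity
    obtain ⟨hi, hb⟩ := hmgf lam hl
    have hm := mul_meas_ge_le_integral_of_nonneg
      (Filter.Eventually.of_forall fun s => (Real.exp_pos (lam * W s)).le) hi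
      (Real.exp (lam * c))
    have hsub : (Measure.pi fun _ : Fin n => P).real {s | c ≤ W s}
        ≤ (Measure.pi fun _ : Fin n => P).real {s | Real.exp (lam * c) ≤ Real.exp (lam * W s)} :=
      measureReal_mono fun s hs => Real.exp_le_exp.2 (mul_le_mul_of_nonneg_left hs hl)
    have h3 : Real.exp (lam * c) * (Measure.pi fun _ : Fin n => P).real {s | c ≤ W s}
        ≤ 4 * N * Real.exp (2 * lam ^ 2 * r ^ 2 * B ^ 2 * n) :=
      (mul_le_mul_of_nonneg_left hsub (Real.exp_pos _).le).trans (hm.trans hb)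
    have h4 : Real.exp (2 * lam ^ 2 * r ^ 2 * B ^ 2 * n)
        = Real.exp (lam * c) * Real.exp (-(c ^ 2 / (8 * r ^ 2 * B ^ 2 * n))) := by
      rw [← Real.exp_add]
      congr 1
      rw [hlam]
      field_simp
      ring
    rw [h4] at h3
    refine le_of_mul_le_mul_left (h3.trans (le_of_eq (by ring))) (Real.exp_pos (lam * c))
  -- Chosen so that the sub-Gaussian exponent equals `4 N`, which also absorbs the prefactor `4 N`.
  · set lam := √(2 * N / n) / (r * B) with hlam
    have hl : 0 < lam := by positivity
    obtain ⟨hi, hb⟩ := hmgf lam hl.le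
    have e1 : 2 * lam ^ 2 * r ^ 2 * B ^ 2 * n = 4 * N := by
      rw [hlam, div_pow, Real.sq_sqrt (by positivity)]
      field_simp
      norm_num
    rw [e1] at hb
    have h3 : 4 * N * Real.exp (4 * N) ≤ Real.exp (8 * N) := by
      rw [show (8 : ℝ) * N = 4 * N + 4 * N by ring, Real.exp_add]
      have := Real.add_one_le_exp (4 * N)
      have := Real.exp_pos (4 * N)
      nlinarith
    -- The tangent inequality `x + 1 ≤ exp x` at `x = lam * W s - 8 N` bounds the mean of `W`
    -- linearly, avoiding logarithms.
    have h4 : ∀ s, lam * W s ≤ 8 * N - 1 + Real.exp (-(8 * N)) * Real.exp (lam * W s) := by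
      intro s
      rw [← Real.exp_add]
      linarith [Real.add_one_le_exp (-(8 * N) + lam * W s)]
    have h5 := integral_mono (hWi.const_mul lam)
      ((integrable_const (8 * N - 1)).add (hi.const_mul (Real.exp (-(8 * N))))) h4
    simp only [Pi.add_apply] at h5
    rw [integral_const_mul, integral_add (integrable_const _) (hi.const_mul _),
      integral_const_mul] at h5
    simp only [integral_const, probReal_univ, one_smul] at h5
    have h6 : Real.exp (-(8 * N)) * ∫ s, Real.exp (lam * W s) ∂(Measure.pi fun _ : Fin n => P)
        ≤ 1 := by
      calc _ ≤ Real.exp (-(8 * N)) * Real.exp (8 * N) :=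
            mul_le_mul_of_nonneg_left (hb.trans h3) (Real.exp_pos _).le
        _ = 1 := by rw [← Real.exp_add]; simp
    have h7 : lam * ∫ s, W s ∂(Measure.pi fun _ : Fin n => P) ≤ 8 * N := by linarith
    have h8 : 8 * N ≤ lam * (6 * r * B * √(N * n)) := by
      have e2 : √(2 * N / n) * √(N * n) = √2 * N := by
        rw [← Real.sqrt_mul (by positivity), show 2 * N / n * (N * n) = 2 * N ^ 2 by field_simp,
          Real.sqrt_mul (by norm_num), Real.sqrt_sq (by linarith)]
      have e3 : lam * (6 * r * B * √(N * n)) = 6 * (√(2 * N / n) * √(N * n)) := by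
        rw [hlam]; field_simp
      rw [e3, e2]
      -- The constant `6` suffices because `6 √2 ≥ 8`.
      have : (4 / 3 : ℝ) ≤ √2 := Real.le_sqrt_of_sq_le (by norm_num)
      nlinarith
    exact le_of_mul_le_mul_left (h7.trans h8) hl

end Deviation

/-! ### The logistic loss -/

theorem log_one_add_exp_sub {a b : ℝ} (hab : a ≤ b) :
    0 ≤ Real.log (1 + Real.exp b) - Real.log (1 + Real.exp a) ∧
      Real.log (1 + Real.exp b) - Real.log (1 + Real.exp a) ≤ b - a := by
  have ha := Real.exp_pos a
  have hb := Real.exp_pos b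
  constructor
  · have := Real.log_le_log (by positivity) (add_le_add_right (Real.exp_le_exp.2 hab) 1)
    linarith
  · have h1 : 1 + Real.exp b ≤ Real.exp (b - a) * (1 + Real.exp a) := by
      rw [mul_add, mul_one, ← Real.exp_add, sub_add_cancel]
      have := Real.one_le_exp (sub_nonneg.2 hab)
      linarith
    have h2 := Real.log_le_log (by positivity) h1
    rw [Real.log_mul (Real.exp_pos _).ne' (by positivity), Real.log_exp] at h2
    linarith

theorem abs_logisticLoss_sub_le {y : ℝ} (hy : y ∈ Icc (0 : ℝ) 1) (a b : ℝ) :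
    |logisticLoss y a - logisticLoss y b| ≤ |a - b| := by
  wlog hab : b ≤ a generalizing a b
  · rw [abs_sub_comm, abs_sub_comm a b]
    exact this b a (le_of_not_ge hab)
  obtain ⟨h1, h2⟩ := log_one_add_exp_sub hab
  have h3 : 0 ≤ a - b := by linarith
  rw [abs_of_nonneg h3, abs_le, logisticLoss, logisticLoss]
  have := mul_le_mul_of_nonneg_right hy.2 h3
  have := mul_nonneg hy.1 h3
  constructor <;> linarith

theorem logisticLoss_zero (y : ℝ) : logisticLoss y 0 = Real.log 2 := by
  norm_num [logisticLoss]

theorem logisticLoss_nonneg {y : ℝ} (hy : y ∈ Icc (0 : ℝ) 1) (a : ℝ) : 0 ≤ logisticLoss y a := by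
  have h1 : 0 ≤ Real.log (1 + Real.exp a) := Real.log_nonneg (by linarith [Real.exp_pos a])
  have h2 : a ≤ Real.log (1 + Real.exp a) := by
    rw [Real.le_log_iff_exp_le (by positivity)]; linarith
  unfold logisticLoss
  nlinarith [hy.1, hy.2, mul_le_mul_of_nonneg_left h2 hy.1,
    mul_le_mul_of_nonneg_right hy.2 h1]

/-- The contraction needs functions dominated by the linear predictor, hence vanishing with it;
subtracting the value at `0` achieves this and leaves deviations unchanged. -/
theorem abs_logisticLoss_sub_log_two_le {y : ℝ} (hy : y ∈ Icc (0 : ℝ) 1) (a : ℝ) :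
    |logisticLoss y a - Real.log 2| ≤ |a| := by
  have := abs_logisticLoss_sub_le hy a 0
  rwa [logisticLoss_zero, sub_zero] at this

theorem measurable_logisticLoss : Measurable fun z : ℝ × ℝ => logisticLoss z.1 z.2 := by
  unfold logisticLoss
  fun_prop

section Model

variable {m q : ℕ} {T : ℝ≥0}

theorem label_mem (o : Obs m q T) : label o ∈ Icc (0 : ℝ) 1 := by
  unfold label; split_ifs <;> simp

theorem measurable_label : Measurable (label : Obs m q T → ℝ) :=
  (measurable_of_finite fun b : Bool => if b then (1 : ℝ) else 0).comp
    (measurable_snd.comp measurable_snd)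

/-! ### Features -/

/-- The feature vector `(S_p(X̃), z)`. -/
def feat (p : ℕ) (o : Obs m q T) (j : Word (m + 1) p ⊕ Fin q) : ℝ :=
  Sum.elim (truncSig p o.1) (fun l => o.2.1 l) j

theorem linPred_eq (p : ℕ) (o : Obs m q T) (θ : Param m q p) :
    linPred p o θ = ∑ j, feat p o j * θ j := rfl

theorem abs_feat_le {CX Cz : ℝ} (hCX : 0 < CX) (hCz : 0 < Cz) {o : Obs m q T}
    (hX : eVariationOn o.1 univ < ENNReal.ofReal CX) (hz : ‖o.2.1‖ < Cz) (p : ℕ)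
    (j : Word (m + 1) p ⊕ Fin q) : |feat p o j| ≤ constC Cz CX T / 2 := by
  have he := Real.exp_pos (CX + T)
  have e : constC Cz CX T / 2 = Cz + Real.exp (CX + T) := by unfold constC; ring
  rw [e]
  rcases j with w | l
  · have : |feat p o (Sum.inl w)| ≤ Real.exp (CX + T) := abs_iterInt_augment_le hCX hX _ _
    linarith
  · have : |feat p o (Sum.inr l)| ≤ ‖o.2.1‖ := PiLp.norm_apply_le o.2.1 l
    linarith

theorem aemeasurable_feat {P : Measure (Obs m q T)} {CX : ℝ} (hCX : 0 < CX)
    (hX : ∀ᵐ o ∂P, eVariationOn o.1 univ < ENNReal.ofReal CX) (p : ℕ)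
    (j : Word (m + 1) p ⊕ Fin q) : AEMeasurable (fun o => feat p o j) P := by
  rcases j with w | l
  · exact aemeasurable_iterInt_augment measurable_fst hCX hX _ _
  · have : Continuous fun v : EuclideanSpace ℝ (Fin q) => v l := by fun_prop
    exact (this.measurable.comp (measurable_fst.comp measurable_snd)).aemeasurable

/-- A bounded measurable version of the features. -/
theorem exists_measurable_feat {P : Measure (Obs m q T)} {CX Cz : ℝ} (hCX : 0 < CX)
    (hCz : 0 < Cz) (hX : ∀ᵐ o ∂P, eVariationOn o.1 univ < ENNReal.ofReal CX)
    (hz : ∀ᵐ o ∂P, ‖o.2.1‖ < Cz) (p : ℕ) :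
    ∃ φ : Obs m q T → (Word (m + 1) p ⊕ Fin q) → ℝ, (∀ j, Measurable fun o => φ o j) ∧
      (∀ o j, |φ o j| ≤ constC Cz CX T / 2) ∧ ∀ᵐ o ∂P, φ o = feat p o := by
  have hm := aemeasurable_feat hCX hX p
  set B := constC Cz CX T / 2 with hB
  have hB0 : 0 ≤ B := by rw [hB]; unfold constC; positivity
  -- Clipping makes the measurable version bounded everywhere while changing it only on a null set.
  refine ⟨fun o j => max (-B) (min B ((hm j).mk _ o)), fun j => ?_, fun o j => ?_, ?_⟩
  · exact measurable_const.max (measurable_const.min (hm j).measurable_mk)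
  · rw [abs_le]
    exact ⟨le_max_left _ _, max_le (by linarith) (min_le_left _ _)⟩
  · filter_upwards [hX, hz, ae_all_iff.2 fun j => (hm j).ae_eq_mk] with o h1 h2 h3
    ext j
    have h4 := abs_le.1 (abs_feat_le hCX hCz h1 h2 p j)
    rw [← h3 j, min_eq_right h4.2, max_eq_right h4.1]

theorem constC_pos {CX Cz : ℝ} (hCz : 0 < Cz) : 0 < constC Cz CX T := by
  unfold constC; positivity

/-! ### Embedding parameters of lower order -/

/-- The inclusion of multi-indices of length at most `p` into those of length at most `p'`. -/
def padIdx {d p p' : ℕ} (h : p ≤ p') : Word d p ⊕ Fin q → Word d p' ⊕ Fin q :=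
  Sum.map (fun w => ⟨Fin.castLE (Nat.succ_le_succ h) w.1, w.2⟩) id

theorem padIdx_injective {d p p' : ℕ} (h : p ≤ p') :
    Function.Injective (padIdx (q := q) (d := d) h) := by
  refine Function.Injective.sumMap ?_ Function.injective_id
  rintro ⟨⟨k, hk⟩, I⟩ ⟨⟨l, hl⟩, J⟩ hw
  simp only [Sigma.mk.injEq, Fin.castLE_mk, Fin.mk.injEq] at hw
  obtain ⟨rfl, h2⟩ := hw
  simp only [heq_eq_eq] at h2
  rw [h2]

theorem feat_padIdx {p p' : ℕ} (h : p ≤ p') (o : Obs m q T) (j : Word (m + 1) p ⊕ Fin q) :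
    feat p' o (padIdx h j) = feat p o j := by
  rcases j with w | l <;> rfl

/-- Extension of a parameter vector by zero. -/
def padParam {p p' : ℕ} (h : p ≤ p') (θ : Param m q p) : Param m q p' :=
  Function.extend (padIdx h) θ 0

theorem sum_padParam {p p' : ℕ} (h : p ≤ p') (θ : Param m q p)
    (g : (Word (m + 1) p' ⊕ Fin q) → ℝ → ℝ) (hg : ∀ j, g j 0 = 0) :
    ∑ j, g j (padParam h θ j) = ∑ j, g (padIdx h j) (θ j) := by
  symm
  refine Fintype.sum_of_injective (padIdx h) (padIdx_injective h) _ _ (fun j hj => ?_) fun j => ?_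
  · rw [padParam, Function.extend_apply' _ _ _ (by simpa using hj)]
    exact hg j
  · rw [padParam, (padIdx_injective h).extend_apply]

/-- The models are nested, so parameters of different orders can be compared within one `ℓ¹`-ball,
under a single deviation bound. -/
theorem linPred_padParam {p p' : ℕ} (h : p ≤ p') (θ : Param m q p) (o : Obs m q T) :
    linPred p' o (padParam h θ) = linPred p o θ := by
  rw [linPred_eq, linPred_eq, sum_padParam h θ (fun j x => feat p' o j * x) (by simp)]
  simp only [feat_padIdx]

theorem padParam_mem {p p' : ℕ} (h : p ≤ p') {θ : Param m q p} {r : ℝ}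
    (hθ : θ ∈ l1Ball m q p r) : padParam h θ ∈ l1Ball m q p' r := by
  have := sum_padParam h θ (fun _ x => |x|) (by simp)
  simp only [l1Ball, mem_ofPred_eq] at hθ ⊢
  rwa [this]

theorem popRisk_padParam {p p' : ℕ} (h : p ≤ p') (θ : Param m q p) (P : Measure (Obs m q T)) :
    popRisk P p' (padParam h θ) = popRisk P p θ := by
  simp only [popRisk, linPred_padParam]

theorem empRisk_padParam {p p' n : ℕ} (h : p ≤ p') (θ : Param m q p) (o : Fin n → Obs m q T) :
    empRisk o p' (padParam h θ) = empRisk o p θ := by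
  simp only [empRisk, linPred_padParam]

theorem card_index (d p : ℕ) : Fintype.card (Word d p ⊕ Fin q) = sigDim d p + q := by
  rw [Fintype.card_sum, Fintype.card_sigma, Fintype.card_fin, sigDim]
  congr 1
  simp only [Fintype.card_fun, Fintype.card_fin]
  exact Fin.sum_univ_eq_sum_range (fun k => d ^ k) (p + 1)

instance instNonemptyWord (d p : ℕ) : Nonempty (Word d p) := ⟨⟨0, Fin.elim0⟩⟩

/-! ### Population risk -/

theorem popRisk_nonneg (P : Measure (Obs m q T)) (p : ℕ) (θ : Param m q p) :
    0 ≤ popRisk P p θ :=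
  integral_nonneg fun o => logisticLoss_nonneg (label_mem o) _

theorem infRisk_le (P : Measure (Obs m q T)) (p : ℕ) (θ : Param m q p) :
    infRisk P ≤ popRisk P p θ :=
  ciInf_le ⟨0, by rintro _ ⟨s, rfl⟩; exact popRisk_nonneg _ _ _⟩
    (⟨p, θ⟩ : Σ p : ℕ, Param m q p)

theorem popMin_le {P : Measure (Obs m q T)} {p : ℕ} {r : ℝ} {θ : Param m q p}
    (hθ : θ ∈ l1Ball m q p r) : popMin P r p ≤ popRisk P p θ :=
  csInf_le ⟨0, by rintro _ ⟨s, -, rfl⟩; exact popRisk_nonneg _ _ _⟩ ⟨θ, hθ, rfl⟩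

theorem isCompact_l1Ball (p : ℕ) {r : ℝ} (hr : 0 ≤ r) : IsCompact (l1Ball m q p r) := by
  refine Metric.isCompact_of_isClosed_isBounded ?_ ?_
  · exact isClosed_le (by fun_prop) continuous_const
  · refine (Metric.isBounded_iff_subset_closedBall 0).2 ⟨r, fun θ hθ => ?_⟩
    rw [mem_closedBall_zero_iff, pi_norm_le_iff_of_nonneg hr]
    intro j
    exact (Finset.single_le_sum (f := fun j => |θ j|) (fun j _ => abs_nonneg _)
      (Finset.mem_univ j)).trans hθ

theorem zero_mem_l1Ball (p : ℕ) {r : ℝ} (hr : 0 ≤ r) : (0 : Param m q p) ∈ l1Ball m q p r := by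
  simp [l1Ball, hr]

section Bounded

variable {P : Measure (Obs m q T)} {CX Cz : ℝ}

theorem aemeasurable_linPred (hCX : 0 < CX)
    (hX : ∀ᵐ o ∂P, eVariationOn o.1 univ < ENNReal.ofReal CX) (p : ℕ) (θ : Param m q p) :
    AEMeasurable (fun o => linPred p o θ) P :=
  Finset.aemeasurable_fun_sum _ fun j _ => (aemeasurable_feat hCX hX p j).mul_const _

theorem abs_linPred_le (hCX : 0 < CX) (hCz : 0 < Cz) {o : Obs m q T}
    (hX : eVariationOn o.1 univ < ENNReal.ofReal CX) (hz : ‖o.2.1‖ < Cz) (p : ℕ)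
    (θ : Param m q p) : |linPred p o θ| ≤ constC Cz CX T / 2 * ∑ j, |θ j| :=
  sum_mul_le_mul_sum_abs (abs_feat_le hCX hCz hX hz p)

variable [IsProbabilityMeasure P]

theorem integrable_loss_of_bounded {g : Obs m q T → ℝ} (hg : AEMeasurable g P) {c : ℝ}
    (hc : ∀ᵐ o ∂P, |g o| ≤ c) : Integrable (fun o => logisticLoss (label o) (g o)) P := by
  refine Integrable.of_bound (measurable_logisticLoss.comp_aemeasurable
    (measurable_label.aemeasurable.prodMk hg)).aestronglyMeasurable (c + Real.log 2) ?_
  filter_upwards [hc] with o ho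
  have h1 := abs_logisticLoss_sub_log_two_le (label_mem o) (g o)
  have h2 := abs_sub_abs_le_abs_sub (logisticLoss (label o) (g o)) (Real.log 2)
  rw [abs_of_pos (Real.log_pos one_lt_two)] at h2
  rw [Real.norm_eq_abs]
  linarith

theorem integrable_loss (hCX : 0 < CX) (hCz : 0 < Cz)
    (hX : ∀ᵐ o ∂P, eVariationOn o.1 univ < ENNReal.ofReal CX) (hz : ∀ᵐ o ∂P, ‖o.2.1‖ < Cz)
    (p : ℕ) (θ : Param m q p) :
    Integrable (fun o => logisticLoss (label o) (linPred p o θ)) P := by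
  refine integrable_loss_of_bounded (aemeasurable_linPred hCX hX p θ)
    (c := constC Cz CX T / 2 * ∑ j, |θ j|) ?_
  filter_upwards [hX, hz] with o h1 h2
  exact abs_linPred_le hCX hCz h1 h2 p θ

theorem popRisk_le (hCX : 0 < CX) (hCz : 0 < Cz)
    (hX : ∀ᵐ o ∂P, eVariationOn o.1 univ < ENNReal.ofReal CX) (hz : ∀ᵐ o ∂P, ‖o.2.1‖ < Cz)
    {p : ℕ} {r : ℝ} {θ : Param m q p} (hθ : θ ∈ l1Ball m q p r) :
    popRisk P p θ ≤ r * constC Cz CX T / 2 + Real.log 2 := by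
  have h1 : ∀ᵐ o ∂P, logisticLoss (label o) (linPred p o θ)
      ≤ r * constC Cz CX T / 2 + Real.log 2 := by
    filter_upwards [hX, hz] with o h1 h2
    have h3 := abs_linPred_le hCX hCz h1 h2 p θ
    have h4 := (le_abs_self _).trans (abs_logisticLoss_sub_log_two_le (label_mem o)
      (linPred p o θ))
    have h5 : constC Cz CX T / 2 * ∑ j, |θ j| ≤ constC Cz CX T / 2 * r :=
      mul_le_mul_of_nonneg_left hθ (half_pos (constC_pos hCz)).le
    linarith
  have h2 := integral_mono_ae (integrable_loss hCX hCz hX hz p θ) (integrable_const _) h1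
  simpa [popRisk] using h2

theorem abs_popRisk_sub_le (hCX : 0 < CX) (hCz : 0 < Cz)
    (hX : ∀ᵐ o ∂P, eVariationOn o.1 univ < ENNReal.ofReal CX) (hz : ∀ᵐ o ∂P, ‖o.2.1‖ < Cz)
    (p : ℕ) (θ η : Param m q p) :
    |popRisk P p θ - popRisk P p η| ≤ constC Cz CX T / 2 * ∑ j, |θ j - η j| := by
  rw [popRisk, popRisk, ← integral_sub (integrable_loss hCX hCz hX hz p θ)
    (integrable_loss hCX hCz hX hz p η)]
  have h1 : ∀ᵐ o ∂P, ‖logisticLoss (label o) (linPred p o θ)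
      - logisticLoss (label o) (linPred p o η)‖ ≤ constC Cz CX T / 2 * ∑ j, |θ j - η j| := by
    filter_upwards [hX, hz] with o h1 h2
    refine (abs_logisticLoss_sub_le (label_mem o) _ _).trans ?_
    rw [linPred_eq, linPred_eq, ← Finset.sum_sub_distrib]
    simp only [← mul_sub]
    exact sum_mul_le_mul_sum_abs (abs_feat_le hCX hCz h1 h2 p)
  have h2 := norm_integral_le_of_norm_le_const h1
  simpa using h2

theorem continuous_popRisk (hCX : 0 < CX) (hCz : 0 < Cz)
    (hX : ∀ᵐ o ∂P, eVariationOn o.1 univ < ENNReal.ofReal CX) (hz : ∀ᵐ o ∂P, ‖o.2.1‖ < Cz)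
    (p : ℕ) : Continuous (popRisk P p) := by
  rw [continuous_iff_continuousAt]
  intro θ
  refine tendsto_iff_dist_tendsto_zero.2 ?_
  have hc : Continuous fun η : Param m q p => constC Cz CX T / 2 * ∑ j, |η j - θ j| := by
    fun_prop
  have h0 := hc.tendsto θ
  simp only [sub_self, abs_zero, Finset.sum_const_zero, mul_zero] at h0
  exact squeeze_zero (fun _ => dist_nonneg)
    (fun η => abs_popRisk_sub_le hCX hCz hX hz p η θ) h0

theorem exists_popMin_eq (hCX : 0 < CX) (hCz : 0 < Cz)
    (hX : ∀ᵐ o ∂P, eVariationOn o.1 univ < ENNReal.ofReal CX) (hz : ∀ᵐ o ∂P, ‖o.2.1‖ < Cz)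
    (p : ℕ) {r : ℝ} (hr : 0 ≤ r) : ∃ θ ∈ l1Ball m q p r, popMin P r p = popRisk P p θ := by
  obtain ⟨θ, hθ, h⟩ := (isCompact_l1Ball p hr).exists_sInf_image_eq ⟨0, zero_mem_l1Ball p hr⟩
    (continuous_popRisk (P := P) hCX hCz hX hz p).continuousOn
  exact ⟨θ, hθ, h⟩

/-- Universality: signature models are as good as semi-parametric ones. -/
theorem infRisk_le_semiRisk (hT : 0 < T) (hCX : 0 < CX)
    (hX : ∀ᵐ o ∂P, eVariationOn o.1 univ < ENNReal.ofReal CX) (hCz : 0 < Cz)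
    (hz : ∀ᵐ o ∂P, ‖o.2.1‖ < Cz) {x₀ : EuclideanSpace ℝ (Fin m)}
    (hx₀ : ∀ᵐ o ∂P, o.1 ⟨0, le_refl 0, T.2⟩ = x₀)
    (F : BoundedContinuousFunction (CPath m T) ℝ) (γ : Fin q → ℝ) :
    infRisk P ≤ semiRisk P F γ := by
  refine le_of_forall_pos_le_add fun ε hε => ?_
  obtain ⟨p, β, hβ⟩ := exists_sig_approx hT hCX (P := P) (X := Prod.fst) measurable_fst hX hx₀ F hε
  refine (infRisk_le P p (Sum.elim β γ)).trans ?_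
  have hlin : ∀ o : Obs m q T, linPred p o (Sum.elim β γ)
      = ∑ w, truncSig p o.1 w * β w + ∑ l, o.2.1 l * γ l := by
    intro o
    rw [linPred, Fintype.sum_sum_type]
    simp
  have hzl : ∀ l : Fin q, Measurable fun o : Obs m q T => o.2.1 l := fun l => by
    have : Continuous fun v : EuclideanSpace ℝ (Fin q) => v l := by fun_prop
    exact this.measurable.comp (measurable_fst.comp measurable_snd)
  have hi : Integrable (fun o => logisticLoss (label o) (F o.1 + ∑ l, o.2.1 l * γ l)) P := by
    refine integrable_loss_of_bounded (c := ‖F‖ + Cz * ∑ l, |γ l|) ?_ ?_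
    · exact ((F.continuous.measurable.comp measurable_fst).add
        (Finset.measurable_fun_sum _ fun l _ => (hzl l).mul_const _)).aemeasurable
    · filter_upwards [hz] with o ho
      refine (abs_add_le _ _).trans (add_le_add (F.norm_coe_le_norm _)
        (sum_mul_le_mul_sum_abs fun l => ?_))
      exact (PiLp.norm_apply_le o.2.1 l).trans ho.le
  have hj := integrable_loss (P := P) hCX hCz hX hz p (Sum.elim β γ)
  have hS : AEMeasurable (fun o : Obs m q T => ∑ w, truncSig p o.1 w * β w) P :=
    Finset.aemeasurable_fun_sum _ fun w _ =>
      (aemeasurable_iterInt_augment measurable_fst hCX hX _ _).mul_const _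
  have hd : Integrable (fun o : Obs m q T => |F o.1 - ∑ w, truncSig p o.1 w * β w|) P := by
    refine Integrable.abs (Integrable.of_bound
      ((F.continuous.measurable.comp measurable_fst).aemeasurable.sub hS).aestronglyMeasurable
      (‖F‖ + Real.exp (CX + T) * ∑ w, |β w|) ?_)
    filter_upwards [hX] with o ho
    refine (abs_sub _ _).trans (add_le_add (F.norm_coe_le_norm _)
      (sum_mul_le_mul_sum_abs fun w => ?_))
    exact abs_iterInt_augment_le hCX ho _ _
  have h1 : popRisk P p (Sum.elim β γ) ≤ ∫ o, (logisticLoss (label o)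
      (F o.1 + ∑ l, o.2.1 l * γ l) + |F o.1 - ∑ w, truncSig p o.1 w * β w|) ∂P := by
    refine integral_mono hj (hi.add hd) fun o => ?_
    have := (le_abs_self _).trans (abs_logisticLoss_sub_le (label_mem o)
      (linPred p o (Sum.elim β γ)) (F o.1 + ∑ l, o.2.1 l * γ l))
    rw [hlin, show ∑ w, truncSig p o.1 w * β w + ∑ l, o.2.1 l * γ l
      - (F o.1 + ∑ l, o.2.1 l * γ l) = -(F o.1 - ∑ w, truncSig p o.1 w * β w) by ring,
      abs_neg] at this
    simp only [hlin]
    linarith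
  rw [integral_add hi hd] at h1
  exact h1.trans (add_le_add le_rfl hβ)

theorem infRisk_le_minSemiRisk (hT : 0 < T) (hCX : 0 < CX)
    (hX : ∀ᵐ o ∂P, eVariationOn o.1 univ < ENNReal.ofReal CX) (hCz : 0 < Cz)
    (hz : ∀ᵐ o ∂P, ‖o.2.1‖ < Cz) {x₀ : EuclideanSpace ℝ (Fin m)}
    (hx₀ : ∀ᵐ o ∂P, o.1 ⟨0, le_refl 0, T.2⟩ = x₀) {CF Cγ : ℝ} (hCF : 0 ≤ CF) (hCγ : 0 ≤ Cγ) :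
    infRisk P ≤ minSemiRisk P CF Cγ := by
  refine le_csInf ⟨_, 0, 0, by simpa using hCF, by simpa using hCγ, rfl⟩ ?_
  rintro _ ⟨F, γ, -, -, rfl⟩
  exact infRisk_le_semiRisk hT hCX hX hCz hz hx₀ F γ

/-- Uniform deviation of the empirical from the population risk over the `ℓ¹`-ball. -/
theorem exists_risk_deviation (hCX : 0 < CX) (hCz : 0 < Cz)
    (hX : ∀ᵐ o ∂P, eVariationOn o.1 univ < ENNReal.ofReal CX) (hz : ∀ᵐ o ∂P, ‖o.2.1‖ < Cz)
    {Ω : Type*} [MeasurableSpace Ω] {μ : Measure Ω} [IsProbabilityMeasure μ]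
    {n : ℕ} (hn : 0 < n) {D : Fin n → Ω → Obs m q T}
    (hDmeas : ∀ i, Measurable (D i)) (hDlaw : ∀ i, μ.map (D i) = P) (hDindep : iIndepFun D μ)
    {r : ℝ} (hr : 0 < r) (p : ℕ) {δ : ℝ} (hδ : 0 < δ) :
    ∃ W : Ω → ℝ, Integrable W μ ∧ (∀ ω, 0 ≤ W ω) ∧
      (∀ᵐ ω ∂μ, ∀ θ ∈ l1Ball m q p r,
        |empRisk (fun i => D i ω) p θ - popRisk P p θ| ≤ W ω + δ) ∧
      (∀ u, 0 ≤ u → μ.real {ω | u ≤ W ω} ≤ 4 * ((sigDim (m + 1) p : ℝ) + q) *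
        Real.exp (-(n * u ^ 2 / (2 * r ^ 2 * constC Cz CX T ^ 2)))) ∧
      ∫ ω, W ω ∂μ ≤ 3 * r * constC Cz CX T * √(((sigDim (m + 1) p : ℝ) + q) / n) := by
  have hn' : (0 : ℝ) < n := by exact_mod_cast hn
  set C := constC Cz CX T with hC
  have hC0 : 0 < C := constC_pos hCz
  obtain ⟨φ, hφm, hφB, hφ⟩ := exists_measurable_feat (P := P) hCX hCz hX hz p
  set f : Param m q p → Obs m q T → ℝ := fun θ o =>
    logisticLoss (label o) (∑ j, φ o j * θ j) - Real.log 2 with hf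
  have hfm : ∀ θ, Measurable (f θ) := fun θ =>
    (measurable_logisticLoss.comp (measurable_label.prodMk
      (Finset.measurable_fun_sum _ fun j _ => (hφm j).mul_const _))).sub_const _
  -- With `B = C / 2` and sums instead of averages, the slack is `n * δ`; dividing by `n` later
  -- turns `6 r B` into `3 r C` and `8 r² B²` into `2 r² C²`.
  obtain ⟨W, hWm, hWi, hW0, hWd, hWt, hWe⟩ := exists_uniform_deviation (P := P) hr
    (half_pos hC0) hfm hφm hφB
    (fun θ o => abs_logisticLoss_sub_log_two_le (label_mem o) _)
    (fun θ η o => by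
      simp only [hf, sub_sub_sub_cancel_right]
      exact abs_logisticLoss_sub_le (label_mem o) _ _) hn (mul_pos hn' hδ)
  have hcard : ((Fintype.card (Word (m + 1) p ⊕ Fin q) : ℕ) : ℝ)
      = (sigDim (m + 1) p : ℝ) + q := by rw [card_index]; push_cast; rfl
  rw [hcard] at hWt hWe
  set S : Ω → Fin n → Obs m q T := fun ω i => D i ω with hS
  have hSm : Measurable S := measurable_pi_lambda _ hDmeas
  have hlaw : μ.map S = Measure.pi fun _ => P := by
    rw [(iIndepFun_iff_map_fun_eq_pi_map fun i => (hDmeas i).aemeasurable).1 hDindep]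
    congr 1
    ext1 i
    exact hDlaw i
  rw [← hlaw] at hWi hWe hWt
  have hDφ : ∀ᵐ ω ∂μ, ∀ i, φ (D i ω) = feat p (D i ω) := by
    refine ae_all_iff.2 fun i => ?_
    exact ae_of_ae_map (hDmeas i).aemeasurable (by rw [hDlaw i]; exact hφ)
  have hpop : ∀ θ, ∫ o, f θ o ∂P = popRisk P p θ - Real.log 2 := by
    intro θ
    have e : ∫ o, f θ o ∂P = ∫ o, (logisticLoss (label o) (linPred p o θ) - Real.log 2) ∂P := by
      refine integral_congr_ae ?_
      filter_upwards [hφ] with o ho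
      simp only [hf]
      rw [ho, linPred_eq]
    rw [e, integral_sub (integrable_loss hCX hCz hX hz p θ) (integrable_const _)]
    simp [popRisk]
  refine ⟨fun ω => W (S ω) / n, ?_, fun ω => by positivity [hW0 (S ω)], ?_, fun u hu => ?_, ?_⟩
  · exact ((integrable_map_measure hWm.aestronglyMeasurable hSm.aemeasurable).1 hWi).div_const _
  · filter_upwards [hDφ] with ω hω θ hθ
    have h1 := hWd θ hθ (S ω)
    have h2 : ∑ i, (f θ (S ω i) - ∫ x, f θ x ∂P)
        = n * (empRisk (fun i => D i ω) p θ - popRisk P p θ) := by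
      have h3 : ∀ i, f θ (S ω i) - ∫ x, f θ x ∂P
          = logisticLoss (label (D i ω)) (linPred p (D i ω) θ) - popRisk P p θ := by
        intro i
        rw [hpop]
        simp only [hf, hS, hω, linPred_eq]
        ring
      simp only [h3, empRisk]
      rw [Finset.sum_sub_distrib]
      simp only [Finset.sum_const, Finset.card_univ, Fintype.card_fin, nsmul_eq_mul]
      field_simp
    rw [h2, abs_mul, abs_of_pos hn'] at h1
    rw [div_add' _ _ _ hn'.ne', le_div_iff₀ hn']
    linarith
  · have h1 := hWt (n * u) (by positivity)
    rw [map_measureReal_apply hSm (measurableSet_le measurable_const hWm)] at h1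
    have e1 : {ω | u ≤ W (S ω) / n} = S ⁻¹' {s | n * u ≤ W s} := by
      ext ω
      simp only [mem_ofPred_eq, mem_preimage]
      rw [le_div_iff₀ hn', mul_comm]
    rw [e1]
    refine h1.trans (le_of_eq ?_)
    congr 3
    field_simp
    norm_num
  · rw [integral_div]
    rw [integral_map hSm.aemeasurable hWm.aestronglyMeasurable] at hWe
    rw [div_le_iff₀ hn']
    refine hWe.trans (le_of_eq ?_)
    have e2 : √(((sigDim (m + 1) p : ℝ) + q) * n) = √(((sigDim (m + 1) p : ℝ) + q) / n) * n := by
      rw [show ((sigDim (m + 1) p : ℝ) + q) * n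
        = ((sigDim (m + 1) p : ℝ) + q) / n * n ^ 2 by field_simp,
        Real.sqrt_mul (by positivity), Real.sqrt_sq hn'.le]
    rw [e2]
    ring

end Bounded

end Model

/-! ### The number of signature terms -/

theorem sigDim_succ (d p : ℕ) : sigDim d (p + 1) = sigDim d p + d ^ (p + 1) := by
  rw [sigDim, Finset.sum_range_succ, ← sigDim]

theorem sigDim_mono (d : ℕ) : Monotone (sigDim d) :=
  monotone_nat_of_le_succ fun p => by rw [sigDim_succ]; omega

theorem succ_le_sigDim {d : ℕ} (hd : 0 < d) (p : ℕ) : p + 1 ≤ sigDim d p := by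
  induction p with
  | zero => simp [sigDim]
  | succ p ih =>
    rw [sigDim_succ]
    have := Nat.pow_pos (n := p + 1) hd
    omega

/-- For `d ≥ 2` the last term of the geometric sum dominates. For `d = 1` the sum grows only
linearly and the bound survives just at `p = 0`. -/
theorem sigDim_succ_le_two_mul {d p : ℕ} (hd : 0 < d) (h : 2 ≤ d ∨ p = 0) :
    sigDim d (p + 1) ≤ 2 * d ^ (p + 1) := by
  have key : 2 ≤ d → ∀ k, sigDim d k ≤ 2 * d ^ k := by
    intro hd2 k
    induction k with
    | zero => simp [sigDim]
    | succ k ih =>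
      rw [sigDim_succ, pow_succ]
      nlinarith [Nat.pow_pos (n := k) hd]
  rcases h with h | rfl
  · exact key h _
  · rw [sigDim_succ]
    simp only [sigDim, Finset.range_one, Finset.sum_singleton, pow_zero, zero_add, pow_one]
    omega

theorem summable_exp_sigDim {d : ℕ} (hd : 0 < d) {c : ℝ} (hc : 0 < c) :
    Summable fun p : ℕ => Real.exp (-c * sigDim d (p + 1)) := by
  have h : Summable fun p : ℕ => Real.exp (-c) ^ p :=
    summable_geometric_of_lt_one (Real.exp_pos _).le (by simpa using hc)
  refine h.of_nonneg_of_le (fun p => (Real.exp_pos _).le) fun p => ?_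
  rw [← Real.exp_nat_mul, Real.exp_le_exp]
  have h1 : (p : ℝ) ≤ sigDim d (p + 1) := by
    exact_mod_cast (by omega : p ≤ p + 1 + 1).trans (succ_le_sigDim hd (p + 1))
  nlinarith

theorem tsum_exp_sigDim_shift_le {d : ℕ} (hd : 0 < d) {c : ℝ} (hc : 0 < c) (p₀ : ℕ) :
    Summable (fun k : ℕ => Real.exp (-c * sigDim d (p₀ + 1 + k))) ∧
    ∑' k : ℕ, Real.exp (-c * sigDim d (p₀ + 1 + k))
      ≤ ∑' p : ℕ, Real.exp (-c * sigDim d (p + 1)) := by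
  have hs := summable_exp_sigDim hd hc
  have hinj : Function.Injective fun k : ℕ => p₀ + k := fun a b h => by simpa using h
  have e : (fun k : ℕ => Real.exp (-c * sigDim d (p₀ + 1 + k)))
      = (fun p : ℕ => Real.exp (-c * sigDim d (p + 1))) ∘ fun k => p₀ + k := by
    ext k
    simp only [Function.comp_apply]
    rw [show p₀ + 1 + k = p₀ + k + 1 by ring]
  rw [e]
  exact ⟨hs.comp_injective hinj, tsum_comp_le_tsum_of_inj hs (fun _ => (Real.exp_pos _).le) hinj⟩

/-! ### The penalty and the selected order -/

/-- The new words of length `p₀ + 1` make up at least half of the total, so the dimension at least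
doubles beyond `p₀`, and `√(1/2) ≤ 3/4`. -/
theorem sqrt_sigDim_ratio {d p p₀ : ℕ} (h2 : sigDim d (p₀ + 1) ≤ 2 * d ^ (p₀ + 1))
    (hp : p₀ < p) : √(sigDim d p₀ : ℝ) ≤ 3 / 4 * √(sigDim d p : ℝ) := by
  have h3 : 2 * sigDim d p₀ ≤ sigDim d p := by
    have := sigDim_mono d (Nat.succ_le_of_lt hp)
    have := sigDim_succ d p₀
    simp only [Nat.succ_eq_add_one] at *
    omega
  have h4 : 2 * (sigDim d p₀ : ℝ) ≤ sigDim d p := by exact_mod_cast h3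
  refine Real.sqrt_le_iff.2 ⟨by positivity, ?_⟩
  rw [mul_pow, Real.sq_sqrt (by positivity)]
  have : (0 : ℝ) ≤ sigDim d p := by positivity
  linarith

theorem penalty_sub_ge {d q n p p₀ : ℕ} {Cpen ρ : ℝ} (hC : 0 < Cpen)
    (h2 : sigDim d (p₀ + 1) ≤ 2 * d ^ (p₀ + 1)) (hp : p₀ < p) :
    penalty d q n Cpen ρ p / 4 ≤ penalty d q n Cpen ρ p - penalty d q n Cpen ρ p₀ := by
  have h := sqrt_sigDim_ratio h2 hp
  have e : penalty d q n Cpen ρ p₀ ≤ 3 / 4 * penalty d q n Cpen ρ p := by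
    unfold penalty
    rw [Real.sqrt_mul (by positivity), Real.sqrt_mul (by positivity), ← mul_div_assoc]
    refine div_le_div_of_nonneg_right ?_ (by positivity)
    have : 0 ≤ Cpen * √(Real.exp q) := by positivity
    nlinarith [mul_le_mul_of_nonneg_left h this]
  linarith

theorem penalty_pos {d q n p : ℕ} {Cpen ρ : ℝ} (hd : 0 < d) (hn : 0 < n) (hC : 0 < Cpen) :
    0 < penalty d q n Cpen ρ p := by
  have : 0 < sigDim d p := (Nat.succ_pos p).trans_le (succ_le_sigDim hd p)
  unfold penalty
  positivity

theorem tendsto_penalty {d q n : ℕ} {Cpen ρ : ℝ} (hd : 0 < d) (hn : 0 < n) (hC : 0 < Cpen) :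
    Filter.Tendsto (penalty d q n Cpen ρ) Filter.atTop Filter.atTop := by
  unfold penalty
  refine Filter.Tendsto.atTop_div_const (by positivity) (Filter.Tendsto.const_mul_atTop hC ?_)
  refine Real.tendsto_sqrt_atTop.comp (Filter.Tendsto.atTop_mul_const (Real.exp_pos _) ?_)
  refine tendsto_natCast_atTop_atTop.comp (Filter.tendsto_atTop_mono (fun p => ?_) Filter.tendsto_id)
  exact (Nat.le_succ p).trans (succ_le_sigDim hd p)

section Order

variable {m q n : ℕ} {T : ℝ≥0}

theorem empRisk_nonneg (o : Fin n → Obs m q T) (p : ℕ) (θ : Param m q p) : 0 ≤ empRisk o p θ :=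
  mul_nonneg (by positivity)
    (Finset.sum_nonneg fun i _ => logisticLoss_nonneg (label_mem (o i)) _)

theorem empMin_nonneg (o : Fin n → Obs m q T) (r : ℝ) (p : ℕ) : 0 ≤ empMin o r p := by
  refine Real.sInf_nonneg ?_
  rintro _ ⟨θ, -, rfl⟩
  exact empRisk_nonneg o p θ

theorem empMin_le {o : Fin n → Obs m q T} {r : ℝ} {p : ℕ} {θ : Param m q p}
    (hθ : θ ∈ l1Ball m q p r) : empMin o r p ≤ empRisk o p θ :=
  csInf_le ⟨0, by rintro _ ⟨s, -, rfl⟩; exact empRisk_nonneg _ _ _⟩ ⟨θ, hθ, rfl⟩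

theorem IsERM.empMin_eq {o : Fin n → Obs m q T} {r : ℝ} {p : ℕ} {θ : Param m q p}
    (h : IsERM o r p θ) : empMin o r p = empRisk o p θ := by
  refine IsLeast.csInf_eq ⟨⟨θ, h.1, rfl⟩, ?_⟩
  rintro _ ⟨η, hη, rfl⟩
  exact h.2 η hη

/-- The penalty tends to infinity and empirical minima are nonnegative, so a finite search finds a
minimizing order and the infimum in `orderHat` is not the default value of an empty set. -/
theorem orderHat_spec (o : Fin n → Obs m q T) (r : ℝ) {Cpen ρ : ℝ} (hn : 0 < n)
    (hC : 0 < Cpen) (p' : ℕ) :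
    empMin o r (orderHat o r Cpen ρ) + penalty (m + 1) q n Cpen ρ (orderHat o r Cpen ρ)
      ≤ empMin o r p' + penalty (m + 1) q n Cpen ρ p' := by
  set g : ℕ → ℝ := fun p => empMin o r p + penalty (m + 1) q n Cpen ρ p with hg
  have hne : {p | ∀ p', g p ≤ g p'}.Nonempty := by
    obtain ⟨K, hK⟩ := Filter.eventually_atTop.1
      ((tendsto_penalty (q := q) (ρ := ρ) (Nat.succ_pos m) hn hC).eventually_ge_atTop (g 0))
    obtain ⟨p, -, hp⟩ := Finset.exists_min_image (Finset.range (K + 1)) g ⟨0, by simp⟩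
    refine ⟨p, fun p' => ?_⟩
    rcases lt_or_ge p' (K + 1) with h | h
    · exact hp p' (Finset.mem_range.2 h)
    · refine (hp 0 (by simp)).trans ((hK p' (by omega)).trans ?_)
      simp only [hg]
      linarith [empMin_nonneg o r p']
  exact Nat.sInf_mem hne p'

/-- Padding the optimal parameter of order `p₀` to order `p` places both competitors in one ball.
Since it is already optimal in population, the extra penalty can only be offset by noise, once for
each competitor. -/
theorem penalty_sub_le_of_orderHat {P : Measure (Obs m q T)} {o : Fin n → Obs m q T}
    {r Cpen ρ Z : ℝ} (hn : 0 < n) (hC : 0 < Cpen) {p p₀ : ℕ} (hp : p₀ < p)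
    (hord : orderHat o r Cpen ρ = p) {θ₀ : Param m q p₀} (hθ₀ : θ₀ ∈ l1Ball m q p₀ r)
    (hopt : popRisk P p₀ θ₀ = infRisk P) {θ : Param m q p} (hθ : IsERM o r p θ)
    (hZ : ∀ η ∈ l1Ball m q p r, |empRisk o p η - popRisk P p η| ≤ Z) :
    penalty (m + 1) q n Cpen ρ p - penalty (m + 1) q n Cpen ρ p₀ ≤ 2 * Z := by
  have h1 := orderHat_spec o r (ρ := ρ) hn hC p₀
  rw [hord, hθ.empMin_eq] at h1
  have h2 := empMin_le (o := o) hθ₀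
  have h3 := (abs_le.1 (hZ _ hθ.1)).1
  have h4 := (abs_le.1 (hZ _ (padParam_mem hp.le hθ₀))).2
  rw [empRisk_padParam, popRisk_padParam, hopt] at h4
  have h5 := infRisk_le P p θ
  linarith

/-- Here the estimator is padded upwards, to order `p₀ - 1` for the comparison with `popMin` and to
`p₀` for the deviation. All smaller orders are thus excluded by one event, without a union bound. -/
theorem gap_le_of_orderHat {P : Measure (Obs m q T)} {o : Fin n → Obs m q T}
    {r Cpen ρ Z : ℝ} (hn : 0 < n) (hC : 0 < Cpen) {p p₀ : ℕ} (hp : p < p₀)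
    (hord : orderHat o r Cpen ρ = p) {θ₀ : Param m q p₀} (hθ₀ : θ₀ ∈ l1Ball m q p₀ r)
    {θ : Param m q p} (hθ : IsERM o r p θ)
    (hZ : ∀ η ∈ l1Ball m q p₀ r, |empRisk o p₀ η - popRisk P p₀ η| ≤ Z) :
    popMin P r (p₀ - 1) - popRisk P p₀ θ₀ ≤ 2 * Z + penalty (m + 1) q n Cpen ρ p₀ := by
  have h1 := orderHat_spec o r (ρ := ρ) hn hC p₀
  rw [hord, hθ.empMin_eq] at h1
  have h2 := empMin_le (o := o) hθ₀
  have h3 := (abs_le.1 (hZ _ hθ₀)).2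
  have h4 := (abs_le.1 (hZ _ (padParam_mem hp.le hθ.1))).1
  rw [empRisk_padParam, popRisk_padParam] at h4
  have h5 := popMin_le (P := P) (padParam_mem (show p ≤ p₀ - 1 by omega) hθ.1)
  rw [popRisk_padParam] at h5
  have h6 := penalty_pos (q := q) (p := p) (ρ := ρ) (Nat.succ_pos m) hn hC
  linarith

/-! ### Measurability of the selected order -/

/-- Besides the union of the first sets, a sublevel set contains the points where no index
qualifies, because the infimum of the empty set is `0`. -/
theorem measurable_sInf_nat {Ω : Type*} [MeasurableSpace Ω] {Q : ℕ → Ω → Prop}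
    (hQ : ∀ p, MeasurableSet {ω | Q p ω}) : Measurable fun ω => sInf {p | Q p ω} := by
  refine measurable_of_Iic fun k => ?_
  have e : (fun ω => sInf {p | Q p ω}) ⁻¹' Iic k
      = (⋃ j ∈ Finset.range (k + 1), {ω | Q j ω}) ∪ ⋂ j, {ω | Q j ω}ᶜ := by
    ext ω
    simp only [mem_preimage, mem_Iic, mem_union, mem_iUnion, Finset.mem_range, mem_iInter,
      mem_compl_iff, mem_ofPred_eq, exists_prop]
    constructor
    · intro h
      by_cases hne : {p | Q p ω}.Nonempty
      · exact Or.inl ⟨_, Nat.lt_succ_of_le h, Nat.sInf_mem hne⟩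
      · exact Or.inr fun j hj => hne ⟨j, hj⟩
    · rintro (⟨j, hj, hQj⟩ | h)
      · exact (Nat.sInf_le hQj).trans (Nat.lt_succ_iff.1 hj)
      · have : {p | Q p ω} = ∅ := by ext j; simpa using h j
        rw [this, Nat.sInf_empty]
        exact Nat.zero_le k
  rw [e]
  exact (Finset.measurableSet_biUnion _ fun j _ => hQ j).union
    (MeasurableSet.iInter fun j => (hQ j).compl)

theorem aemeasurable_empRisk {P : Measure (Obs m q T)} {CX : ℝ} (hCX : 0 < CX)
    (hX : ∀ᵐ o ∂P, eVariationOn o.1 univ < ENNReal.ofReal CX)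
    {Ω : Type*} [MeasurableSpace Ω] {μ : Measure Ω} {D : Fin n → Ω → Obs m q T}
    (hDmeas : ∀ i, Measurable (D i)) (hDlaw : ∀ i, μ.map (D i) = P) {p : ℕ}
    {θ : Ω → Param m q p} (hθ : AEMeasurable θ μ) :
    AEMeasurable (fun ω => empRisk (fun i => D i ω) p (θ ω)) μ := by
  unfold empRisk
  refine (Finset.aemeasurable_fun_sum _ fun i _ => ?_).const_mul _
  refine measurable_logisticLoss.comp_aemeasurable
    ((measurable_label.comp (hDmeas i)).aemeasurable.prodMk ?_)
  change AEMeasurable (fun ω => ∑ j, feat p (D i ω) j * θ ω j) μ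
  refine Finset.aemeasurable_fun_sum _ fun j _ => ?_
  refine AEMeasurable.mul ?_ ((measurable_pi_apply j).comp_aemeasurable hθ)
  have h1 := aemeasurable_feat (P := P) hCX hX p j
  rw [← hDlaw i] at h1
  exact h1.comp_measurable (hDmeas i)

/-- The empirical minimum is the empirical risk at the given measurable minimizer, so no infimum
over an uncountable ball has to be measured; only countably many orders are compared. -/
theorem aemeasurable_orderHat {P : Measure (Obs m q T)} {CX : ℝ} (hCX : 0 < CX)
    (hX : ∀ᵐ o ∂P, eVariationOn o.1 univ < ENNReal.ofReal CX)
    {Ω : Type*} [MeasurableSpace Ω] {μ : Measure Ω} {D : Fin n → Ω → Obs m q T}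
    (hDmeas : ∀ i, Measurable (D i)) (hDlaw : ∀ i, μ.map (D i) = P) {r Cpen ρ : ℝ}
    {θHat : (p : ℕ) → Ω → Param m q p} (hθmeas : ∀ p, AEMeasurable (θHat p) μ)
    (hθHat : ∀ p, ∀ᵐ ω ∂μ, IsERM (fun i => D i ω) r p (θHat p ω)) :
    AEMeasurable (fun ω => orderHat (fun i => D i ω) r Cpen ρ) μ := by
  have hm := fun p => aemeasurable_empRisk (P := P) hCX hX hDmeas hDlaw (hθmeas p)
  refine ⟨fun ω => sInf {p | ∀ p', (hm p).mk _ ω + penalty (m + 1) q n Cpen ρ p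
    ≤ (hm p').mk _ ω + penalty (m + 1) q n Cpen ρ p'}, measurable_sInf_nat fun p => ?_, ?_⟩
  · have e : {ω | ∀ p', (hm p).mk _ ω + penalty (m + 1) q n Cpen ρ p
        ≤ (hm p').mk _ ω + penalty (m + 1) q n Cpen ρ p'}
        = ⋂ p', {ω | (hm p).mk _ ω + penalty (m + 1) q n Cpen ρ p
        ≤ (hm p').mk _ ω + penalty (m + 1) q n Cpen ρ p'} := by
      ext ω; simp
    rw [e]
    exact MeasurableSet.iInter fun p' => measurableSet_le
      ((hm p).measurable_mk.add_const _) ((hm p').measurable_mk.add_const _)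
  · filter_upwards [ae_all_iff.2 hθHat, ae_all_iff.2 fun p => (hm p).ae_eq_mk] with ω h1 h2
    have h3 : ∀ p, empMin (fun i => D i ω) r p = (hm p).mk _ ω := fun p => by
      rw [(h1 p).empMin_eq]; exact h2 p
    simp only [orderHat, h3]

theorem aemeasurable_apply_nat {Ω β : Type*} [MeasurableSpace Ω] [MeasurableSpace β]
    {μ : Measure Ω} {G : ℕ → Ω → β} (hG : ∀ p, AEMeasurable (G p) μ) {N : Ω → ℕ}
    (hN : AEMeasurable N μ) : AEMeasurable (fun ω => G (N ω) ω) μ := by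
  have h : Measurable fun z : ℕ × Ω => (hG z.1).mk _ z.2 :=
    measurable_from_prod_countable_right fun p => (hG p).measurable_mk
  refine ⟨fun ω => (hG (hN.mk N ω)).mk _ ω, h.comp (hN.measurable_mk.prodMk measurable_id), ?_⟩
  filter_upwards [hN.ae_eq_mk, ae_all_iff.2 fun p => (hG p).ae_eq_mk] with ω h1 h2
  rw [h1, h2]

/-! ### The minimal order and the gap -/

/-- With no space coordinates there is a single path, all signature terms are constants, and the
intercept absorbs them. This covers the dimension `d = 1`, where signature dimensions do not grow
geometrically. -/
theorem pStar_eq_zero_of_trivial {P : Measure (Obs 0 q T)} {pStar : ℕ}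
    (hpStar : IsLeast {p | ∃ θ : Param 0 q p, popRisk P p θ = infRisk P} pStar) :
    pStar = 0 := by
  obtain ⟨θ, hθ⟩ := hpStar.1
  refine Nat.le_zero.1 (hpStar.2 ⟨Sum.elim
    (fun _ => ∑ w, truncSig pStar (0 : CPath 0 T) w * θ (Sum.inl w)) (fun l => θ (Sum.inr l)), ?_⟩)
  rw [← hθ, popRisk, popRisk]
  congr 1
  ext o
  congr 1
  have hx : o.1 = 0 := by ext t i; exact i.elim0
  rw [linPred, linPred, Fintype.sum_sum_type, Fintype.sum_sum_type, hx]
  simp only [Sum.elim_inl, Sum.elim_inr]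
  congr 1
  rw [Fintype.sum_sigma]
  simp [truncSig, iterInt]

/-- Compactness of the ball makes the minimum at order `pStar - 1` attained, so equality would
exhibit a smaller sufficient order. -/
theorem gap_pos {P : Measure (Obs m q T)} [IsProbabilityMeasure P] {CX Cz : ℝ} (hCX : 0 < CX)
    (hCz : 0 < Cz) (hX : ∀ᵐ o ∂P, eVariationOn o.1 univ < ENNReal.ofReal CX)
    (hz : ∀ᵐ o ∂P, ‖o.2.1‖ < Cz) {pStar : ℕ}
    (hpStar : IsLeast {p | ∃ θ : Param m q p, popRisk P p θ = infRisk P} pStar)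
    (h0 : pStar ≠ 0) {r : ℝ} (hr : 0 ≤ r) : infRisk P < popMin P r (pStar - 1) := by
  obtain ⟨θ, -, hθ⟩ := exists_popMin_eq (P := P) hCX hCz hX hz (pStar - 1) hr
  rw [hθ]
  refine lt_of_le_of_ne (infRisk_le P _ θ) fun h => ?_
  have := hpStar.2 ⟨θ, h.symm⟩
  omega

end Order

/-! ### Constants -/

/-- With `Y = G X s / K²`, the sample size condition makes `Y` at least `10 ^ 6` times the
dimension. The prefactor, bounded by its exponential, then uses a negligible share of `Y / 512`; the
rest covers `Y / 9216` twice, once for summability over orders and once for the rate in `n`. -/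
theorem overshoot_exponent_le {G K X s s₁ D Q a b : ℝ} (hK : 0 < K) (hG : 0 < G) (hX : 1 ≤ X)
    (hD : 1 ≤ D) (hD₁ : D ≤ s₁) (hs : s₁ ≤ s) (hQ : 0 ≤ Q)
    (hb : 10 ^ 6 * K ^ 2 * (s₁ + Q) ≤ G * X * D) (ha : a ≤ G / (9216 * K ^ 2))
    (hb' : b ≤ G / (9216 * K ^ 2)) :
    4 * (s + Q) * Real.exp (-(G * X * s / (512 * K ^ 2))) ≤ Real.exp (-a * s) * Real.exp (-b * X) := by
  have hs0 : 1 ≤ s := hD.trans (hD₁.trans hs)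
  have hs₁ : 0 < s₁ := by linarith
  set Y := G * X * s / K ^ 2 with hY
  have hY0 : 0 < Y := by positivity
  have h1 : 10 ^ 6 * (s + Q) ≤ Y := by
    rw [hY, le_div_iff₀ (by positivity)]
    have h2 : G * X * D ≤ G * X * s₁ := by gcongr
    have h3 : 10 ^ 6 * K ^ 2 * (s₁ + Q) * s ≤ G * X * s₁ * s :=
      mul_le_mul_of_nonneg_right (hb.trans h2) (by linarith)
    have h4 : s₁ * (10 ^ 6 * (s + Q) * K ^ 2) ≤ s₁ * (G * X * s) := by
      have h5 : Q * s₁ ≤ Q * s := mul_le_mul_of_nonneg_left hs hQ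
      have h6 : 0 < K ^ 2 := by positivity
      nlinarith [mul_le_mul_of_nonneg_left h5 h6.le]
    exact le_of_mul_le_mul_left h4 hs₁
  have h2 : a * s ≤ Y / 9216 := by
    calc a * s ≤ G / (9216 * K ^ 2) * s := mul_le_mul_of_nonneg_right ha (by linarith)
      _ = G * 1 * s / K ^ 2 / 9216 := by field_simp
      _ ≤ Y / 9216 := by rw [hY]; gcongr
  have h3 : b * X ≤ Y / 9216 := by
    calc b * X ≤ G / (9216 * K ^ 2) * X := mul_le_mul_of_nonneg_right hb' (by linarith)
      _ = G * X * 1 / K ^ 2 / 9216 := by field_simp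
      _ ≤ Y / 9216 := by rw [hY]; gcongr
  have h4 : G * X * s / (512 * K ^ 2) = Y / 512 := by rw [hY]; field_simp
  have h5 : 4 * (s + Q) ≤ Real.exp (4 * (s + Q)) := by
    linarith [Real.add_one_le_exp (4 * (s + Q))]
  rw [h4]
  refine (mul_le_mul_of_nonneg_right h5 (Real.exp_pos _).le).trans ?_
  rw [← Real.exp_add, ← Real.exp_add, Real.exp_le_exp]
  linarith

theorem undershoot_exponent_le {K N n g X b : ℝ} (hK : 0 < K) (hn : 0 ≤ n)
    (hX : X ≤ n) (hb : 10 ^ 6 * K ^ 2 * N ≤ n * g ^ 2) (hb' : b ≤ g ^ 2 / (36864 * K ^ 2))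
    (hX0 : 0 ≤ X) :
    4 * N * Real.exp (-(n * g ^ 2 / (128 * K ^ 2))) ≤ Real.exp (-b * X) := by
  set Y := n * g ^ 2 / K ^ 2 with hY
  have hY0 : 0 ≤ Y := by positivity
  have h1 : 10 ^ 6 * N ≤ Y := by
    rw [hY, le_div_iff₀ (by positivity)]
    linarith
  have h3 : b * X ≤ Y / 36864 := by
    calc b * X ≤ g ^ 2 / (36864 * K ^ 2) * X := mul_le_mul_of_nonneg_right hb' hX0
      _ = X * g ^ 2 / K ^ 2 / 36864 := by field_simp
      _ ≤ Y / 36864 := by rw [hY]; gcongr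
  have h4 : n * g ^ 2 / (128 * K ^ 2) = Y / 128 := by rw [hY]; field_simp
  have h5 : 4 * N ≤ Real.exp (4 * N) := by linarith [Real.add_one_le_exp (4 * N)]
  rw [h4]
  refine (mul_le_mul_of_nonneg_right h5 (Real.exp_pos _).le).trans ?_
  rw [← Real.exp_add, Real.exp_le_exp]
  linarith

section Constants

variable {d q pStar : ℕ} {r C Cpen gap : ℝ}

theorem c0_pos (hd : 0 < d) (hr : 0 < r) (hC : 0 < C) (hCpen : 0 < Cpen) :
    0 < c0 d q pStar r C Cpen := by
  have : 0 < sigDim d (pStar + 1) := (Nat.succ_pos _).trans_le (succ_le_sigDim hd _)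
  unfold c0
  positivity

theorem pow_le_sigDim (d p : ℕ) : d ^ p ≤ sigDim d p :=
  Finset.single_le_sum (f := fun k => d ^ k) (fun _ _ => Nat.zero_le _)
    (Finset.mem_range.2 (Nat.lt_succ_self p))

/-- Dropping the `+ 1` leaves `256 * 36 = 9216`, and `d ^ (pStar + 1)` is one of the terms of the
dimension. The left side is `c0`, and also the first candidate in `c2`. -/
theorem penalty_const_le (hd : 0 < d) (hr : 0 < r) (hC : 0 < C) :
    Cpen ^ 2 * (d : ℝ) ^ (pStar + 1) * Real.exp q /
      (256 * r * C * (36 * r * C + 1) * sigDim d (pStar + 1))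
      ≤ Cpen ^ 2 * Real.exp q / (9216 * (r * C) ^ 2) := by
  have h0 : 0 < sigDim d (pStar + 1) := (Nat.succ_pos _).trans_le (succ_le_sigDim hd _)
  have h1 : (0 : ℝ) < sigDim d (pStar + 1) := by exact_mod_cast h0
  have h2 : (d : ℝ) ^ (pStar + 1) ≤ sigDim d (pStar + 1) := by
    exact_mod_cast pow_le_sigDim d (pStar + 1)
  have hK : 0 < r * C := mul_pos hr hC
  calc _ ≤ Cpen ^ 2 * (sigDim d (pStar + 1) : ℝ) * Real.exp q /
      (256 * r * C * (36 * r * C + 1) * sigDim d (pStar + 1)) := by gcongr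
    _ = Cpen ^ 2 * Real.exp q / (256 * r * C * (36 * r * C + 1)) := by field_simp
    _ ≤ _ := by
      refine div_le_div_of_nonneg_left (by positivity) (by positivity) ?_
      linarith

theorem c2_le_left (hd : 0 < d) (hr : 0 < r) (hC : 0 < C) :
    c2 d q pStar r C Cpen gap ≤ Cpen ^ 2 * Real.exp q / (9216 * (r * C) ^ 2) := by
  refine le_trans ?_ (penalty_const_le (pStar := pStar) hd hr hC)
  have hs : 0 < sigDim d (pStar + 1) := (Nat.succ_pos _).trans_le (succ_le_sigDim hd _)
  have e : Cpen ^ 2 * (d : ℝ) ^ (pStar + 1) * Real.exp q /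
      (256 * r * C * (36 * r * C + 1) * sigDim d (pStar + 1))
      = 1 / (256 * r * C * (36 * r * C + 1)) *
        (Cpen ^ 2 * (d : ℝ) ^ (pStar + 1) * Real.exp q / sigDim d (pStar + 1)) := by
    field_simp
  rw [e, c2]
  refine mul_le_mul_of_nonneg_left ?_ (by positivity)
  split_ifs
  · exact le_rfl
  · exact min_le_left _ _

theorem c2_le_right (hr : 0 < r) (hC : 0 < C) (h0 : pStar ≠ 0) :
    c2 d q pStar r C Cpen gap ≤ gap ^ 2 / (36864 * (r * C) ^ 2) := by
  have hK : 0 < r * C := mul_pos hr hC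
  rw [c2, if_neg h0]
  calc _ ≤ 1 / (256 * r * C * (36 * r * C + 1)) * (gap ^ 2 / 4) :=
        mul_le_mul_of_nonneg_left (min_le_right _ _) (by positivity)
    _ = gap ^ 2 / (4 * (256 * r * C * (36 * r * C + 1))) := by field_simp
    _ ≤ _ := by
      refine div_le_div_of_nonneg_left (by positivity) (by positivity) ?_
      linarith

/-- The consequences of the sample size condition. -/
theorem sample_size_bounds {n : ℕ} {ρ : ℝ} (hd : 0 < d) (hr : 0 < r) (hC : 0 < C)
    (hCpen : 0 < Cpen) (hρ : ρ ∈ Ioo (0 : ℝ) (1 / 2)) (hgap : pStar ≠ 0 → 0 < gap)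
    (hn : nStar d q pStar r C Cpen ρ gap ≤ n) :
    0 < n ∧
    10 ^ 6 * (r * C) ^ 2 * ((sigDim d (pStar + 1) : ℝ) + q)
      ≤ Cpen ^ 2 * Real.exp q * (n : ℝ) ^ (1 - 2 * ρ) * (d : ℝ) ^ (pStar + 1) ∧
    (pStar ≠ 0 → 10 ^ 6 * (r * C) ^ 2 * ((sigDim d pStar : ℝ) + q) ≤ n * gap ^ 2) ∧
    (pStar ≠ 0 → penalty d q n Cpen ρ pStar ≤ gap / 2) := by
  have hK : 0 < r * C := mul_pos hr hC
  have hτ : 0 < min ρ (1 / 2 - ρ) := lt_min hρ.1 (by linarith [hρ.2])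
  set τ := min ρ (1 / 2 - ρ) with hτ_def
  set t : ℝ := (n : ℝ) ^ τ with ht
  have hs0 : (0 : ℝ) < sigDim d (pStar + 1) := by
    exact_mod_cast (Nat.succ_pos _).trans_le (succ_le_sigDim hd (pStar + 1))
  have hthr : thresholdBound d q pStar r C Cpen gap ≤ t := by
    have hne : {k : ℕ | thresholdBound d q pStar r C Cpen gap ≤ (k : ℝ) ^ τ}.Nonempty := by
      have := ((tendsto_rpow_atTop hτ).comp tendsto_natCast_atTop_atTop).eventually_ge_atTop
        (thresholdBound d q pStar r C Cpen gap)
      exact this.exists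
    have h1 : thresholdBound d q pStar r C Cpen gap
        ≤ (nStar d q pStar r C Cpen ρ gap : ℝ) ^ τ := Nat.sInf_mem hne
    refine h1.trans (Real.rpow_le_rpow (by positivity) (by exact_mod_cast hn) hτ.le)
  set a0 := 432 * √Real.pi * r * C with ha0
  set b0 := Cpen * √(Real.exp q) with hb0
  set g : ℝ := if pStar = 0 then 0 else 2 * √((sigDim d (pStar + 1) : ℝ) + q) / gap with hg
  set h : ℝ := √(2 * (sigDim d (pStar + 1) : ℝ) + 2 * q) /
        (Cpen * √(Real.exp q * (d : ℝ) ^ (pStar + 1))) with hh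
  have hthr' : (a0 + b0) * (g + h) ≤ t := hthr
  have ha0p : 0 < a0 := by positivity
  have hb0p : 0 < b0 := by positivity
  have hg0 : 0 ≤ g := by
    rw [hg]
    split_ifs with h0
    · exact le_rfl
    · have := hgap h0
      positivity
  have hh0 : 0 < h := by positivity
  -- All four products are nonnegative, so each is bounded by `t` separately; the conclusions use
  -- `a0 * h`, `a0 * g` and `b0 * g`, and `b0 * h` is not needed.
  have e1 : (a0 + b0) * (g + h) = a0 * g + a0 * h + b0 * g + b0 * h := by ring
  rw [e1] at hthr'
  have n1 : 0 ≤ a0 * g := by positivity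
  have n2 : 0 < a0 * h := by positivity
  have n3 : 0 ≤ b0 * g := by positivity
  have n4 : 0 < b0 * h := by positivity
  have hn0 : 0 < n := by
    rcases Nat.eq_zero_or_pos n with h0 | h0
    · rw [ht, h0, Nat.cast_zero, Real.zero_rpow hτ.ne'] at hthr'
      linarith
    · exact h0
  have hn1 : (1 : ℝ) ≤ n := by exact_mod_cast hn0
  have hnp : (0 : ℝ) < n := by linarith
  have t1 : t ≤ (n : ℝ) ^ ρ := Real.rpow_le_rpow_of_exponent_le hn1 (min_le_left _ _)
  have t2 : t ≤ (n : ℝ) ^ (1 / 2 - ρ) := Real.rpow_le_rpow_of_exponent_le hn1 (min_le_right _ _)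
  have t3 : t ≤ (n : ℝ) ^ (1 / 2 : ℝ) :=
    t2.trans (Real.rpow_le_rpow_of_exponent_le hn1 (by linarith [hρ.1]))
  have hsq : ∀ y : ℝ, ((n : ℝ) ^ y) ^ 2 = (n : ℝ) ^ (2 * y) := fun y => by
    rw [mul_comm, Real.rpow_mul hnp.le, Real.rpow_two]
  -- `432² = 186624`, and `π > 3` triples it. Twice the result exceeds `10 ^ 6`, the margin that the
  -- exponent estimates rely on.
  have ha0sq : 559872 * (r * C) ^ 2 ≤ a0 ^ 2 := by
    have : a0 ^ 2 = 186624 * Real.pi * (r * C) ^ 2 := by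
      rw [ha0, mul_pow, mul_pow, mul_pow, Real.sq_sqrt Real.pi_pos.le]; ring
    rw [this]
    nlinarith [Real.pi_gt_three, sq_nonneg (r * C)]
  have hs1 : (0 : ℝ) ≤ (sigDim d (pStar + 1) : ℝ) + q := by positivity
  clear_value a0
  refine ⟨hn0, ?_, fun h0 => ?_, fun h0 => ?_⟩
  · have h1 : (a0 * h) ^ 2 ≤ (n : ℝ) ^ (1 - 2 * ρ) := by
      have h2 : a0 * h ≤ (n : ℝ) ^ (1 / 2 - ρ) := by linarith
      have h3 := pow_le_pow_left₀ n2.le h2 2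
      rwa [hsq, show 2 * (1 / 2 - ρ) = 1 - 2 * ρ by ring] at h3
    have hD : (0 : ℝ) < (d : ℝ) ^ (pStar + 1) := by positivity
    have h4 : (a0 * h) ^ 2 = a0 ^ 2 * (2 * ((sigDim d (pStar + 1) : ℝ) + q)) /
        (Cpen ^ 2 * Real.exp q * (d : ℝ) ^ (pStar + 1)) := by
      rw [hh, mul_pow, div_pow, mul_pow, Real.sq_sqrt (by positivity),
        Real.sq_sqrt (by positivity), ← mul_div_assoc]
      ring_nf
    rw [h4, div_le_iff₀ (by positivity)] at h1
    have h5 := mul_le_mul_of_nonneg_right ha0sq hs1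
    have h6 : 0 ≤ (r * C) ^ 2 * ((sigDim d (pStar + 1) : ℝ) + q) := by positivity
    linarith
  · have hgp := hgap h0
    have h1 : (a0 * g) ^ 2 ≤ n := by
      have h2 : a0 * g ≤ (n : ℝ) ^ (1 / 2 : ℝ) := by linarith
      have h3 := pow_le_pow_left₀ n1 h2 2
      rwa [hsq, show 2 * (1 / 2 : ℝ) = 1 by norm_num, Real.rpow_one] at h3
    have h4 : (a0 * g) ^ 2 = a0 ^ 2 * (4 * ((sigDim d (pStar + 1) : ℝ) + q)) / gap ^ 2 := by
      rw [hg, if_neg h0, mul_pow, div_pow, mul_pow, Real.sq_sqrt hs1, ← mul_div_assoc]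
      norm_num
    rw [h4, div_le_iff₀ (by positivity)] at h1
    have h5 := mul_le_mul_of_nonneg_right ha0sq hs1
    have h7 : (sigDim d pStar : ℝ) ≤ sigDim d (pStar + 1) := by
      exact_mod_cast sigDim_mono d (Nat.le_succ pStar)
    have h6 : (r * C) ^ 2 * ((sigDim d pStar : ℝ) + q)
        ≤ (r * C) ^ 2 * ((sigDim d (pStar + 1) : ℝ) + q) := by gcongr
    have h8 : 0 ≤ (r * C) ^ 2 * ((sigDim d (pStar + 1) : ℝ) + q) := by positivity
    linarith
  · have hgp := hgap h0
    have h2 : b0 * g ≤ (n : ℝ) ^ ρ := by linarith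
    rw [hg, if_neg h0, ← mul_div_assoc, div_le_iff₀ hgp] at h2
    have h7 : (sigDim d pStar : ℝ) ≤ (sigDim d (pStar + 1) : ℝ) + q := by
      have : (sigDim d pStar : ℝ) ≤ sigDim d (pStar + 1) := by
        exact_mod_cast sigDim_mono d (Nat.le_succ pStar)
      have : (0 : ℝ) ≤ q := by positivity
      linarith
    have h8 := mul_le_mul_of_nonneg_left (Real.sqrt_le_sqrt h7) hb0p.le
    rw [penalty, div_le_iff₀ (by positivity), Real.sqrt_mul (by positivity)]
    have h9 : Cpen * (√(sigDim d pStar : ℝ) * √(Real.exp q)) = b0 * √(sigDim d pStar : ℝ) := by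
      rw [hb0]; ring
    rw [h9]
    linarith

/-- The factor `8` is twice the mean deviation constant `3` plus a slack of `1`; it is well below
the `36` of `c3`. -/
theorem expectation_const_le (n : ℕ) (hr : 0 < r) (hC : 0 < C) :
    8 * (r * C) * √(((sigDim d pStar : ℝ) + q) / n) ≤ c3 d q pStar r C / √(n : ℝ) := by
  have hK : 0 < r * C := mul_pos hr hC
  rw [Real.sqrt_div (by positivity), ← mul_div_assoc, c3]
  refine div_le_div_of_nonneg_right (mul_le_mul_of_nonneg_right ?_ (Real.sqrt_nonneg _))
    (Real.sqrt_nonneg _)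
  have h1 : 1 ≤ √Real.pi := Real.one_le_sqrt.2 (by linarith [Real.pi_gt_three])
  have h2 : (1 : ℝ) ≤ pStar + 1 := by
    have : (0 : ℝ) ≤ pStar := by positivity
    linarith
  have h3 : 1 ≤ √Real.pi * (pStar + 1) := one_le_mul_of_one_le_of_one_le h1 h2
  nlinarith

end Constants

/-! ### Probability of selecting a wrong order -/

section WrongOrder

variable {m q : ℕ} {T : ℝ≥0} {P : Measure (Obs m q T)} [IsProbabilityMeasure P] {CX Cz : ℝ}
  {Ω : Type*} [MeasurableSpace Ω] {μ : Measure Ω} [IsProbabilityMeasure μ] {n : ℕ}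
  {D : Fin n → Ω → Obs m q T} {r Cpen ρ : ℝ} {θHat : (p : ℕ) → Ω → Param m q p} {pStar : ℕ}
  {θStar : Param m q pStar}

/-- Overshooting needs `pen / 4 ≤ 2 * (W + pen / 16)`, hence `W ≥ pen / 16`; squaring in the tail
bound produces `512 = 2 * 16²`. -/
theorem measure_orderHat_eq_le (hCX : 0 < CX) (hCz : 0 < Cz)
    (hX : ∀ᵐ o ∂P, eVariationOn o.1 univ < ENNReal.ofReal CX) (hz : ∀ᵐ o ∂P, ‖o.2.1‖ < Cz)
    (hn : 0 < n) (hDmeas : ∀ i, Measurable (D i)) (hDlaw : ∀ i, μ.map (D i) = P)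
    (hDindep : iIndepFun D μ) (hr : 0 < r) (hCpen : 0 < Cpen)
    (hθHat : ∀ p, ∀ᵐ ω ∂μ, IsERM (fun i => D i ω) r p (θHat p ω))
    (hθr : θStar ∈ l1Ball m q pStar r) (hθStar : popRisk P pStar θStar = infRisk P)
    (h2 : sigDim (m + 1) (pStar + 1) ≤ 2 * (m + 1) ^ (pStar + 1)) {p : ℕ} (hp : pStar < p) :
    μ.real {ω | orderHat (fun i => D i ω) r Cpen ρ = p} ≤ 4 * ((sigDim (m + 1) p : ℝ) + q) *
      Real.exp (-(Cpen ^ 2 * Real.exp q * (n : ℝ) ^ (1 - 2 * ρ) * sigDim (m + 1) p /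
        (512 * (r * constC Cz CX T) ^ 2))) := by
  have hn' : (0 : ℝ) < n := by exact_mod_cast hn
  have hC0 : 0 < constC Cz CX T := constC_pos hCz
  set pen := penalty (m + 1) q n Cpen ρ p with hpen
  have hpen0 : 0 < pen := penalty_pos (Nat.succ_pos m) hn hCpen
  obtain ⟨W, hWi, hW0, hWd, hWt, -⟩ := exists_risk_deviation hCX hCz hX hz hn hDmeas hDlaw
    hDindep hr p (δ := pen / 16) (by positivity)
  have hsub : μ.real {ω | orderHat (fun i => D i ω) r Cpen ρ = p}
      ≤ μ.real {ω | pen / 16 ≤ W ω} := by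
    refine ENNReal.toReal_mono (measure_ne_top _ _) (measure_mono_ae ?_)
    filter_upwards [hWd, hθHat p] with ω h3 h4 h5
    have h6 := penalty_sub_le_of_orderHat hn hCpen hp h5 hθr hθStar h4 h3
    have h7 := penalty_sub_ge (q := q) (n := n) (ρ := ρ) hCpen h2 hp
    change pen / 16 ≤ W ω
    rw [← hpen] at h6 h7
    linarith
  refine (hsub.trans (hWt _ (by positivity))).trans (le_of_eq ?_)
  congr 3
  have hsq : pen ^ 2 * n = Cpen ^ 2 * Real.exp q * (n : ℝ) ^ (1 - 2 * ρ) * sigDim (m + 1) p := by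
    have e1 : ((n : ℝ) ^ ρ) ^ 2 = (n : ℝ) ^ (2 * ρ) := by
      rw [mul_comm, Real.rpow_mul hn'.le, Real.rpow_two]
    rw [hpen, penalty, div_pow, mul_pow, Real.sq_sqrt (by positivity), e1,
      Real.rpow_sub hn', Real.rpow_one]
    field_simp
  rw [← hsq]
  field_simp
  norm_num

/-- Half of the gap is spent on the penalty. With slack `gap / 8` the other half forces `W ≥ gap /
8`, and `128 = 2 * 8²`. -/
theorem measure_orderHat_lt_le (hCX : 0 < CX) (hCz : 0 < Cz)
    (hX : ∀ᵐ o ∂P, eVariationOn o.1 univ < ENNReal.ofReal CX) (hz : ∀ᵐ o ∂P, ‖o.2.1‖ < Cz)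
    (hn : 0 < n) (hDmeas : ∀ i, Measurable (D i)) (hDlaw : ∀ i, μ.map (D i) = P)
    (hDindep : iIndepFun D μ) (hr : 0 < r) (hCpen : 0 < Cpen)
    (hθHat : ∀ p, ∀ᵐ ω ∂μ, IsERM (fun i => D i ω) r p (θHat p ω))
    (hθr : θStar ∈ l1Ball m q pStar r) {gap : ℝ}
    (hgap : gap = popMin P r (pStar - 1) - popRisk P pStar θStar) (hgap0 : 0 < gap)
    (hpen : penalty (m + 1) q n Cpen ρ pStar ≤ gap / 2) :
    μ.real {ω | orderHat (fun i => D i ω) r Cpen ρ < pStar} ≤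
      4 * ((sigDim (m + 1) pStar : ℝ) + q) *
        Real.exp (-(n * gap ^ 2 / (128 * (r * constC Cz CX T) ^ 2))) := by
  have hC0 : 0 < constC Cz CX T := constC_pos hCz
  obtain ⟨W, hWi, hW0, hWd, hWt, -⟩ := exists_risk_deviation hCX hCz hX hz hn hDmeas hDlaw
    hDindep hr pStar (δ := gap / 8) (by positivity)
  have hsub : μ.real {ω | orderHat (fun i => D i ω) r Cpen ρ < pStar}
      ≤ μ.real {ω | gap / 8 ≤ W ω} := by
    refine ENNReal.toReal_mono (measure_ne_top _ _) (measure_mono_ae ?_)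
    filter_upwards [hWd, ae_all_iff.2 hθHat] with ω h3 h4 h5
    have h6 := gap_le_of_orderHat hn hCpen h5 rfl hθr (h4 _) h3
    change gap / 8 ≤ W ω
    rw [← hgap] at h6
    linarith
  refine (hsub.trans (hWt _ (by positivity))).trans (le_of_eq ?_)
  congr 3
  field_simp
  norm_num

/-- The probability that the selected order differs from the minimal one. -/
theorem measure_orderHat_ne_le (hCX : 0 < CX) (hCz : 0 < Cz)
    (hX : ∀ᵐ o ∂P, eVariationOn o.1 univ < ENNReal.ofReal CX) (hz : ∀ᵐ o ∂P, ‖o.2.1‖ < Cz)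
    (hDmeas : ∀ i, Measurable (D i)) (hDlaw : ∀ i, μ.map (D i) = P)
    (hDindep : iIndepFun D μ) (hr : 0 < r) (hCpen : 0 < Cpen) (hρ : ρ ∈ Ioo (0 : ℝ) (1 / 2))
    (hθHat : ∀ p, ∀ᵐ ω ∂μ, IsERM (fun i => D i ω) r p (θHat p ω))
    (hpStar : IsLeast {p | ∃ θ : Param m q p, popRisk P p θ = infRisk P} pStar)
    (hθr : θStar ∈ l1Ball m q pStar r) (hθStar : popRisk P pStar θStar = infRisk P)
    {C gap : ℝ} (hC : C = constC Cz CX T)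
    (hgap : gap = popMin P r (pStar - 1) - popRisk P pStar θStar)
    (hn : nStar (m + 1) q pStar r C Cpen ρ gap ≤ n) :
    μ.real {ω | orderHat (fun i => D i ω) r Cpen ρ ≠ pStar} ≤ c1 (m + 1) q pStar r C Cpen *
      Real.exp (-c2 (m + 1) q pStar r C Cpen gap * (n : ℝ) ^ (1 - 2 * ρ)) := by
  have hd : 0 < m + 1 := Nat.succ_pos m
  have hC0 : 0 < C := hC ▸ constC_pos hCz
  have hK : 0 < r * C := mul_pos hr hC0
  have hgap0 : pStar ≠ 0 → 0 < gap := fun h0 => by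
    have := gap_pos hCX hCz hX hz hpStar h0 hr.le
    rw [hgap, hθStar]
    linarith
  obtain ⟨hn0, hb1, hb2, hb3⟩ := sample_size_bounds hd hr hC0 hCpen hρ hgap0 hn
  have hn1 : (1 : ℝ) ≤ n := by exact_mod_cast hn0
  -- The one-dimensional case is admissible because there the minimal order is zero.
  have hdim : sigDim (m + 1) (pStar + 1) ≤ 2 * (m + 1) ^ (pStar + 1) := by
    refine sigDim_succ_le_two_mul hd ?_
    rcases Nat.eq_zero_or_pos m with h | h
    · subst h
      exact Or.inr (pStar_eq_zero_of_trivial hpStar)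
    · exact Or.inl (by omega)
  set X : ℝ := (n : ℝ) ^ (1 - 2 * ρ) with hXdef
  have hX1 : 1 ≤ X := Real.one_le_rpow hn1 (by linarith [hρ.2])
  have hXn : X ≤ n := by
    have := Real.rpow_le_rpow_of_exponent_le hn1 (show 1 - 2 * ρ ≤ 1 by linarith [hρ.1])
    rwa [Real.rpow_one] at this
  set a := c0 (m + 1) q pStar r C Cpen with ha
  set b := c2 (m + 1) q pStar r C Cpen gap with hb
  have ha0 : 0 < a := c0_pos hd hr hC0 hCpen
  have hover : ∀ k : ℕ, μ {ω | orderHat (fun i => D i ω) r Cpen ρ = pStar + 1 + k}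
      ≤ ENNReal.ofReal (Real.exp (-a * sigDim (m + 1) (pStar + 1 + k)) * Real.exp (-b * X)) := by
    intro k
    have h1 := measure_orderHat_eq_le (ρ := ρ) hCX hCz hX hz hn0 hDmeas hDlaw hDindep hr hCpen hθHat
      hθr hθStar hdim (show pStar < pStar + 1 + k by omega)
    rw [← hC] at h1
    have hD1 : (1 : ℝ) ≤ ((m + 1 : ℕ) : ℝ) ^ (pStar + 1) := by
      exact_mod_cast Nat.one_le_pow _ _ hd
    have hDs : ((m + 1 : ℕ) : ℝ) ^ (pStar + 1) ≤ (sigDim (m + 1) (pStar + 1) : ℝ) := by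
      exact_mod_cast pow_le_sigDim (m + 1) (pStar + 1)
    have hss : (sigDim (m + 1) (pStar + 1) : ℝ) ≤ sigDim (m + 1) (pStar + 1 + k) := by
      exact_mod_cast sigDim_mono (m + 1) (Nat.le_add_right _ _)
    have h3 := overshoot_exponent_le (Q := q) (b := b) (a := a) hK
      (show 0 < Cpen ^ 2 * Real.exp q by positivity) hX1 hD1 hDs hss (by positivity) hb1
      (penalty_const_le hd hr hC0) (c2_le_left hd hr hC0)
    rw [← ofReal_measureReal]
    exact ENNReal.ofReal_le_ofReal (h1.trans h3)
  have hunder : μ {ω | orderHat (fun i => D i ω) r Cpen ρ < pStar}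
      ≤ ENNReal.ofReal (148 * pStar * Real.exp (-b * X)) := by
    rcases Nat.eq_zero_or_pos pStar with h0 | h0
    · simp [h0]
    · have h1 := measure_orderHat_lt_le hCX hCz hX hz hn0 hDmeas hDlaw hDindep hr hCpen hθHat
        hθr hgap (hgap0 h0.ne') (hb3 h0.ne')
      rw [← hC] at h1
      have h3 := undershoot_exponent_le hK (by linarith) hXn (hb2 h0.ne')
        (c2_le_right (d := m + 1) (q := q) (Cpen := Cpen) hr hC0 h0.ne') (by linarith)
      rw [← hb] at h3
      have h4 : (1 : ℝ) ≤ 148 * pStar := by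
        have : (1 : ℝ) ≤ pStar := by exact_mod_cast h0
        linarith
      rw [← ofReal_measureReal]
      refine ENNReal.ofReal_le_ofReal (h1.trans (h3.trans ?_))
      exact le_mul_of_one_le_left (Real.exp_pos _).le h4
  obtain ⟨hsum, hle⟩ := tsum_exp_sigDim_shift_le hd ha0 pStar
  -- Undershooting is one event, while overshooting is a countable union whose probabilities are
  -- dominated by the series in `c1`.
  have hcover : {ω | orderHat (fun i => D i ω) r Cpen ρ ≠ pStar}
      ⊆ {ω | orderHat (fun i => D i ω) r Cpen ρ < pStar}
        ∪ ⋃ k : ℕ, {ω | orderHat (fun i => D i ω) r Cpen ρ = pStar + 1 + k} := by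
    intro ω hω
    rcases lt_or_gt_of_ne (show orderHat (fun i => D i ω) r Cpen ρ ≠ pStar from hω) with h | h
    · exact Or.inl h
    · refine Or.inr (mem_iUnion.2 ⟨orderHat (fun i => D i ω) r Cpen ρ - (pStar + 1), ?_⟩)
      change orderHat (fun i => D i ω) r Cpen ρ = _
      omega
  set S := ∑' p : ℕ, Real.exp (-a * sigDim (m + 1) (p + 1)) with hS
  have hS0 : 0 ≤ S := tsum_nonneg fun _ => (Real.exp_pos _).le
  have hE := Real.exp_pos (-b * X)
  have htot : μ {ω | orderHat (fun i => D i ω) r Cpen ρ ≠ pStar}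
      ≤ ENNReal.ofReal (148 * pStar * Real.exp (-b * X) + S * Real.exp (-b * X)) := by
    refine (measure_mono hcover).trans ((measure_union_le _ _).trans ?_)
    rw [ENNReal.ofReal_add (by positivity) (by positivity)]
    refine add_le_add hunder ((measure_iUnion_le _).trans ((ENNReal.tsum_le_tsum hover).trans ?_))
    rw [← ENNReal.ofReal_tsum_of_nonneg (fun k => by positivity) (hsum.mul_right _),
      tsum_mul_right]
    exact ENNReal.ofReal_le_ofReal (mul_le_mul_of_nonneg_right hle hE.le)
  have h1 := ENNReal.toReal_le_of_le_ofReal (by positivity) htot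
  refine h1.trans ?_
  rw [c1, ← add_mul]
  refine mul_le_mul_of_nonneg_right ?_ hE.le
  linarith

end WrongOrder

end PSLR

end

/-! ### Assembly of the risk bound -/

theorem theorem4
    {m q : ℕ} {T : ℝ≥0} (hT : 0 < T)
    -- the joint law of `(X, z, y)`
    (P : Measure (PSLR.Obs m q T)) [IsProbabilityMeasure P]
    -- the model: `X` starts at a fixed point, and the log-odds of `y = 1` are `F(X) + zᵀγ`
    (x₀ : EuclideanSpace ℝ (Fin m))
    (hx₀ : ∀ᵐ o ∂P, o.1 ⟨0, le_refl 0, T.2⟩ = x₀)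
    (F : BoundedContinuousFunction (PSLR.CPath m T) ℝ) (γ : Fin q → ℝ)
    (hmodel : P[PSLR.label | MeasurableSpace.comap PSLR.covariates inferInstance]
      =ᵐ[P] fun o => Real.sigmoid (F o.1 + ∑ l, o.2.1 l * γ l))
    -- (A.1)
    (CF Cγ : ℝ) (hF : ‖F‖ < CF) (hCγ : 0 < Cγ) (hγ : ∑ l, |γ l| ≤ Cγ)
    -- (A.2)
    (CX Cz : ℝ) (hCX : 0 < CX) (hCz : 0 < Cz)
    (hX : ∀ᵐ o ∂P, eVariationOn o.1 univ < ENNReal.ofReal CX)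
    (hz : ∀ᵐ o ∂P, ‖o.2.1‖ < Cz)
    -- the minimal sufficient order `p*`, its coefficients `θ*`, and (A.3)
    (pStar : ℕ)
    (hpStar : IsLeast {p | ∃ θ : PSLR.Param m q p, PSLR.popRisk P p θ = PSLR.infRisk P} pStar)
    (θStar : PSLR.Param m q pStar)
    (hθStar : PSLR.popRisk P pStar θStar = PSLR.infRisk P)
    (r : ℝ) (hr : 0 < r) (hθr : θStar ∈ PSLR.l1Ball m q pStar r)
    -- (A.4)
    (hA4 : PSLR.minSemiRisk P CF Cγ ≤ PSLR.infRisk P)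
    -- the tuning constants of the penalty
    (Cpen ρ : ℝ) (hCpen : 0 < Cpen) (hρ : ρ ∈ Ioo (0 : ℝ) (1 / 2))
    -- an i.i.d. sample of size `n`
    {Ω : Type*} [MeasurableSpace Ω] (μ : Measure Ω) [IsProbabilityMeasure μ]
    (n : ℕ) (D : Fin n → Ω → PSLR.Obs m q T)
    (hDmeas : ∀ i, Measurable (D i)) (hDlaw : ∀ i, μ.map (D i) = P) (hDindep : iIndepFun D μ)
    -- empirical risk minimizers of all orders
    (θHat : (p : ℕ) → Ω → PSLR.Param m q p) (hθmeas : ∀ p, AEMeasurable (θHat p) μ)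
    (hθHat : ∀ p, ∀ᵐ ω ∂μ, PSLR.IsERM (fun i => D i ω) r p (θHat p ω))
    -- the constants
    (C gap : ℝ) (hC : C = PSLR.constC Cz CX T)
    (hgap : gap = PSLR.popMin P r (pStar - 1) - PSLR.popRisk P pStar θStar)
    (hn : PSLR.nStar (m + 1) q pStar r C Cpen ρ gap ≤ n) :
    let pHat : Ω → ℕ := fun ω => PSLR.orderHat (fun i => D i ω) r Cpen ρ
    Integrable (fun ω => PSLR.popRisk P (pHat ω) (θHat (pHat ω) ω)) μ ∧
    |(∫ ω, PSLR.popRisk P (pHat ω) (θHat (pHat ω) ω) ∂μ) - PSLR.minSemiRisk P CF Cγ|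
      ≤ PSLR.c3 (m + 1) q pStar r C / √(n : ℝ)
        + PSLR.c4 (m + 1) q pStar r C Cpen *
          Real.exp (-PSLR.c2 (m + 1) q pStar r C Cpen gap * (n : ℝ) ^ (1 - 2 * ρ)) := by
  intro pHat
  have hC0 : 0 < C := hC ▸ PSLR.constC_pos hCz
  have hK : 0 < r * C := mul_pos hr hC0
  have hgap0 : pStar ≠ 0 → 0 < gap := fun h0 => by
    have := PSLR.gap_pos hCX hCz hX hz hpStar h0 hr.le
    rw [hgap, hθStar]
    linarith
  obtain ⟨hn0, -, -, -⟩ :=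
    PSLR.sample_size_bounds (Nat.succ_pos m) hr hC0 hCpen hρ hgap0 hn
  have hn1 : (0 : ℝ) < n := by exact_mod_cast hn0
  have hR : PSLR.minSemiRisk P CF Cγ = PSLR.infRisk P :=
    le_antisymm hA4 (PSLR.infRisk_le_minSemiRisk hT hCX hX hCz hz hx₀
      ((norm_nonneg F).trans hF.le) hCγ.le)
  set R := PSLR.infRisk P with hRdef
  have hR0 : 0 ≤ R := hθStar ▸ PSLR.popRisk_nonneg P pStar θStar
  have hpm : AEMeasurable pHat μ :=
    PSLR.aemeasurable_orderHat hCX hX hDmeas hDlaw hθmeas hθHat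
  set g : Ω → ℝ := fun ω => PSLR.popRisk P (pHat ω) (θHat (pHat ω) ω) with hg
  set M := r * C / 2 + Real.log 2 with hM
  have hM0 : 0 ≤ M := by
    have := Real.log_nonneg one_le_two
    positivity
  have hgm : AEMeasurable g μ :=
    PSLR.aemeasurable_apply_nat (G := fun p ω => PSLR.popRisk P p (θHat p ω))
      (fun p => (PSLR.continuous_popRisk hCX hCz hX hz p).measurable.comp_aemeasurable
        (hθmeas p)) hpm
  have hERM := ae_all_iff.2 hθHat
  have hgM : ∀ᵐ ω ∂μ, g ω ≤ M := by
    filter_upwards [hERM] with ω hω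
    rw [hM, hC]
    exact PSLR.popRisk_le hCX hCz hX hz (hω (pHat ω)).1
  have hgR : ∀ ω, R ≤ g ω := fun ω => PSLR.infRisk_le P _ _
  have hgi : Integrable g μ := by
    refine Integrable.of_bound hgm.aestronglyMeasurable M ?_
    filter_upwards [hgM] with ω hω
    rw [Real.norm_eq_abs, abs_of_nonneg (hR0.trans (hgR ω))]
    exact hω
  refine ⟨hgi, ?_⟩
  rw [hR]
  have hlow : R ≤ ∫ ω, g ω ∂μ := by
    have := integral_mono (integrable_const R) hgi hgR
    simpa using this
  rw [abs_of_nonneg (by linarith)]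
  set N : ℝ := (PSLR.sigDim (m + 1) pStar : ℝ) + q with hN
  have hN0 : 0 < N := by
    have : 0 < PSLR.sigDim (m + 1) pStar :=
      (Nat.succ_pos _).trans_le (PSLR.succ_le_sigDim (Nat.succ_pos m) pStar)
    positivity
  obtain ⟨W, hWi, hW0, hWd, -, hWe⟩ := PSLR.exists_risk_deviation hCX hCz hX hz hn0 hDmeas hDlaw
    hDindep hr pStar (δ := r * C * √(N / n)) (by positivity)
  rw [← hC, ← hN] at hWe
  -- The selected order is only almost everywhere measurable, so the event of a wrong order is
  -- replaced by a measurable hull of equal measure.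
  set E : Set Ω := toMeasurable μ {ω | pHat ω ≠ pStar} with hE
  have hEm : MeasurableSet E := measurableSet_toMeasurable _ _
  have hEμ : μ.real E = μ.real {ω | pHat ω ≠ pStar} := by
    rw [Measure.real, Measure.real, hE, measure_toMeasurable]
  have hup : ∀ᵐ ω ∂μ, g ω ≤ R + 2 * (W ω + r * C * √(N / n)) + M * E.indicator 1 ω := by
    filter_upwards [hERM, hWd, hgM] with ω h1 h2 h3
    have hδ : 0 ≤ r * C * √(N / n) := by positivity
    by_cases hp : pHat ω = pStar
    · have hgp : g ω = PSLR.popRisk P pStar (θHat pStar ω) := by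
        -- The parameter type depends on the order, so the equality of orders is substituted through
        -- a generic `k`.
        have hk : ∀ k, k = pStar →
            PSLR.popRisk P k (θHat k ω) = PSLR.popRisk P pStar (θHat pStar ω) := by
          intro k hk
          rw [hk]
        exact hk _ hp
      have h4 := (abs_le.1 (h2 _ (h1 pStar).1)).1
      have h5 := (abs_le.1 (h2 _ hθr)).2
      have h6 := (h1 pStar).2 _ hθr
      have h7 : 0 ≤ M * E.indicator (1 : Ω → ℝ) ω :=
        mul_nonneg hM0 (Set.indicator_nonneg (fun _ _ => zero_le_one) ω)
      rw [hθStar] at h5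
      rw [hgp]
      linarith
    · have hmem : ω ∈ E := subset_toMeasurable μ _ hp
      rw [Set.indicator_of_mem hmem, Pi.one_apply, mul_one]
      linarith [hW0 ω]
  have hEi : Integrable (fun ω => M * E.indicator (1 : Ω → ℝ) ω) μ :=
    ((integrable_const (1 : ℝ)).indicator hEm).const_mul M
  have hWδ : Integrable (fun ω => W ω + r * C * √(N / n)) μ := hWi.add (integrable_const _)
  have hRW : Integrable (fun ω => R + 2 * (W ω + r * C * √(N / n))) μ :=
    (integrable_const R).add (hWδ.const_mul 2)
  have hint := integral_mono_ae hgi (hRW.add hEi) hup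
  simp only [Pi.add_apply] at hint
  rw [integral_add hRW hEi, integral_add (integrable_const R) (hWδ.const_mul 2),
    integral_const_mul, integral_add hWi (integrable_const _), integral_const_mul M,
    integral_indicator_one hEm, hEμ] at hint
  simp only [integral_const, probReal_univ, one_smul] at hint
  have hprob := PSLR.measure_orderHat_ne_le hCX hCz hX hz hDmeas hDlaw hDindep hr hCpen hρ hθHat
    hpStar hθr hθStar hC hgap hn
  have hc3 := PSLR.expectation_const_le (d := m + 1) (q := q) (pStar := pStar) n hr hC0
  have hexp := Real.exp_pos
    (-PSLR.c2 (m + 1) q pStar r C Cpen gap * (n : ℝ) ^ (1 - 2 * ρ))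
  set e := Real.exp (-PSLR.c2 (m + 1) q pStar r C Cpen gap * (n : ℝ) ^ (1 - 2 * ρ)) with he
  set k1 := PSLR.c1 (m + 1) q pStar r C Cpen with hk1
  have hk1e : 0 ≤ k1 * e := measureReal_nonneg.trans hprob
  have hMe : M * μ.real {ω | pHat ω ≠ pStar} ≤ M * (k1 * e) :=
    mul_le_mul_of_nonneg_left hprob hM0
  -- `c4` contains `(r * C + log 2) * c1` plus a nonnegative series, more than the `(r * C / 2 + log
  -- 2) * c1` needed.
  have hc4 : M * (k1 * e) ≤ PSLR.c4 (m + 1) q pStar r C Cpen * e := by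
    have hs : 0 ≤ ∑' k : ℕ, √((PSLR.sigDim (m + 1) (pStar + 1 + k) : ℝ) + q) *
        Real.exp (-PSLR.c0 (m + 1) q pStar r C Cpen *
          PSLR.sigDim (m + 1) (pStar + 1 + k)) := tsum_nonneg fun k => by positivity
    have h1 : 0 ≤ r * C * (2664 * √Real.pi * ∑' k : ℕ,
        √((PSLR.sigDim (m + 1) (pStar + 1 + k) : ℝ) + q) *
        Real.exp (-PSLR.c0 (m + 1) q pStar r C Cpen *
          PSLR.sigDim (m + 1) (pStar + 1 + k))) * e := by positivity
    have h2 : 0 ≤ r * C * (k1 * e) := mul_nonneg hK.le hk1e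
    rw [PSLR.c4, ← hk1, hM]
    linarith
  linarith
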